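/- **Setting.** Let $M$ be a smooth spacetime manifold (possibly with boundary or corners) of dimension $d+1$, $d\ge 2$, and $N\subset M$ an embedded $d$-dimensional hypersurface. Dynamical fields $\phi$ are sections of a natural bundle over $M$ (tensor fields, densities). Let $\mathcal F$ be an off-shell field space, invariant under infinitesimal diffeomorphisms and with no boundary conditions on the variations. Let $\delta$ and $I$ be the exterior derivative and contraction on field space; $d$, $i_\xi$, $\pounds_\xi$ those on spacetime forms. A (possibly field-dependent) vector field $\xi$ on $M$, tangent to $N$, defines $\hat\xi$ on field space by $I_{\hat\xi}\delta\phi=\pounds_\xi\phi$, and the anomaly operator is $\Delta_{\hat\xi}=L_{\hat\xi}-\pounds_\xi-I_{\widehat{\delta\xi}}$ with $L_{\hat\xi}=I_{\hat\xi}\delta+\delta I_{\hat\xi}$. Let the following be local forms, smooth in the fields. On $M$: $L'$ and $\theta'$ with $\delta L'=E\cdot\delta\phi+d\theta'$; $b'$ and $\lambda'$ with $\Delta_{\hat\xi}L'=d\Delta_{\hat\xi}b'$ and $\Delta_{\hat\xi}\theta'=\Delta_{\hat\xi}\delta b'+d\Delta_{\hat\xi}\lambda'$; and $Q_\xi$,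 linear in $\xi$, with $I_{\hat\xi}(\theta'-\delta b'-d\lambda')-i_\xi(L'-db')=dQ_\xi$ on the solution space $\mathcal S=\{E=0\}\subset\mathcal F$. On $N$ (with pullbacks to $N$ understood): $\ell',\beta',\mathcal E$ with $\theta'=-\delta\ell'+d\beta'+\mathcal E$, and $c',\gamma',\varepsilon$ with $$\beta'-\lambda'=-\delta c'+d\gamma'+\varepsilon .$$ Put $Q'_\xi=Q_\xi+i_\xi b'+I_{\hat\xi}\lambda'$, $h_\xi=Q'_\xi+i_\xi\ell'-I_{\hat\xi}\beta'$, and $\tilde h_\xi=h_\xi-\Delta_{\hat\xi}c'$. Let $\Sigma$ be a compact oriented hypersurface in $M$ (a smooth $d$-chain) whose boundary $\partial\Sigma$ is a closed cut of $N$, and put $$\tilde H_\xi=\int_{\partial\Sigma}\tilde h_\xi,\qquad \Omega=\int_\Sigma\delta\theta'-\int_{\partial\Sigma}\delta\beta',\qquad \tilde{\mathcal F}_{\hat\xi}=\int_{\partial\Sigma}\big(i_\xi\mathcal E-\Delta_{\hat\xi}\varepsilon+\tilde h_{\delta\xi}\big).$$ **Statement.** 1. On the solution space, i.e. along every smooth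 curve of solutions, $\tilde H_\xi$ is differentiable and $\delta\tilde H_\xi=-I_{\hat\xi}\Omega+\tilde{\mathcal F}_{\hat\xi}$. 2. On $\mathcal F$, $\tilde h_\xi=Q_\xi+i_\xi(\ell'+b'+dc')-I_{\hat\xi}\varepsilon+d\,(i_\xi c'-I_{\hat\xi}\gamma')$. 3. Let $e$ on $M$ and $f$ on $N$ be local, not necessarily covariant, field-dependent $(d-1)$-forms. Replace $b'\to b'+de$, $\lambda'\to\lambda'-\delta e$, $\ell'\to\ell'+df$, $\beta'\to\beta'+\delta f$, and $c'\to c'-f-e$, with $L',E,\theta',Q_\xi,\mathcal E,\gamma'$ and the corner flux $\varepsilon$ fixed. The new quantities again satisfy all the defining equations above, and on $\mathcal F$ the improved charge density changes only by an exact term, $\tilde h_\xi\to\tilde h_\xi-d\,i_\xi(e+f)$, so that the integrated improved charge $\tilde H_\xi$ is invariant. -/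

import Mathlib

open scoped ContDiff Manifold
open Set

noncomputable section

namespace CovariantPhaseSpace

/-! ### Vector fields and differential forms on manifolds with corners

As in Mathlib, the tangent space at `x` is the model space `E`, identified with it through the
preferred chart at `x`. A vector field on `M` is a function `M → E`, and a differential `k`-form
on `M` is a function `M → E [⋀^Fin k]→L[ℝ] ℝ`. -/

section Spacetime

variable {E : Type*} [NormedAddCommGroup E] [NormedSpace ℝ E]
  {H : Type*} [TopologicalSpace H] (I : ModelWithCorners ℝ E H)
  {M : Type*} [TopologicalSpace M] [ChartedSpace H M]

/-- A family `Φ s` of sections, with parameter `s` in a vector space `S`, is smooth at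
`(s₀, x₀)`: the components in the chart at `x₀` (given by `rep`) depend smoothly, and jointly, on
the parameter and on the point. -/
def SmoothFamilyAt {W W' : Type*} [NormedAddCommGroup W'] [NormedSpace ℝ W']
    {S : Type*} [NormedAddCommGroup S] [NormedSpace ℝ S]
    (rep : M → (M → W) → E → W') (Φ : S → M → W) (s₀ : S) (x₀ : M) : Prop :=
  ContDiffWithinAt ℝ ∞ (fun z : S × E ↦ rep x₀ (Φ z.1) z.2) (univ ×ˢ range I)
    (s₀, extChartAt I x₀ x₀)

/-- A single section is smooth at `x₀`. -/
def SmoothSectionAt {W W' : Type*} [NormedAddCommGroup W'] [NormedSpace ℝ W']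
    (rep : M → (M → W) → E → W') (φ : M → W) (x₀ : M) : Prop :=
  ContDiffWithinAt ℝ ∞ (rep x₀ φ) (range I) (extChartAt I x₀ x₀)

variable [IsManifold I ∞ M]

/-- The components of the vector field `X` in the chart at `x₀`. -/
def vecInChart (x₀ : M) (X : M → E) (y : E) : E :=
  let p := (extChartAt I x₀).symm y
  tangentCoordChange I p x₀ p (X p)

/-- The components of the differential form `η` in the chart at `x₀`. -/
def formInChart {k : ℕ} (x₀ : M) (η : M → E [⋀^Fin k]→L[ℝ] ℝ) (y : E) : E [⋀^Fin k]→L[ℝ] ℝ :=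
  let p := (extChartAt I x₀).symm y
  (η p).compContinuousLinearMap (tangentCoordChange I x₀ p p)

/-- `X` is a smooth vector field. -/
def SmoothVec (X : M → E) : Prop := ∀ x, SmoothSectionAt I (vecInChart I) X x

/-- `η` is a smooth differential form. -/
def SmoothForm {k : ℕ} (η : M → E [⋀^Fin k]→L[ℝ] ℝ) : Prop :=
  ∀ x, SmoothSectionAt I (formInChart I) η x

/-- The exterior derivative `d`, computed at each point in the chart at that point. -/
def extD {k : ℕ} (η : M → E [⋀^Fin k]→L[ℝ] ℝ) : M → E [⋀^Fin (k + 1)]→L[ℝ] ℝ :=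
  fun x ↦ extDerivWithin (formInChart I x η) (range I) (extChartAt I x x)

/-- The contraction `i_X η`. -/
def contract {P F : Type*} [NormedAddCommGroup F] [NormedSpace ℝ F] {k : ℕ}
    (X : P → F) (η : P → F [⋀^Fin (k + 1)]→L[ℝ] ℝ) : P → F [⋀^Fin k]→L[ℝ] ℝ :=
  fun x ↦ (η x).curryLeft (X x)

/-- The Lie derivative `£_X η = d i_X η + i_X d η` of a form of positive degree. -/
def lieForm {k : ℕ} (X : M → E) (η : M → E [⋀^Fin (k + 1)]→L[ℝ] ℝ) :
    M → E [⋀^Fin (k + 1)]→L[ℝ] ℝ :=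
  extD I (contract X η) + contract X (extD I η)

/-- The pullback of a form along `f`. -/
def pullback {F : Type*} [NormedAddCommGroup F] [NormedSpace ℝ F]
    {G : Type*} [TopologicalSpace G] (J : ModelWithCorners ℝ F G)
    {N : Type*} [TopologicalSpace N] [ChartedSpace G N]
    (f : N → M) {k : ℕ} (η : M → E [⋀^Fin k]→L[ℝ] ℝ) : N → F [⋀^Fin k]→L[ℝ] ℝ :=
  fun p ↦ (η (f p)).compContinuousLinearMap (mfderiv J I f p : F →L[ℝ] E)

end Spacetime

/-! ### Integration over smooth singular chains -/

section Chains

/-- A smooth singular `k`-cube in `M`; only the values on the unit cube matter. -/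
structure SmoothCube {E : Type*} [NormedAddCommGroup E] [NormedSpace ℝ E]
    {H : Type*} [TopologicalSpace H] (I : ModelWithCorners ℝ E H)
    (M : Type*) [TopologicalSpace M] [ChartedSpace H M] (k : ℕ) where
  toFun : (Fin k → ℝ) → M
  smooth : ContMDiffOn 𝓘(ℝ, Fin k → ℝ) I ∞ toFun (Icc 0 1)

variable {E : Type*} [NormedAddCommGroup E] [NormedSpace ℝ E]
  {H : Type*} [TopologicalSpace H] {I : ModelWithCorners ℝ E H}
  {M : Type*} [TopologicalSpace M] [ChartedSpace H M]

/-- The integral of a `k`-form over a singular `k`-cube. -/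
def SmoothCube.integral {k : ℕ} (σ : SmoothCube I M k) (η : M → E [⋀^Fin k]→L[ℝ] ℝ) : ℝ :=
  ∫ u in Icc (0 : Fin k → ℝ) 1, η (σ.toFun u)
    (fun i ↦ (mfderivWithin 𝓘(ℝ, Fin k → ℝ) I σ.toFun (Icc 0 1) u : (Fin k → ℝ) →L[ℝ] E)
      (Pi.single i 1))

/-- The face of a cube on which the `i`-th coordinate has the value `c ∈ [0, 1]`. -/
def SmoothCube.face {k : ℕ} (σ : SmoothCube I M (k + 1)) (i : Fin (k + 1)) (c : ℝ)
    (hc : c ∈ Icc (0 : ℝ) 1) : SmoothCube I M k where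
  toFun u := σ.toFun (i.insertNth c u)
  smooth := by
    have h : ContDiff ℝ ∞ (fun u : Fin k → ℝ ↦ (i.insertNth c u : Fin (k + 1) → ℝ)) := by
      rw [contDiff_pi]
      intro j
      refine Fin.succAboveCases i ?_ (fun l ↦ ?_) j
      · simpa using contDiff_const
      · simpa using contDiff_apply ℝ ℝ l
    refine σ.smooth.comp h.contMDiff.contMDiffOn ?_
    intro u hu
    refine ⟨fun j ↦ ?_, fun j ↦ ?_⟩
    · refine Fin.succAboveCases i ?_ (fun l ↦ ?_) j
      · simpa using hc.1
      · simpa using hu.1 l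
    · refine Fin.succAboveCases i ?_ (fun l ↦ ?_) j
      · simpa using hc.2
      · simpa using hu.2 l

variable (I M) in
/-- Smooth singular (cubical) chains with real coefficients. -/
abbrev SmoothChain (k : ℕ) := SmoothCube I M k →₀ ℝ

/-- The integral of a form over a chain. -/
def chainIntegral {k : ℕ} (C : SmoothChain I M k) (η : M → E [⋀^Fin k]→L[ℝ] ℝ) : ℝ :=
  C.sum fun σ a ↦ a * σ.integral η

/-- The boundary of a chain, with `∂σ = ∑ i, (-1) ^ i (σ|_{u i = 1} - σ|_{u i = 0})`. -/
def chainBoundary {k : ℕ} (C : SmoothChain I M (k + 1)) : SmoothChain I M k :=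
  C.sum fun σ a ↦ ∑ i : Fin (k + 1),
    (Finsupp.single (σ.face i 1 (by simp)) ((-1) ^ (i : ℕ) * a)
      - Finsupp.single (σ.face i 0 (by simp)) ((-1) ^ (i : ℕ) * a))

end Chains

/-! ### Dynamical fields -/

/-- A smooth representation of `GL(E)` on `V`. It determines the natural vector bundle over each
manifold modelled on `E` whose sections are the dynamical fields: any finite collection of tensor
fields and tensor densities. Only the values of `act` on invertible maps matter. -/
structure FieldType (E V : Type*) [NormedAddCommGroup E] [NormedSpace ℝ E]
    [NormedAddCommGroup V] [NormedSpace ℝ V] where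
  act : (E →L[ℝ] E) → V →L[ℝ] V
  act_one : act (ContinuousLinearMap.id ℝ E) = ContinuousLinearMap.id ℝ V
  act_comp : ∀ A B : E →L[ℝ] E, IsUnit A → IsUnit B → act (A.comp B) = (act A).comp (act B)
  smooth : ContDiffOn ℝ ∞ act {A | IsUnit A}

section Fields

variable {E : Type*} [NormedAddCommGroup E] [NormedSpace ℝ E]
  {V : Type*} [NormedAddCommGroup V] [NormedSpace ℝ V] (ρ : FieldType E V)
  {H : Type*} [TopologicalSpace H] (I : ModelWithCorners ℝ E H)
  {M : Type*} [TopologicalSpace M] [ChartedSpace H M] [IsManifold I ∞ M]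

/-- The components of the field `φ` in the chart at `x₀`. Like tangent vectors, the value `φ x` is
given by its components in the preferred chart at `x`. -/
def fieldInChart (x₀ : M) (φ : M → V) (y : E) : V :=
  let p := (extChartAt I x₀).symm y
  ρ.act (tangentCoordChange I p x₀ p) (φ p)

/-- `φ` is a smooth field. -/
def SmoothField (φ : M → V) : Prop := ∀ x, SmoothSectionAt I (fieldInChart ρ I) φ x

/-- The Lie derivative `£_X φ`; in a chart, `£_X φ = ∂_X φ - dρ(∂X) φ`. -/
def lieField (X : M → E) (φ : M → V) : M → V := fun x ↦
  fderivWithin ℝ (fieldInChart ρ I x φ) (range I) (extChartAt I x x) (X x)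
    - fderiv ℝ ρ.act (ContinuousLinearMap.id ℝ E)
        (fderivWithin ℝ (vecInChart I x X) (range I) (extChartAt I x x)) (φ x)

/-- `c` is a smooth curve of fields, all of which belong to `A`. -/
structure IsCurveIn (A : Set (M → V)) (c : ℝ → M → V) : Prop where
  mem : ∀ t, c t ∈ A
  smooth : ∀ t x, SmoothFamilyAt I (fieldInChart ρ I) c t x

/-- The velocity of a curve of fields at time `0`. -/
def velocity (c : ℝ → M → V) : M → V := fun x ↦ deriv (fun t ↦ c t x) 0

variable (M) in
/-- An off-shell field space: a set of smooth fields such that the tangent space at each of its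
points, i.e. the set of velocities of smooth curves in it, is the same linear space of variations
(no boundary conditions are imposed on these), and to which the infinitesimal diffeomorphisms are
tangent. Example: all Lorentzian metrics, with all symmetric tensors as variations. -/
structure FieldSpace where
  configs : Set (M → V)
  variations : Submodule ℝ (M → V)
  smooth_configs : ∀ φ ∈ configs, SmoothField ρ I φ
  smooth_variations : ∀ v ∈ variations, SmoothField ρ I v
  mem_variations_iff : ∀ φ ∈ configs, ∀ v, v ∈ variations ↔
    ∃ c, IsCurveIn ρ I configs c ∧ c 0 = φ ∧ velocity c = v
  lie_mem : ∀ φ ∈ configs, ∀ X, SmoothVec I X → lieField ρ I X φ ∈ variations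

end Fields

/-! ### Local forms on field space

A field-space `0`-form (`1`-form) with values in the differential forms on a manifold `P` (either
spacetime or the hypersurface) is a function of the field `φ` (and of one variation `v`). These are
local: the value at a point `p` of `P` is only determined by, and depends smoothly on, the germ of
the fields at the point `ι p` of spacetime. Smoothness is expressed by the smooth families of
fields, which may leave the field space away from `ι p`. -/

section LocalForms

variable {E : Type*} [NormedAddCommGroup E] [NormedSpace ℝ E]
  {V : Type*} [NormedAddCommGroup V] [NormedSpace ℝ V] (ρ : FieldType E V)
  {H : Type*} [TopologicalSpace H] (I : ModelWithCorners ℝ E H)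
  {M : Type*} [TopologicalSpace M] [ChartedSpace H M] [IsManifold I ∞ M]
  {F : Type*} [NormedAddCommGroup F] [NormedSpace ℝ F]
  {G : Type*} [TopologicalSpace G] (J : ModelWithCorners ℝ F G)
  {P : Type*} [TopologicalSpace P] [ChartedSpace G P] [IsManifold J ∞ P] (ι : P → M)

/-- `α` is a local field-space `0`-form. -/
def IsLocalZeroForm (A : Set (M → V)) {q : ℕ} (α : (M → V) → P → F [⋀^Fin q]→L[ℝ] ℝ) : Prop :=
  ∀ (S : Type) [NormedAddCommGroup S] [NormedSpace ℝ S] [FiniteDimensional ℝ S]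
    (Φ : S → M → V) (s : S) (p : P), Φ s ∈ A →
    SmoothFamilyAt I (fieldInChart ρ I) Φ s (ι p) →
    SmoothFamilyAt J (formInChart J) (fun s ↦ α (Φ s)) s p

/-- `α` is a local field-space `1`-form; `α φ v` is its value on the variation `v` at `φ`. -/
structure IsLocalOneForm (A : Set (M → V)) {q : ℕ}
    (α : (M → V) → (M → V) → P → F [⋀^Fin q]→L[ℝ] ℝ) : Prop where
  linear : ∀ φ ∈ A, ∀ (v w : M → V) (a b : ℝ) (p : P),
    SmoothSectionAt I (fieldInChart ρ I) v (ι p) → SmoothSectionAt I (fieldInChart ρ I) w (ι p) →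
    α φ (a • v + b • w) p = a • α φ v p + b • α φ w p
  smooth : ∀ (S : Type) [NormedAddCommGroup S] [NormedSpace ℝ S] [FiniteDimensional ℝ S]
    (Φ v : S → M → V) (s : S) (p : P), Φ s ∈ A →
    SmoothFamilyAt I (fieldInChart ρ I) Φ s (ι p) →
    SmoothFamilyAt I (fieldInChart ρ I) v s (ι p) →
    SmoothFamilyAt J (formInChart J) (fun s ↦ α (Φ s) (v s)) s p

/-- `α` is a local field-space `0`-form on spacetime that depends linearly on a vector field. -/
structure IsLocalVectorForm (A : Set (M → V)) {q : ℕ}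
    (α : (M → V) → (M → E) → M → E [⋀^Fin q]→L[ℝ] ℝ) : Prop where
  linear : ∀ φ ∈ A, ∀ (X Y : M → E) (a b : ℝ) (x : M),
    SmoothSectionAt I (vecInChart I) X x → SmoothSectionAt I (vecInChart I) Y x →
    α φ (a • X + b • Y) x = a • α φ X x + b • α φ Y x
  smooth : ∀ (S : Type) [NormedAddCommGroup S] [NormedSpace ℝ S] [FiniteDimensional ℝ S]
    (Φ : S → M → V) (X : S → M → E) (s : S) (x : M), Φ s ∈ A →
    SmoothFamilyAt I (fieldInChart ρ I) Φ s x →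
    SmoothFamilyAt I (vecInChart I) X s x →
    SmoothFamilyAt I (formInChart I) (fun s ↦ α (Φ s) (X s)) s x

/-- The field-space exterior derivative `δ` of a `0`-form, at `φ` on the variation `v`. -/
def var {q : ℕ} (α : (M → V) → P → F [⋀^Fin q]→L[ℝ] ℝ) (φ v : M → V) :
    P → F [⋀^Fin q]→L[ℝ] ℝ :=
  fun p ↦ deriv (fun t : ℝ ↦ α (φ + t • v) p) 0

/-- The field-space exterior derivative `δ` of a `1`-form, at `φ` on the variations `v, w`. -/
def var₂ {q : ℕ} (α : (M → V) → (M → V) → P → F [⋀^Fin q]→L[ℝ] ℝ) (φ v w : M → V) :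
    P → F [⋀^Fin q]→L[ℝ] ℝ :=
  var (fun ψ ↦ α ψ w) φ v - var (fun ψ ↦ α ψ v) φ w

/-- The anomaly `Δ_ξ̂ α = L_ξ̂ α - £_ξ α` of a `0`-form, with `L_ξ̂ α = I_ξ̂ δα`. Here `X` is the value
of `ξ` at `φ`, as a vector field on spacetime, and `XP` is that vector field on `P`. -/
def anomaly {q : ℕ} (α : (M → V) → P → F [⋀^Fin (q + 1)]→L[ℝ] ℝ) (φ : M → V) (X : M → E)
    (XP : P → F) : P → F [⋀^Fin (q + 1)]→L[ℝ] ℝ :=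
  var α φ (lieField ρ I X φ) - lieForm J XP (α φ)

/-- The anomaly `Δ_ξ̂ α = L_ξ̂ α - £_ξ α - I_{δξ̂} α` of a `1`-form, on the variation `v` at `φ`. Here
`L_ξ̂ α = I_ξ̂ δα + δ I_ξ̂ α`, and the vector field `ξ` on spacetime, which may depend on the fields,
enters through its value `X` at `φ` and its variation `Y = δξ[v]` along `v`; thus
`(δ I_ξ̂ α)[v]` is the derivative of `I_ξ̂ α` along `φ + t v`, `ξ = X + t Y`, and
`(I_{δξ̂} α)[v] = α[£_Y φ]`. -/
def anomaly₁ {q : ℕ} (α : (M → V) → (M → V) → P → F [⋀^Fin (q + 1)]→L[ℝ] ℝ) (φ : M → V)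
    (X : M → E) (XP : P → F) (Y : M → E) (v : M → V) : P → F [⋀^Fin (q + 1)]→L[ℝ] ℝ :=
  (var₂ α φ (lieField ρ I X φ) v
      + fun p ↦ deriv (fun t : ℝ ↦
          α (φ + t • v) (lieField ρ I (X + t • Y) (φ + t • v)) p) 0)
    - lieForm J XP (α φ v) - α φ (lieField ρ I Y φ)

end LocalForms

/-! ### Generators, phase space data, charges -/

section Charges

variable {E : Type*} [NormedAddCommGroup E] [NormedSpace ℝ E]
  {V : Type*} [NormedAddCommGroup V] [NormedSpace ℝ V] {ρ : FieldType E V}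
  {H : Type*} [TopologicalSpace H] {I : ModelWithCorners ℝ E H}
  {M : Type*} [TopologicalSpace M] [ChartedSpace H M] [IsManifold I ∞ M]
  {F : Type*} [NormedAddCommGroup F] [NormedSpace ℝ F]
  {G : Type*} [TopologicalSpace G] (J : ModelWithCorners ℝ F G)
  {N : Type*} [TopologicalSpace N] [ChartedSpace G N] [IsManifold J ∞ N] (ι : N → M)

/-- A field-dependent vector field `ξ` on spacetime, tangent to the hypersurface `ι : N → M`, with
the vector field on `N` that it induces, and with its variation `δξ`: a field-space `1`-form. -/
structure Generator (𝓕 : FieldSpace ρ I M) where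
  vec : (M → V) → M → E
  vecN : (M → V) → N → F
  varVec : (M → V) → (M → V) → M → E
  varVecN : (M → V) → (M → V) → N → F
  smooth : ∀ c, IsCurveIn ρ I 𝓕.configs c →
    ∀ t x, SmoothFamilyAt I (vecInChart I) (fun t ↦ vec (c t)) t x
  smoothN : ∀ c, IsCurveIn ρ I 𝓕.configs c →
    ∀ t p, SmoothFamilyAt J (vecInChart J) (fun t ↦ vecN (c t)) t p
  hasVar : ∀ c, IsCurveIn ρ I 𝓕.configs c →
    ∀ x, HasDerivAt (fun t ↦ vec (c t) x) (varVec (c 0) (velocity c) x) 0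
  hasVarN : ∀ c, IsCurveIn ρ I 𝓕.configs c →
    ∀ p, HasDerivAt (fun t ↦ vecN (c t) p) (varVecN (c 0) (velocity c) p) 0
  tangent : ∀ φ ∈ 𝓕.configs, ∀ p, (mfderiv J I ι p : F →L[ℝ] E) (vecN φ p) = vec φ (ι p)

variable (E V M F N) in
/-- The quantities of the formalism in spacetime dimension `d + 1 = m + 3`: on spacetime, the
Lagrangian `L'`, the field equations `E`, the symplectic potential `θ'`, the noncovariances `b'`,
`λ'` and the Noether potential `Q_ξ` of the covariant Lagrangian and symplectic potential; on the
hypersurface, the boundary term `ℓ'`, the corner term `β'`, the flux `𝓔`, the corner boundary term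
`c'`, the corner potential `γ'` and the corner flux `ε`. -/
structure PhaseSpaceData (m : ℕ) where
  L : (M → V) → M → E [⋀^Fin (m + 3)]→L[ℝ] ℝ
  eom : (M → V) → (x : M) → V →L[ℝ] E [⋀^Fin (m + 3)]→L[ℝ] ℝ
  θ : (M → V) → (M → V) → M → E [⋀^Fin (m + 2)]→L[ℝ] ℝ
  b : (M → V) → M → E [⋀^Fin (m + 2)]→L[ℝ] ℝ
  lam : (M → V) → (M → V) → M → E [⋀^Fin (m + 1)]→L[ℝ] ℝ
  Q : (M → V) → (M → E) → M → E [⋀^Fin (m + 1)]→L[ℝ] ℝ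
  ell : (M → V) → N → F [⋀^Fin (m + 2)]→L[ℝ] ℝ
  β : (M → V) → (M → V) → N → F [⋀^Fin (m + 1)]→L[ℝ] ℝ
  flux : (M → V) → (M → V) → N → F [⋀^Fin (m + 2)]→L[ℝ] ℝ
  c : (M → V) → N → F [⋀^Fin (m + 1)]→L[ℝ] ℝ
  γ : (M → V) → (M → V) → N → F [⋀^Fin m]→L[ℝ] ℝ
  ε : (M → V) → (M → V) → N → F [⋀^Fin (m + 1)]→L[ℝ] ℝ

namespace PhaseSpaceData

variable {m : ℕ} (D : PhaseSpaceData E V M F N m) (𝓕 : FieldSpace ρ I M)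

/-- The solution space: the fields with `E · δφ = 0` for all variations `δφ`. -/
def solutions : Set (M → V) :=
  {φ | φ ∈ 𝓕.configs ∧ ∀ v ∈ 𝓕.variations, ∀ x, D.eom φ x (v x) = 0}

variable (I) in
/-- The covariant Lagrangian `L' - d b'`. -/
def covL (φ : M → V) : M → E [⋀^Fin (m + 3)]→L[ℝ] ℝ := D.L φ - extD I (D.b φ)

variable (I) in
/-- The covariant symplectic potential `θ' - δ b' - d λ'`. -/
def covθ (φ v : M → V) : M → E [⋀^Fin (m + 2)]→L[ℝ] ℝ :=
  D.θ φ v - var D.b φ v - extD I (D.lam φ v)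

/-- The defining equations of the quantities of the formalism. -/
structure IsAdmissible : Prop where
  local_L : IsLocalZeroForm ρ I I id 𝓕.configs D.L
  local_θ : IsLocalOneForm ρ I I id 𝓕.configs D.θ
  local_b : IsLocalZeroForm ρ I I id 𝓕.configs D.b
  local_lam : IsLocalOneForm ρ I I id 𝓕.configs D.lam
  local_Q : IsLocalVectorForm ρ I 𝓕.configs D.Q
  local_ell : IsLocalZeroForm ρ I J ι 𝓕.configs D.ell
  local_β : IsLocalOneForm ρ I J ι 𝓕.configs D.β
  local_flux : IsLocalOneForm ρ I J ι 𝓕.configs D.flux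
  local_c : IsLocalZeroForm ρ I J ι 𝓕.configs D.c
  local_γ : IsLocalOneForm ρ I J ι 𝓕.configs D.γ
  local_ε : IsLocalOneForm ρ I J ι 𝓕.configs D.ε
  /-- `δL' = E · δφ + dθ'` -/
  var_L : ∀ φ ∈ 𝓕.configs, ∀ v ∈ 𝓕.variations,
    var D.L φ v = (fun x ↦ D.eom φ x (v x)) + extD I (D.θ φ v)
  /-- `Δ_ξ̂ L' = d Δ_ξ̂ b'` -/
  anomaly_L : ∀ φ ∈ 𝓕.configs, ∀ X, SmoothVec I X →
    anomaly ρ I I D.L φ X X = extD I (anomaly ρ I I D.b φ X X)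
  /-- `Δ_ξ̂ θ' = Δ_ξ̂ δb' + d Δ_ξ̂ λ'` -/
  anomaly_θ : ∀ φ ∈ 𝓕.configs, ∀ v ∈ 𝓕.variations, ∀ X, SmoothVec I X →
    anomaly₁ ρ I I D.θ φ X X 0 v
      = anomaly₁ ρ I I (var D.b) φ X X 0 v + extD I (anomaly₁ ρ I I D.lam φ X X 0 v)
  /-- on shell, `I_ξ̂ θ - i_ξ L = d Q_ξ` for the covariant Lagrangian and symplectic potential -/
  noether : ∀ φ ∈ D.solutions 𝓕, ∀ X, SmoothVec I X →
    D.covθ I φ (lieField ρ I X φ) - contract X (D.covL I φ) = extD I (D.Q φ X)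
  /-- `θ' = -δℓ' + dβ' + 𝓔` on the hypersurface -/
  decomp_θ : ∀ φ ∈ 𝓕.configs, ∀ v ∈ 𝓕.variations,
    pullback I J ι (D.θ φ v) = -var D.ell φ v + extD J (D.β φ v) + D.flux φ v
  /-- `β' - λ' = -δc' + dγ' + ε` on the hypersurface -/
  decomp_β : ∀ φ ∈ 𝓕.configs, ∀ v ∈ 𝓕.variations,
    D.β φ v - pullback I J ι (D.lam φ v) = -var D.c φ v + extD J (D.γ φ v) + D.ε φ v

variable {J} in
/-- The symplectic form `Ω = ∫_Σ δθ' - ∫_∂Σ δβ'`; the cut `∂Σ` is given as a chain in `N`. -/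
def symplecticForm (slice : SmoothChain I M (m + 2)) (cut : SmoothChain J N (m + 1))
    (φ v w : M → V) : ℝ :=
  chainIntegral slice (var₂ D.θ φ v w) - chainIntegral cut (var₂ D.β φ v w)

variable (ρ I)

/-- `Q'_ξ = Q_ξ + i_ξ b' + I_ξ̂ λ'`, where `X` is the value of `ξ` at `φ`. -/
def noetherCharge (φ : M → V) (X : M → E) : M → E [⋀^Fin (m + 1)]→L[ℝ] ℝ :=
  D.Q φ X + contract X (D.b φ) + D.lam φ (lieField ρ I X φ)

/-- The charge density `h_ξ = Q'_ξ + i_ξ ℓ' - I_ξ̂ β'`, where `X`, `XN` are the values of `ξ` at `φ`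
as vector fields on spacetime and on the hypersurface. -/
def density (φ : M → V) (X : M → E) (XN : N → F) : N → F [⋀^Fin (m + 1)]→L[ℝ] ℝ :=
  pullback I J ι (D.noetherCharge ρ I φ X) + contract XN (D.ell φ) - D.β φ (lieField ρ I X φ)

/-- The improved charge density `h_ξ - Δ_ξ̂ c'`, where `X`, `XN` are the values of `ξ` at `φ`. -/
def improvedDensityAt (φ : M → V) (X : M → E) (XN : N → F) : N → F [⋀^Fin (m + 1)]→L[ℝ] ℝ :=
  D.density ρ I J ι φ X XN - anomaly ρ I J D.c φ X XN

variable {ρ I J ι 𝓕} (ξ : Generator J ι 𝓕)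

/-- The improved charge density of the field-dependent vector field `ξ`. -/
def improvedDensity (φ : M → V) : N → F [⋀^Fin (m + 1)]→L[ℝ] ℝ :=
  D.improvedDensityAt ρ I J ι φ (ξ.vec φ) (ξ.vecN φ)

/-- The improved charge: the integral of the improved charge density over the cut. -/
def improvedCharge (cut : SmoothChain J N (m + 1)) (φ : M → V) : ℝ :=
  chainIntegral cut (D.improvedDensity ξ φ)

/-- The improved flux `∫_∂Σ (i_ξ 𝓔 - Δ_ξ̂ ε + h_{δξ})`, with the improved charge density `h` of the
variation `δξ`, at `φ` on the variation `v`. -/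
def improvedFlux (cut : SmoothChain J N (m + 1)) (φ v : M → V) : ℝ :=
  chainIntegral cut
    (contract (ξ.vecN φ) (D.flux φ v)
      - anomaly₁ ρ I J D.ε φ (ξ.vec φ) (ξ.vecN φ) (ξ.varVec φ v) v
      + D.improvedDensityAt ρ I J ι φ (ξ.varVec φ v) (ξ.varVecN φ v))

variable (I J ι) in
/-- The change of the data under the ambiguities `b' → b' + de`, `λ' → λ' - δe` on spacetime and
`ℓ' → ℓ' + df`, `β' → β' + δf` on the hypersurface, with the corner flux fixed, which is
achieved by `c' → c' - f - e`. -/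
def shift (e : (M → V) → M → E [⋀^Fin (m + 1)]→L[ℝ] ℝ)
    (f : (M → V) → N → F [⋀^Fin (m + 1)]→L[ℝ] ℝ) : PhaseSpaceData E V M F N m :=
  { D with
    b := fun φ ↦ D.b φ + extD I (e φ)
    lam := fun φ v ↦ D.lam φ v - var e φ v
    ell := fun φ ↦ D.ell φ + extD J (f φ)
    β := fun φ v ↦ D.β φ v + var f φ v
    c := fun φ ↦ D.c φ - f φ - pullback I J ι (e φ) }

end PhaseSpaceData

end Charges

end CovariantPhaseSpace

end

open CovariantPhaseSpace

/-! Write `L = L' - db'` and `θ = θ' - δb' - dλ'` (`covL`, `covθ`). The anomaly equation for `θ'`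
amounts to covariance of `θ`: for fixed `ξ`, `L_ξ̂ θ = £_ξ θ` (`var_covθ`). Differentiate the
Noether identity `I_ξ̂ θ - i_ξ L = dQ_ξ` along a curve of solutions, where `δL = dθ`. Cartan's
formula and the Noether identity for `δξ` then give `I_ξ̂ δθ = d(i_ξ θ + Q_{δξ} - δQ_ξ)`
(`var₂_covθ`). Since `δ²b' = 0`, returning to `θ'` only adds `d(I_ξ̂ δλ')` (`var₂_θ`), so Stokes
moves `I_ξ̂ Ω` to the cut.

On the hypersurface put `B = ℓ' + b' + dc'`. The two decompositions combine to `δB + θ = 𝓔 + dε`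
(`var_boundary_add_pullback_covθ`) and to `δβ' = δλ' + dδγ' + δε` (`var₂_β`). Contracting the corner
decomposition with `ξ̂` cancels `I_ξ̂ δc'` against the anomaly of `c'`, so the improved density is
`Q_ξ + i_ξ B - I_ξ̂ ε` up to an exact form (`improvedDensityAt_eq`, which is statement 2). Its
variation matches the integrands of `-I_ξ̂ Ω` and of the flux up to an exact form, which integrates
to zero over a closed cut (`hasDerivAt_improvedCharge`).

For statement 3, `covL`, `covθ` and `B` are unchanged by the shift, because `d² = 0` and `δd = dδ`.
Hence the defining equations persist, and only the term `d i_ξ c'` of the density moves.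

The analytic difficulty is that `δ` differentiates along straight lines of fields, which may leave
the field space, while variations are velocities of curves inside it. Hadamard's formula `u t = u 0
+ t • w t`, with `w` again a smooth family (`meanVelocity`), relates the two. Locality enters only
as smoothness on finite-dimensional families of fields. The remaining tools are chart independence
of `d` and of the Lie derivative, naturality of `d`, and Stokes on singular cubes. -/

noncomputable section

namespace CovariantPhaseSpace

open Filter Topology

set_option linter.unusedSectionVars false

/-! ### Parameter integrals and mixed derivatives, up to the boundary of the domain. -/

section Calculus

variable {Z W : Type*} [NormedAddCommGroup Z] [NormedSpace ℝ Z]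
  [NormedAddCommGroup W] [NormedSpace ℝ W]

/-- A continuous family parametrised by a compact set varies uniformly. -/
theorem eventually_forall_norm_sub_le {T : Type*} [TopologicalSpace T] {C : Set T}
    (hC : IsCompact C) {h : T → Z → W} {K : Set Z}
    (hh : ContinuousOn (Function.uncurry h) (C ×ˢ K)) {z : Z} (hz : z ∈ K) {ε : ℝ} (hε : 0 < ε) :
    ∀ᶠ z' in 𝓝[K] z, ∀ τ ∈ C, ‖h τ z' - h τ z‖ ≤ ε := by
  rw [eventually_nhdsWithin_iff]
  -- The tube lemma works with full neighbourhoods, so membership in `K` and `C` is carried as a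
  -- premise inside the predicate.
  have key := hC.eventually_forall_of_forall_eventually (x₀ := z)
    (P := fun z' τ ↦ z' ∈ K → τ ∈ C → ‖h τ z' - h τ z‖ ≤ ε) ?_
  · filter_upwards [key] with z' hz' hK τ hτ using hz' τ hτ hK hτ
  intro τ hτ
  have h1 := hh (τ, z) ⟨hτ, hz⟩
  have h2 := Metric.continuousWithinAt_iff'.1 h1 (ε / 2) (by positivity)
  rw [eventually_nhdsWithin_iff] at h2
  have h3 : Tendsto (fun q : Z × T ↦ (q.2, q.1)) (𝓝 (z, τ)) (𝓝 (τ, z)) :=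
    (continuous_swap.tendsto (z, τ))
  have h4 : Tendsto (fun q : Z × T ↦ (q.2, z)) (𝓝 (z, τ)) (𝓝 (τ, z)) :=
    (Continuous.tendsto (by fun_prop) (z, τ))
  filter_upwards [h3.eventually h2, h4.eventually h2] with q hq hq' hqK hqC
  have a := hq ⟨hqC, hqK⟩
  have b := hq' ⟨hqC, hz⟩
  simp only [Function.uncurry, dist_eq_norm] at a b
  calc ‖h q.2 q.1 - h q.2 z‖ = ‖(h q.2 q.1 - h τ z) - (h q.2 z - h τ z)‖ := by congr 1; abel
    _ ≤ ‖h q.2 q.1 - h τ z‖ + ‖h q.2 z - h τ z‖ := norm_sub_le _ _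
    _ ≤ ε := by linarith

theorem continuousOn_integral_param {h : ℝ → Z → W} {K : Set Z}
    (hh : ContinuousOn (Function.uncurry h) (Icc 0 1 ×ˢ K)) :
    ContinuousOn (fun z ↦ ∫ τ in (0 : ℝ)..1, h τ z) K := by
  intro z hz
  have hint : ∀ z ∈ K, IntervalIntegrable (fun τ ↦ h τ z) MeasureTheory.volume 0 1 := by
    intro z hz
    apply ContinuousOn.intervalIntegrable
    rw [uIcc_of_le zero_le_one]
    exact hh.comp (f := fun τ ↦ (τ, z)) (by fun_prop) (fun τ hτ ↦ ⟨hτ, hz⟩)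
  refine Metric.continuousWithinAt_iff'.2 fun ε hε ↦ ?_
  filter_upwards [eventually_forall_norm_sub_le isCompact_Icc hh hz (half_pos hε),
    self_mem_nhdsWithin] with z' hz' hz'K
  rw [dist_eq_norm, ← intervalIntegral.integral_sub (hint _ hz'K) (hint _ hz)]
  have := intervalIntegral.norm_integral_le_of_norm_le_const (a := 0) (b := 1)
    (f := fun τ ↦ h τ z' - h τ z) (C := ε / 2) (fun τ hτ ↦ by
      rw [uIoc_of_le zero_le_one] at hτ
      exact hz' τ (Ioc_subset_Icc_self hτ))
  simp only [sub_zero, abs_one, mul_one] at this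
  linarith

/-- By the mean value inequality on the convex set `ball ∩ K`, continuity of `h'` uniform in `τ`
becomes a remainder bound `ε ‖y - z‖` uniform in `τ`, which survives integration. -/
theorem hasFDerivWithinAt_integral_param [CompleteSpace W] {h : ℝ → Z → W} {K : Set Z}
    {h' : ℝ → Z → Z →L[ℝ] W} (hK : Convex ℝ K)
    (hc : ContinuousOn (Function.uncurry h) (Icc 0 1 ×ˢ K))
    (hh' : ContinuousOn (Function.uncurry h') (Icc 0 1 ×ˢ K))
    (hd : ∀ τ ∈ Icc (0 : ℝ) 1, ∀ z ∈ K, HasFDerivWithinAt (h τ) (h' τ z) K z)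
    {z : Z} (hz : z ∈ K) :
    HasFDerivWithinAt (fun z ↦ ∫ τ in (0 : ℝ)..1, h τ z) (∫ τ in (0 : ℝ)..1, h' τ z) K z := by
  have hint : ∀ z ∈ K, IntervalIntegrable (fun τ ↦ h τ z) MeasureTheory.volume 0 1 := by
    intro z hz
    apply ContinuousOn.intervalIntegrable
    rw [uIcc_of_le zero_le_one]
    exact hc.comp (f := fun τ ↦ (τ, z)) (by fun_prop) (fun τ hτ ↦ ⟨hτ, hz⟩)
  have hint' : IntervalIntegrable (fun τ ↦ h' τ z) MeasureTheory.volume 0 1 := by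
    apply ContinuousOn.intervalIntegrable
    rw [uIcc_of_le zero_le_one]
    exact hh'.comp (f := fun τ ↦ (τ, z)) (by fun_prop) (fun τ hτ ↦ ⟨hτ, hz⟩)
  rw [hasFDerivWithinAt_iff_isLittleO, Asymptotics.isLittleO_iff]
  intro ε hε
  have h1 := eventually_forall_norm_sub_le isCompact_Icc hh' hz hε
  obtain ⟨δ, hδ, hball⟩ := Metric.mem_nhdsWithin_iff.1 h1
  have hKδ : Convex ℝ (Metric.ball z δ ∩ K) := (convex_ball z δ).inter hK
  filter_upwards [inter_mem_nhdsWithin K (Metric.ball_mem_nhds z hδ)] with y hy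
  have hyK := hy.1
  have hzm : z ∈ Metric.ball z δ ∩ K := ⟨Metric.mem_ball_self hδ, hz⟩
  have hym : y ∈ Metric.ball z δ ∩ K := ⟨hy.2, hy.1⟩
  rw [← intervalIntegral.integral_sub (hint _ hyK) (hint _ hz),
    ContinuousLinearMap.intervalIntegral_apply hint',
    ← intervalIntegral.integral_sub ((hint _ hyK).sub (hint _ hz)) (by
      apply ContinuousOn.intervalIntegrable
      rw [uIcc_of_le zero_le_one]
      exact (hh'.comp (f := fun τ ↦ (τ, z)) (by fun_prop) (fun τ hτ ↦ ⟨hτ, hz⟩)).clm_apply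
        continuousOn_const)]
  have := intervalIntegral.norm_integral_le_of_norm_le_const (a := 0) (b := 1)
    (f := fun τ ↦ h τ y - h τ z - h' τ z (y - z)) (C := ε * ‖y - z‖) (fun τ hτ ↦ by
      rw [uIoc_of_le zero_le_one] at hτ
      have hτ := Ioc_subset_Icc_self hτ
      refine hKδ.norm_image_sub_le_of_norm_hasFDerivWithin_le' (f := h τ) (f' := h' τ)
        (fun x hx ↦ (hd τ hτ x hx.2).mono inter_subset_right) (fun x hx ↦ ?_) hzm hym
      exact hball hx τ hτ)
  simpa using this

/-- Induction on the order: a directional derivative of the integral is again a parameter integral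
with values in the same `W`, so the induction never changes codomain. Directional derivatives
suffice because `Z` is finite-dimensional. -/
theorem contDiffOn_integral_param [CompleteSpace W] [FiniteDimensional ℝ Z] {n : ℕ} :
    ∀ {h : ℝ → Z → W} {K : Set Z}, Convex ℝ K → UniqueDiffOn ℝ K →
    ContDiffOn ℝ n (Function.uncurry h) (Icc 0 1 ×ˢ K) →
    ContDiffOn ℝ n (fun z ↦ ∫ τ in (0 : ℝ)..1, h τ z) K := by
  induction n with
  | zero =>
    intro h K hK hu hh
    simp only [CharP.cast_eq_zero, contDiffOn_zero] at hh ⊢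
    exact continuousOn_integral_param hh
  | succ n ih =>
    intro h K hK hu hh
    have hus : UniqueDiffOn ℝ (Icc (0 : ℝ) 1 ×ˢ K) := (uniqueDiffOn_Icc zero_lt_one).prod hu
    push_cast at hh ⊢
    set D : ℝ → Z → Z →L[ℝ] W := fun τ z ↦
      (fderivWithin ℝ (Function.uncurry h) (Icc 0 1 ×ˢ K) (τ, z)).comp
        (ContinuousLinearMap.inr ℝ ℝ Z) with hD
    have hDc : ContDiffOn ℝ n (Function.uncurry D) (Icc 0 1 ×ˢ K) := by
      have := hh.fderivWithin hus (m := n) le_rfl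
      exact this.clm_comp contDiffOn_const
    have hd : ∀ τ ∈ Icc (0 : ℝ) 1, ∀ z ∈ K, HasFDerivWithinAt (h τ) (D τ z) K z := by
      intro τ hτ z hz
      have h1 := (hh.differentiableOn (by simp) (τ, z) ⟨hτ, hz⟩).hasFDerivWithinAt
      have h2 : HasFDerivWithinAt (fun z : Z ↦ (τ, z)) (ContinuousLinearMap.inr ℝ ℝ Z) K z :=
        (hasFDerivAt_prodMk_right τ z).hasFDerivWithinAt
      exact h1.comp z h2 (fun z hz ↦ ⟨hτ, hz⟩)
    have hF := fun z (hz : z ∈ K) ↦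
      hasFDerivWithinAt_integral_param hK hh.continuousOn hDc.continuousOn hd hz
    refine contDiffOn_succ_of_fderiv_apply (fun z hz ↦ (hF z hz).differentiableWithinAt)
      (by simp) (fun y ↦ ?_)
    refine (ih (h := fun τ z ↦ D τ z y) hK hu (hDc.clm_apply contDiffOn_const)).congr ?_
    intro z hz
    rw [(hF z hz).fderivWithin (hu z hz), ContinuousLinearMap.intervalIntegral_apply]
    apply ContinuousOn.intervalIntegrable
    rw [uIcc_of_le zero_le_one]
    exact hDc.continuousOn.comp (f := fun τ ↦ (τ, z)) (by fun_prop) (fun τ hτ ↦ ⟨hτ, hz⟩)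

/-- Averaging over the rescalings of one variable preserves smoothness. -/
theorem contDiffWithinAt_integral_rescale [CompleteSpace W] [FiniteDimensional ℝ Z]
    {h : ℝ → Z → W} {R : Set Z} (hR : Convex ℝ R) (hu : UniqueDiffOn ℝ R) {z₀ : Z} (hz : z₀ ∈ R)
    (hh : ContDiffWithinAt ℝ ∞ (Function.uncurry h) (univ ×ˢ R) (0, z₀)) :
    ContDiffWithinAt ℝ ∞ (fun q : ℝ × Z ↦ ∫ τ in (0 : ℝ)..1, h (τ * q.1) q.2) (univ ×ˢ R)
      (0, z₀) := by
  rw [contDiffWithinAt_infty] at hh ⊢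
  intro n
  obtain ⟨u, huo, hu0, hun⟩ := (hh n).contDiffOn' (m := n) le_rfl (by simp)
  rw [insert_eq_of_mem (show ((0 : ℝ), z₀) ∈ univ ×ˢ R from ⟨trivial, hz⟩)] at hun
  obtain ⟨δ, hδ, hball⟩ := Metric.isOpen_iff.1 huo _ hu0
  -- This set is convex, and rescaling the first coordinate by `τ ∈ [0, 1]` stays inside it.
  set K : Set (ℝ × Z) := Metric.ball 0 δ ×ˢ (Metric.ball z₀ δ ∩ R) with hKdef
  have hK : Convex ℝ K := (convex_ball _ _).prod ((convex_ball _ _).inter hR)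
  have hKu : UniqueDiffOn ℝ K :=
    Metric.isOpen_ball.uniqueDiffOn.prod (by
      rw [inter_comm]; exact hu.inter Metric.isOpen_ball)
  have hKn : K ∈ 𝓝[univ ×ˢ R] ((0 : ℝ), z₀) := by
    rw [nhdsWithin_prod_eq]
    refine prod_mem_prod (by simpa using Metric.ball_mem_nhds _ hδ) ?_
    rw [inter_comm]
    exact inter_mem_nhdsWithin _ (Metric.ball_mem_nhds _ hδ)
  have key : ContDiffOn ℝ n (fun q : ℝ × Z ↦ ∫ τ in (0 : ℝ)..1, h (τ * q.1) q.2) K := by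
    refine contDiffOn_integral_param (h := fun τ (q : ℝ × Z) ↦ h (τ * q.1) q.2) hK hKu ?_
    refine hun.comp (f := fun p : ℝ × ℝ × Z ↦ (p.1 * p.2.1, p.2.2))
      (ContDiff.contDiffOn (by fun_prop)) ?_
    rintro ⟨τ, r, y⟩ ⟨hτ, hr, hy, hyR⟩
    refine ⟨⟨trivial, hyR⟩, hball ?_⟩
    simp only [Metric.mem_ball, dist_zero_right, Real.norm_eq_abs] at hr hτ
    rw [Metric.mem_ball, Prod.dist_eq, max_lt_iff]
    refine ⟨?_, hy⟩
    simp only [dist_zero_right, norm_mul, Real.norm_eq_abs, abs_of_nonneg hτ.1]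
    exact lt_of_le_of_lt (mul_le_of_le_one_left (abs_nonneg _) hτ.2) hr
  have h0 : ((0 : ℝ), z₀) ∈ univ ×ˢ R := ⟨trivial, hz⟩
  exact (key _ (mem_of_mem_nhdsWithin h0 hKn)).mono_of_mem_nhdsWithin hKn

/-- Derivatives with respect to a parameter and to the point commute. -/
theorem hasDerivAt_fderivWithin {g : ℝ → Z → W} {R : Set Z} (hu : UniqueDiffOn ℝ R)
    {t₀ : ℝ} {z₀ : Z} (hz : z₀ ∈ R) (hzc : z₀ ∈ closure (interior R))
    (hg : ContDiffWithinAt ℝ ∞ (Function.uncurry g) (univ ×ˢ R) (t₀, z₀)) :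
    HasDerivAt (fun t ↦ fderivWithin ℝ (g t) R z₀)
      (fderivWithin ℝ (fun z ↦ deriv (fun t ↦ g t z) t₀) R z₀) t₀ := by
  have huR : UniqueDiffOn ℝ ((univ : Set ℝ) ×ˢ R) := uniqueDiffOn_univ.prod hu
  have hmem : (t₀, z₀) ∈ (univ : Set ℝ) ×ˢ R := ⟨trivial, hz⟩
  set G := fderivWithin ℝ (Function.uncurry g) (univ ×ˢ R) with hG
  have hGs : ContDiffWithinAt ℝ ∞ G (univ ×ˢ R) (t₀, z₀) :=
    hg.fderivWithin_right huR (m := ∞) (by simp) hmem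
  -- Both derivatives are values of the second derivative of `g` on the vectors `(1, 0)` and `(0,
  -- z)`, in opposite orders. Symmetry holds even at boundary points because these lie in the
  -- closure of the interior.
  have hsymm := hg.isSymmSndFDerivWithinAt (by simp; exact WithTop.coe_le_coe.2 le_top) huR
    (by rw [interior_prod_eq, closure_prod_eq]; simpa using hzc) hmem
  have hev : ∀ᶠ q in 𝓝[univ ×ˢ R] (t₀, z₀),
      DifferentiableWithinAt ℝ (Function.uncurry g) (univ ×ˢ R) q := by
    have := (hg.of_le (m := 1) (by simp)).eventually (by simp)
    rw [insert_eq_of_mem hmem] at this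
    exact this.mono fun q hq ↦ hq.differentiableWithinAt one_ne_zero
  have h1 : ∀ᶠ t in 𝓝 t₀, fderivWithin ℝ (g t) R z₀
      = (G (t, z₀)).comp (ContinuousLinearMap.inr ℝ ℝ Z) := by
    have ht : Tendsto (fun t : ℝ ↦ (t, z₀)) (𝓝 t₀) (𝓝[univ ×ˢ R] (t₀, z₀)) :=
      tendsto_nhdsWithin_iff.2 ⟨Continuous.tendsto (by fun_prop) _,
        Eventually.of_forall fun t ↦ ⟨trivial, hz⟩⟩
    filter_upwards [ht.eventually hev] with t ht
    refine HasFDerivWithinAt.fderivWithin ?_ (hu z₀ hz)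
    exact ht.hasFDerivWithinAt.comp z₀ (hasFDerivAt_prodMk_right t z₀).hasFDerivWithinAt
      (fun z hz ↦ ⟨trivial, hz⟩)
  have h2 : ∀ᶠ z in 𝓝[R] z₀, deriv (fun t ↦ g t z) t₀ = G (t₀, z) (1, 0) := by
    have ht : Tendsto (fun z : Z ↦ (t₀, z)) (𝓝[R] z₀) (𝓝[univ ×ˢ R] (t₀, z₀)) := by
      refine tendsto_nhdsWithin_iff.2 ⟨(Continuous.tendsto (by fun_prop) _).mono_left
        nhdsWithin_le_nhds, ?_⟩
      filter_upwards [self_mem_nhdsWithin] with z hz using ⟨trivial, hz⟩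
    filter_upwards [ht.eventually hev, self_mem_nhdsWithin] with z hd hz
    have := hd.hasFDerivWithinAt.comp_hasDerivWithinAt (s := univ) t₀
      ((hasDerivAt_id t₀).prodMk (hasDerivAt_const t₀ z)).hasDerivWithinAt
      (fun t _ ↦ (⟨trivial, hz⟩ : (id t, z) ∈ univ ×ˢ R))
    rw [hasDerivWithinAt_univ] at this
    exact this.deriv
  have hGd := (hGs.differentiableWithinAt (by simp)).hasFDerivWithinAt
  have h3 : fderivWithin ℝ (fun z ↦ deriv (fun t ↦ g t z) t₀) R z₀
      = ((ContinuousLinearMap.apply ℝ W ((1 : ℝ), (0 : Z))).comp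
          (fderivWithin ℝ G (univ ×ˢ R) (t₀, z₀))).comp (ContinuousLinearMap.inr ℝ ℝ Z) := by
    rw [Filter.EventuallyEq.fderivWithin_eq h2 (h2.self_of_nhdsWithin hz)]
    refine HasFDerivWithinAt.fderivWithin ?_ (hu z₀ hz)
    have := hGd.comp z₀ (hasFDerivAt_prodMk_right t₀ z₀).hasFDerivWithinAt
      (s := R) (fun z hz ↦ ⟨trivial, hz⟩)
    exact (ContinuousLinearMap.apply ℝ W ((1 : ℝ), (0 : Z))).hasFDerivAt.comp_hasFDerivWithinAt
      z₀ this
  rw [h3]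
  refine HasDerivAt.congr_of_eventuallyEq ?_ h1
  have h4 := hGd.comp_hasDerivWithinAt (s := univ) t₀
      ((hasDerivAt_id t₀).prodMk (hasDerivAt_const t₀ z₀)).hasDerivWithinAt
      (fun t _ ↦ (⟨trivial, hz⟩ : (id t, z₀) ∈ univ ×ˢ R))
  rw [hasDerivWithinAt_univ] at h4
  have h5 := ((ContinuousLinearMap.compL ℝ Z (ℝ × Z) W).flip
    (ContinuousLinearMap.inr ℝ ℝ Z)).hasFDerivAt.comp_hasDerivAt t₀ h4
  refine h5.congr_deriv ?_
  ext z
  simpa using hsymm (1, 0) (0, z)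

end Calculus

/-! ### Smooth families of sections, uniformly for vectors, forms and dynamical fields. -/

section Reps

variable {E : Type*} [NormedAddCommGroup E] [NormedSpace ℝ E]
  {H : Type*} [TopologicalSpace H] {I : ModelWithCorners ℝ E H}
  {M : Type*} [TopologicalSpace M] [ChartedSpace H M]
  {W : Type*} [NormedAddCommGroup W] [NormedSpace ℝ W]

variable (I) in
/-- The components of sections in charts are given by pointwise linear maps, invertible on the
domain of the chart. -/
structure IsLinearRep (rep : M → (M → W) → E → W) : Prop where
  center : ∀ x φ, rep x φ (extChartAt I x x) = φ x
  linear : ∀ x y, ∃ A : W →L[ℝ] W, (∀ φ, rep x φ y = A (φ ((extChartAt I x).symm y))) ∧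
    (y ∈ (extChartAt I x).target → ∃ B : W →L[ℝ] W, ∀ w, B (A w) = w)

/-- Differentiability of `f` need not be assumed: the left inverse transfers it back from `A ∘ f`,
so if it fails both derivatives have the default value `0`. -/
theorem deriv_clm_apply_of_leftInverse {A B : W →L[ℝ] W} (h : ∀ w, B (A w) = w) (f : ℝ → W)
    (t : ℝ) : deriv (fun t ↦ A (f t)) t = A (deriv f t) := by
  by_cases hf : DifferentiableAt ℝ f t
  · exact (A.hasFDerivAt.comp_hasDerivAt t hf.hasDerivAt).deriv
  · rw [deriv_zero_of_not_differentiableAt hf, map_zero, deriv_zero_of_not_differentiableAt]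
    intro h'
    apply hf
    have := (B.differentiableAt (x := A (f t))).comp t h'
    simpa [Function.comp_def, h] using this

theorem integral_clm_apply_of_leftInverse [CompleteSpace W] {A B : W →L[ℝ] W}
    (h : ∀ w, B (A w) = w) (f : ℝ → W) :
    ∫ t in (0 : ℝ)..1, A (f t) = A (∫ t in (0 : ℝ)..1, f t) := by
  by_cases hf : IntervalIntegrable f MeasureTheory.volume 0 1
  · exact A.intervalIntegral_comp_comm hf
  · rw [intervalIntegral.integral_undef hf, map_zero, intervalIntegral.integral_undef]
    intro h'
    apply hf
    have : IntervalIntegrable (fun t ↦ B (A (f t))) MeasureTheory.volume 0 1 :=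
      ⟨B.integrable_comp h'.1, B.integrable_comp h'.2⟩
    simpa [h] using this

theorem eventually_mem_target (x : M) : ∀ᶠ y in 𝓝[range I] (extChartAt I x x),
    y ∈ (extChartAt I x).target := extChartAt_target_mem_nhdsWithin x

theorem eventually_snd_mem_target {S : Type*} [NormedAddCommGroup S] (s : S) (x : M) :
    ∀ᶠ z in 𝓝[univ ×ˢ range I] (s, extChartAt I x x), z.2 ∈ (extChartAt I x).target := by
  rw [nhdsWithin_prod_eq]
  exact (eventually_mem_target x).prod_inr _

theorem mem_range_extChartAt (x : M) : extChartAt I x x ∈ range I :=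
  extChartAt_target_subset_range x (mem_extChartAt_target x)

variable {S : Type*} [NormedAddCommGroup S] [NormedSpace ℝ S]
  {S' : Type*} [NormedAddCommGroup S'] [NormedSpace ℝ S']
  {rep : M → (M → W) → E → W}

theorem SmoothFamilyAt.comp {Φ : S → M → W} {s' : S'} {x : M} {f : S' → S}
    (h : SmoothFamilyAt I rep Φ (f s') x) (hf : ContDiffAt ℝ ∞ f s') :
    SmoothFamilyAt I rep (fun s ↦ Φ (f s)) s' x := by
  unfold SmoothFamilyAt at h ⊢
  refine h.comp (f := fun z : S' × E ↦ (f z.1, z.2)) (s', extChartAt I x x) ?_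
    (fun z hz ↦ ⟨trivial, hz.2⟩)
  exact ContDiffAt.contDiffWithinAt
    ((ContDiffAt.comp (s', extChartAt I x x) hf contDiffAt_fst).prodMk contDiffAt_snd)

theorem SmoothSectionAt.family {φ : M → W} {x : M} (h : SmoothSectionAt I rep φ x) (s : S) :
    SmoothFamilyAt I rep (fun _ ↦ φ) s x := by
  unfold SmoothFamilyAt
  exact ContDiffWithinAt.comp (f := fun z : S × E ↦ z.2) (s, extChartAt I x x) h
    contDiffWithinAt_snd (fun z hz ↦ hz.2)

theorem SmoothFamilyAt.section {Φ : S → M → W} {s : S} {x : M}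
    (h : SmoothFamilyAt I rep Φ s x) : SmoothSectionAt I rep (Φ s) x := by
  unfold SmoothFamilyAt at h
  exact ContDiffWithinAt.comp (f := fun y : E ↦ (s, y)) (extChartAt I x x) h
    (ContDiff.contDiffWithinAt (by fun_prop)) (fun y hy ↦ ⟨trivial, hy⟩)

variable (hrep : IsLinearRep I rep)
include hrep

theorem IsLinearRep.map_add (x : M) (φ ψ : M → W) (y : E) :
    rep x (φ + ψ) y = rep x φ y + rep x ψ y := by
  obtain ⟨A, hA, -⟩ := hrep.linear x y
  simp [hA]

theorem IsLinearRep.map_sub (x : M) (φ ψ : M → W) (y : E) :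
    rep x (φ - ψ) y = rep x φ y - rep x ψ y := by
  obtain ⟨A, hA, -⟩ := hrep.linear x y
  simp [hA]

theorem IsLinearRep.map_smul (x : M) (a : ℝ) (φ : M → W) (y : E) :
    rep x (a • φ) y = a • rep x φ y := by
  obtain ⟨A, hA, -⟩ := hrep.linear x y
  simp [hA]

theorem IsLinearRep.map_zero (x : M) (y : E) : rep x 0 y = 0 := by
  obtain ⟨A, hA, -⟩ := hrep.linear x y
  simp [hA]

theorem SmoothFamilyAt.add {Φ Ψ : S → M → W} {s : S} {x : M}
    (h : SmoothFamilyAt I rep Φ s x) (h' : SmoothFamilyAt I rep Ψ s x) :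
    SmoothFamilyAt I rep (fun s ↦ Φ s + Ψ s) s x := by
  unfold SmoothFamilyAt at *
  simpa only [hrep.map_add] using ContDiffWithinAt.add h h'

theorem SmoothFamilyAt.sub {Φ Ψ : S → M → W} {s : S} {x : M}
    (h : SmoothFamilyAt I rep Φ s x) (h' : SmoothFamilyAt I rep Ψ s x) :
    SmoothFamilyAt I rep (fun s ↦ Φ s - Ψ s) s x := by
  unfold SmoothFamilyAt at *
  simpa only [hrep.map_sub] using ContDiffWithinAt.sub h h'

theorem SmoothFamilyAt.smul {Φ : S → M → W} {s : S} {x : M} {a : S → ℝ}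
    (ha : ContDiffAt ℝ ∞ a s) (h : SmoothFamilyAt I rep Φ s x) :
    SmoothFamilyAt I rep (fun s ↦ a s • Φ s) s x := by
  unfold SmoothFamilyAt at *
  simp only [hrep.map_smul]
  refine ContDiffWithinAt.smul ?_ h
  exact ContDiffAt.contDiffWithinAt (ContDiffAt.comp (s, extChartAt I x x) ha contDiffAt_fst)

theorem SmoothSectionAt.add {φ ψ : M → W} {x : M} (h : SmoothSectionAt I rep φ x)
    (h' : SmoothSectionAt I rep ψ x) : SmoothSectionAt I rep (φ + ψ) x :=
  (SmoothFamilyAt.add hrep (h.family (0 : ℝ)) (h'.family 0)).section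

theorem SmoothSectionAt.sub {φ ψ : M → W} {x : M} (h : SmoothSectionAt I rep φ x)
    (h' : SmoothSectionAt I rep ψ x) : SmoothSectionAt I rep (φ - ψ) x :=
  (SmoothFamilyAt.sub hrep (h.family (0 : ℝ)) (h'.family 0)).section

theorem SmoothSectionAt.smul {φ : M → W} {x : M} (a : ℝ) (h : SmoothSectionAt I rep φ x) :
    SmoothSectionAt I rep (a • φ) x :=
  (SmoothFamilyAt.smul hrep contDiffAt_const (h.family (0 : ℝ))).section

theorem SmoothSectionAt.zero (x : M) : SmoothSectionAt I rep (0 : M → W) x := by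
  unfold SmoothSectionAt
  rw [show rep x 0 = fun _ ↦ 0 from funext fun y ↦ hrep.map_zero x y]
  exact contDiffWithinAt_const

/-- The line `φ + t v` of sections. -/
theorem SmoothSectionAt.line {φ v : M → W} {x : M} (h : SmoothSectionAt I rep φ x)
    (h' : SmoothSectionAt I rep v x) (t : ℝ) :
    SmoothFamilyAt I rep (fun t : ℝ ↦ φ + t • v) t x :=
  SmoothFamilyAt.add hrep (h.family t) (SmoothFamilyAt.smul hrep contDiffAt_id (h'.family t))

theorem SmoothFamilyAt.contDiffAt {Φ : S → M → W} {s : S} {x : M}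
    (h : SmoothFamilyAt I rep Φ s x) : ContDiffAt ℝ ∞ (fun s ↦ Φ s x) s := by
  unfold SmoothFamilyAt at h
  have := ContDiffWithinAt.comp (s := univ) (f := fun s : S ↦ (s, extChartAt I x x)) s h
    (ContDiff.contDiffWithinAt (by fun_prop)) (fun y hy ↦ ⟨trivial, mem_range_extChartAt x⟩)
  simpa only [Function.comp_def, hrep.center, contDiffWithinAt_univ] using this

theorem IsLinearRep.rep_deriv {x : M} {y : E} (hy : y ∈ (extChartAt I x).target)
    (Φ : ℝ → M → W) (t : ℝ) :
    rep x (fun x ↦ deriv (fun t ↦ Φ t x) t) y = deriv (fun t ↦ rep x (Φ t) y) t := by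
  obtain ⟨A, hA, hB⟩ := hrep.linear x y
  obtain ⟨B, hB⟩ := hB hy
  simp only [hA]
  exact (deriv_clm_apply_of_leftInverse hB (fun t ↦ Φ t _) t).symm

theorem IsLinearRep.rep_integral [CompleteSpace W] {x : M} {y : E}
    (hy : y ∈ (extChartAt I x).target) (Φ : ℝ → M → W) :
    rep x (fun x ↦ ∫ t in (0 : ℝ)..1, Φ t x) y = ∫ t in (0 : ℝ)..1, rep x (Φ t) y := by
  obtain ⟨A, hA, hB⟩ := hrep.linear x y
  obtain ⟨B, hB⟩ := hB hy
  simp only [hA]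
  exact (integral_clm_apply_of_leftInverse hB (fun t ↦ Φ t _)).symm

/-- The derivative of a smooth family with respect to one of its parameters is smooth. -/
theorem SmoothFamilyAt.deriv {Φ : S × ℝ → M → W} {s : S} {t : ℝ} {x : M}
    (h : SmoothFamilyAt I rep Φ (s, t) x) :
    SmoothFamilyAt I rep (fun s x ↦ deriv (fun t ↦ Φ (s, t) x) t) s x := by
  unfold SmoothFamilyAt at h ⊢
  have h1 : ContDiffWithinAt ℝ ∞
      (fun z : S × E ↦ fderivWithin ℝ (fun t ↦ rep x (Φ (z.1, t)) z.2) univ t)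
      (univ ×ˢ range I) (s, extChartAt I x x) := by
    refine ContDiffWithinAt.fderivWithin (f := fun (z : S × E) t ↦ rep x (Φ (z.1, t)) z.2)
      (g := fun _ ↦ t) (n := ∞) ?_ contDiffWithinAt_const uniqueDiffOn_univ (by simp)
      ⟨trivial, mem_range_extChartAt x⟩ (by simp)
    exact ContDiffWithinAt.comp (f := fun z : (S × E) × ℝ ↦ ((z.1.1, z.2), z.1.2))
      ((s, extChartAt I x x), t) h (ContDiff.contDiffWithinAt (by fun_prop))
      (fun z hz ↦ ⟨trivial, hz.1.2⟩)
  have h2 := h1.clm_apply (contDiffWithinAt_const (c := (1 : ℝ)))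
  refine h2.congr_of_eventuallyEq_of_mem ?_ ⟨trivial, mem_range_extChartAt x⟩
  filter_upwards [eventually_snd_mem_target s x] with z hz
  rw [hrep.rep_deriv hz, fderivWithin_univ, fderiv_apply_one_eq_deriv]

/-- Translation turns the derivative at a moving time into a derivative at the fixed time `0` of the
two-parameter family `Φ (s + t)`, to which `SmoothFamilyAt.deriv` applies. -/
theorem SmoothFamilyAt.deriv_curve {Φ : ℝ → M → W} {t : ℝ} {x : M}
    (h : SmoothFamilyAt I rep Φ t x) :
    SmoothFamilyAt I rep (fun t x ↦ _root_.deriv (fun t ↦ Φ t x) t) t x := by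
  have h1 : SmoothFamilyAt I rep (fun q : ℝ × ℝ ↦ Φ (q.1 + q.2)) (t, 0) x :=
    SmoothFamilyAt.comp (f := fun q : ℝ × ℝ ↦ q.1 + q.2) (by simpa using h)
      (ContDiff.contDiffAt (by fun_prop))
  have h2 := h1.deriv hrep
  have h3 : ∀ s x, _root_.deriv (fun t ↦ Φ (s + t) x) 0 = _root_.deriv (fun t ↦ Φ t x) s := by
    intro s x
    rw [deriv_comp_const_add (fun t ↦ Φ t x) s 0, add_zero]
  simpa only [h3] using h2

/-- The mean of the velocities `u'` between `0` and `r`, so that `u r = u 0 + r • w r`. -/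
def meanVelocity (u : ℝ → M → W) (r : ℝ) : M → W :=
  fun x ↦ ∫ τ in (0 : ℝ)..1, _root_.deriv (fun t ↦ u t x) (τ * r)

omit hrep in
theorem meanVelocity_zero [CompleteSpace W] (u : ℝ → M → W) :
    meanVelocity u 0 = velocity u := by
  ext x
  simp [meanVelocity, velocity]

/-- Hadamard's lemma for curves of sections. It places a curve on the diagonal `s = r` of the family
`u 0 + s • meanVelocity u r`, which is affine in `s`, and so makes it accessible to `var`. -/
theorem eq_add_smul_meanVelocity [CompleteSpace W] {u : ℝ → M → W}
    (hu : ∀ t x, SmoothFamilyAt I rep u t x) (r : ℝ) : u r = u 0 + r • meanVelocity u r := by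
  ext x
  have hc : ContDiff ℝ ∞ (fun t ↦ u t x) :=
    contDiff_iff_contDiffAt.2 fun t ↦ (hu t x).contDiffAt hrep
  have h1 := intervalIntegral.smul_integral_comp_mul_right (a := 0) (b := 1)
    (fun t ↦ _root_.deriv (fun t ↦ u t x) t) r
  simp only [Pi.add_apply, Pi.smul_apply, meanVelocity]
  rw [h1, zero_mul, one_mul, intervalIntegral.integral_deriv_eq_sub]
  · abel
  · exact fun t _ ↦ (hc.differentiable (by simp)) t
  · exact (hc.continuous_deriv (by simp)).intervalIntegrable _ _

theorem SmoothFamilyAt.meanVelocity [CompleteSpace W] [FiniteDimensional ℝ E] {u : ℝ → M → W}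
    (hu : ∀ t x, SmoothFamilyAt I rep u t x) (x : M) :
    SmoothFamilyAt I rep (meanVelocity u) 0 x := by
  have h1 := (hu 0 x).deriv_curve hrep
  unfold SmoothFamilyAt at h1 ⊢
  have h2 := contDiffWithinAt_integral_rescale
    (h := fun t y ↦ rep x (fun x ↦ _root_.deriv (fun t ↦ u t x) t) y) I.convex_range
    I.uniqueDiffOn (mem_range_extChartAt x) h1
  refine h2.congr_of_eventuallyEq_of_mem ?_ ⟨trivial, mem_range_extChartAt x⟩
  filter_upwards [eventually_snd_mem_target (0 : ℝ) x] with z hz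
  exact hrep.rep_integral hz _

/-- Derivatives of components along a curve and in space commute. -/
theorem SmoothFamilyAt.hasDerivAt_fderivWithin {Φ : ℝ → M → W} {t : ℝ} {x : M}
    (h : SmoothFamilyAt I rep Φ t x) :
    HasDerivAt (fun t ↦ fderivWithin ℝ (rep x (Φ t)) (range I) (extChartAt I x x))
      (fderivWithin ℝ (rep x (fun x ↦ _root_.deriv (fun t ↦ Φ t x) t)) (range I)
        (extChartAt I x x)) t := by
  have hmem := mem_range_extChartAt (I := I) x
  refine (CovariantPhaseSpace.hasDerivAt_fderivWithin (g := fun t y ↦ rep x (Φ t) y)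
    I.uniqueDiffOn hmem (I.range_subset_closure_interior hmem) h).congr_deriv ?_
  have : (fun y ↦ _root_.deriv (fun t ↦ rep x (Φ t) y) t) =ᶠ[𝓝[range I] (extChartAt I x x)]
      rep x (fun x ↦ _root_.deriv (fun t ↦ Φ t x) t) := by
    filter_upwards [eventually_mem_target x] with y hy using (hrep.rep_deriv hy _ _).symm
  exact this.fderivWithin_eq_of_mem hmem

end Reps

/-! ### Smoothness of maps into spaces of alternating forms. -/

section AlternatingMaps

variable {E : Type*} [NormedAddCommGroup E] [NormedSpace ℝ E] [FiniteDimensional ℝ E]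

/-- The evaluation of alternating maps on a family of tuples of vectors. -/
def evalTuples {k : ℕ} {ι : Type*} [Fintype ι] (b : ι → Fin k → E) :
    (E [⋀^Fin k]→L[ℝ] ℝ) →L[ℝ] ι → ℝ :=
  ContinuousLinearMap.pi fun i ↦
    (ContinuousMultilinearMap.apply ℝ (fun _ : Fin k ↦ E) ℝ (b i)).comp
      (ContinuousAlternatingMap.toContinuousMultilinearMapLI
        (𝕜 := ℝ) (E := E) (F := ℝ) (ι := Fin k)).toContinuousLinearMap

theorem evalTuples_basis_injective (k : ℕ) :
    Function.Injective (evalTuples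
      (fun v : Fin k → Fin (Module.finrank ℝ E) ↦ fun i ↦ Module.finBasis ℝ E (v i))) := by
  intro α β h
  apply ContinuousAlternatingMap.toAlternatingMap_injective
  refine Module.Basis.ext_alternating (Module.finBasis ℝ E) fun v _ ↦ ?_
  exact congrFun h v

/-- Evaluation on all tuples of basis vectors is an injective linear map into a finite power of `ℝ`.
A left inverse of it recovers `f` from finitely many smooth scalar functions. -/
theorem contDiffWithinAt_alternating {Z : Type*} [NormedAddCommGroup Z] [NormedSpace ℝ Z]
    {k : ℕ} {n : ℕ∞ω} {f : Z → E [⋀^Fin k]→L[ℝ] ℝ} {s : Set Z} {z : Z}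
    (h : ∀ v, ContDiffWithinAt ℝ n (fun z ↦ f z v) s z) : ContDiffWithinAt ℝ n f s z := by
  set e := evalTuples
    (fun v : Fin k → Fin (Module.finrank ℝ E) ↦ fun i ↦ Module.finBasis ℝ E (v i)) with he
  obtain ⟨g, hg⟩ := LinearMap.exists_leftInverse_of_injective e.toLinearMap
    (LinearMap.ker_eq_bot.2 (by simpa [he] using evalTuples_basis_injective (E := E) k))
  have h1 : ContDiffWithinAt ℝ n (fun z ↦ e (f z)) s z := contDiffWithinAt_pi.2 fun i ↦ h _
  have h2 := (LinearMap.toContinuousLinearMap g).contDiff.comp_contDiffWithinAt h1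
  refine h2.congr_of_eventuallyEq (Eventually.of_forall fun z ↦ ?_) ?_
  · exact (LinearMap.congr_fun hg (f z)).symm
  · exact (LinearMap.congr_fun hg (f z)).symm

/-- The pullback `α ∘ A` is linear in `α` and multilinear in the `k` copies of `A`. -/
theorem ContDiffWithinAt.alternating_comp {Z F : Type*} [NormedAddCommGroup Z] [NormedSpace ℝ Z]
    [NormedAddCommGroup F] [NormedSpace ℝ F] [FiniteDimensional ℝ F]
    {k : ℕ} {n : ℕ∞ω} {f : Z → E [⋀^Fin k]→L[ℝ] ℝ} {A : Z → F →L[ℝ] E} {s : Set Z} {z : Z}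
    (hf : ContDiffWithinAt ℝ n f s z) (hA : ContDiffWithinAt ℝ n A s z) :
    ContDiffWithinAt ℝ n (fun z ↦ (f z).compContinuousLinearMap (A z)) s z := by
  refine contDiffWithinAt_alternating fun v ↦ ?_
  have h1 : ContDiffWithinAt ℝ n
      (fun z ↦ ContinuousMultilinearMap.compContinuousLinearMapContinuousMultilinear ℝ
        (fun _ : Fin k ↦ F) (fun _ ↦ E) ℝ (fun _ ↦ A z)) s z :=
    (ContinuousMultilinearMap.contDiff _).comp_contDiffWithinAt
      (contDiffWithinAt_pi.2 fun _ ↦ hA)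
  have h2 : ContDiffWithinAt ℝ n (fun z ↦ (f z).toContinuousMultilinearMap) s z :=
    (ContinuousAlternatingMap.toContinuousMultilinearMapLI
        (𝕜 := ℝ) (E := E) (F := ℝ) (ι := Fin k)).contDiff.comp_contDiffWithinAt hf
  exact (ContinuousMultilinearMap.apply ℝ (fun _ : Fin k ↦ F) ℝ v).contDiff.comp_contDiffWithinAt
    (h1.clm_apply h2)

/-- `ContinuousAlternatingMap.curryLeft` as a continuous linear map. -/
def curryLeftCLM (E : Type*) [NormedAddCommGroup E] [NormedSpace ℝ E] (k : ℕ) :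
    (E [⋀^Fin (k + 1)]→L[ℝ] ℝ) →L[ℝ] E →L[ℝ] E [⋀^Fin k]→L[ℝ] ℝ :=
  (ContinuousAlternatingMap.curryLeftLI (𝕜 := ℝ) (E := E) (F := ℝ) (n := k)).toContinuousLinearMap

omit [FiniteDimensional ℝ E] in
theorem hasFDerivAt_curryLeftCLM (k : ℕ) (α : E [⋀^Fin (k + 1)]→L[ℝ] ℝ) :
    HasFDerivAt (curryLeftCLM E k) (curryLeftCLM E k) α :=
  ContinuousLinearMap.hasFDerivAt (𝕜 := ℝ) (E := E [⋀^Fin (k + 1)]→L[ℝ] ℝ)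
    (F := E →L[ℝ] E [⋀^Fin k]→L[ℝ] ℝ) (curryLeftCLM E k)

theorem ContDiffWithinAt.curryLeft {Z : Type*} [NormedAddCommGroup Z] [NormedSpace ℝ Z]
    {k : ℕ} {n : ℕ∞ω} {f : Z → E [⋀^Fin (k + 1)]→L[ℝ] ℝ} {X : Z → E} {s : Set Z} {z : Z}
    (hf : ContDiffWithinAt ℝ n f s z) (hX : ContDiffWithinAt ℝ n X s z) :
    ContDiffWithinAt ℝ n (fun z ↦ (f z).curryLeft (X z)) s z := by
  have h : ContDiff ℝ n (curryLeftCLM E k) := by fun_prop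
  have h1 : ContDiffWithinAt ℝ n (fun z ↦ curryLeftCLM E k (f z)) s z :=
    h.comp_contDiffWithinAt hf
  exact h1.clm_apply hX

omit [FiniteDimensional ℝ E] in
theorem alternating_comp_comp_of_inv {F : Type*} [NormedAddCommGroup F] [NormedSpace ℝ F]
    {k : ℕ} {A : F →L[ℝ] E} {B : E →L[ℝ] F} (h : A.comp B = ContinuousLinearMap.id ℝ E)
    (α : E [⋀^Fin k]→L[ℝ] ℝ) :
    (α.compContinuousLinearMap A).compContinuousLinearMap B = α := by
  ext v
  change α (fun i ↦ A (B (v i))) = α v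
  congr 1
  funext i
  exact DFunLike.congr_fun h (v i)

end AlternatingMaps

/-! ### The cocycle of coordinate changes, and the three linear chart representations. -/

section Charts

variable {E : Type*} [NormedAddCommGroup E] [NormedSpace ℝ E]
  {H : Type*} [TopologicalSpace H] {I : ModelWithCorners ℝ E H}
  {M : Type*} [TopologicalSpace M] [ChartedSpace H M] [IsManifold I ∞ M]

theorem tangentCoordChange_comp_eq {w x y z : M} (hw : z ∈ (extChartAt I w).source)
    (hx : z ∈ (extChartAt I x).source) (hy : z ∈ (extChartAt I y).source) :
    (tangentCoordChange I x y z).comp (tangentCoordChange I w x z)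
      = tangentCoordChange I w y z := by
  ext v
  exact tangentCoordChange_comp ⟨⟨hw, hx⟩, hy⟩

theorem tangentCoordChange_self_eq {x z : M} (hx : z ∈ (extChartAt I x).source) :
    tangentCoordChange I x x z = ContinuousLinearMap.id ℝ E := by
  ext v
  exact tangentCoordChange_self hx

theorem tangentCoordChange_inv {x y z : M} (hx : z ∈ (extChartAt I x).source)
    (hy : z ∈ (extChartAt I y).source) :
    (tangentCoordChange I y x z).comp (tangentCoordChange I x y z)
      = ContinuousLinearMap.id ℝ E := by
  rw [tangentCoordChange_comp_eq hx hy hx, tangentCoordChange_self_eq hx]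

theorem isLinearRep_vec : IsLinearRep I (vecInChart (M := M) I) where
  center x X := by
    simp only [vecInChart, extChartAt_to_inv]
    exact tangentCoordChange_self (mem_extChartAt_source x)
  linear x y := by
    refine ⟨tangentCoordChange I ((extChartAt I x).symm y) x ((extChartAt I x).symm y),
      fun φ ↦ rfl, fun hy ↦ ⟨tangentCoordChange I x ((extChartAt I x).symm y)
        ((extChartAt I x).symm y), fun w ↦ ?_⟩⟩
    exact DFunLike.congr_fun (tangentCoordChange_inv (mem_extChartAt_source _)
      ((extChartAt I x).map_target hy)) w

theorem isLinearRep_form (k : ℕ) : IsLinearRep I (formInChart (M := M) I (k := k)) where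
  center x X := by
    simp only [formInChart, extChartAt_to_inv]
    rw [tangentCoordChange_self_eq (mem_extChartAt_source x)]
    ext v
    rfl
  linear x y := by
    refine ⟨ContinuousAlternatingMap.compContinuousLinearMapCLM
        (tangentCoordChange I x ((extChartAt I x).symm y) ((extChartAt I x).symm y)),
      fun φ ↦ rfl, fun hy ↦ ⟨ContinuousAlternatingMap.compContinuousLinearMapCLM
        (tangentCoordChange I ((extChartAt I x).symm y) x ((extChartAt I x).symm y)),
        fun w ↦ ?_⟩⟩
    exact alternating_comp_comp_of_inv (tangentCoordChange_inv (mem_extChartAt_source _)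
      ((extChartAt I x).map_target hy)) w

theorem isUnit_tangentCoordChange {x y z : M} (hx : z ∈ (extChartAt I x).source)
    (hy : z ∈ (extChartAt I y).source) : IsUnit (tangentCoordChange I x y z) :=
  ⟨⟨tangentCoordChange I x y z, tangentCoordChange I y x z, tangentCoordChange_inv hy hx,
    tangentCoordChange_inv hx hy⟩, rfl⟩

theorem isLinearRep_field {V : Type*} [NormedAddCommGroup V] [NormedSpace ℝ V]
    (ρ : FieldType E V) : IsLinearRep I (fieldInChart (M := M) ρ I) where
  center x X := by
    simp only [fieldInChart, extChartAt_to_inv]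
    rw [tangentCoordChange_self_eq (mem_extChartAt_source x), ρ.act_one]
    rfl
  linear x y := by
    refine ⟨ρ.act (tangentCoordChange I ((extChartAt I x).symm y) x ((extChartAt I x).symm y)),
      fun φ ↦ rfl, fun hy ↦ ⟨ρ.act (tangentCoordChange I x ((extChartAt I x).symm y)
        ((extChartAt I x).symm y)), fun w ↦ ?_⟩⟩
    have h1 := mem_extChartAt_source (I := I) ((extChartAt I x).symm y)
    have h2 := (extChartAt I x).map_target hy
    rw [← ContinuousLinearMap.comp_apply, ← ρ.act_comp _ _ (isUnit_tangentCoordChange h2 h1)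
      (isUnit_tangentCoordChange h1 h2), tangentCoordChange_inv h1 h2, ρ.act_one]
    rfl

end Charts

/-! ### Pullback to normed spaces, and chart independence of `d` and of contraction. -/

section Pull

variable {E : Type*} [NormedAddCommGroup E] [NormedSpace ℝ E]
  {H : Type*} [TopologicalSpace H] {I : ModelWithCorners ℝ E H}
  {M : Type*} [TopologicalSpace M] [ChartedSpace H M] [IsManifold I ∞ M]
  {Z : Type*} [NormedAddCommGroup Z] [NormedSpace ℝ Z]

variable (I) in
/-- The pullback of a form along a map defined on a subset of a normed space. -/
def pullWithin (f : Z → M) (s : Set Z) {k : ℕ} (η : M → E [⋀^Fin k]→L[ℝ] ℝ) :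
    Z → Z [⋀^Fin k]→L[ℝ] ℝ :=
  fun u ↦ (η (f u)).compContinuousLinearMap (mfderivWithin 𝓘(ℝ, Z) I f s u : Z →L[ℝ] E)

/-- `mfderivWithin` is written in the preferred chart at the image point, which moves with `u`. The
coordinate change re-expresses it in one fixed chart, where it can be differentiated further. -/
theorem tangentCoordChange_comp_mfderivWithin {f : Z → M} {s : Set Z} {u : Z} {x : M}
    (hf : MDifferentiableWithinAt 𝓘(ℝ, Z) I f s u) (hx : f u ∈ (extChartAt I x).source)
    (hs : UniqueDiffWithinAt ℝ s u) :
    (tangentCoordChange I (f u) x (f u)).comp (mfderivWithin 𝓘(ℝ, Z) I f s u : Z →L[ℝ] E)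
      = fderivWithin ℝ (extChartAt I x ∘ f) s u := by
  have h1 := hf.hasMFDerivWithinAt.2
  simp only [writtenInExtChartAt, extChartAt_model_space_eq_id, PartialEquiv.refl_symm,
    PartialEquiv.refl_coe, Function.comp_id, preimage_id_eq, id_eq, modelWithCornersSelf_coe,
    range_id, inter_univ] at h1
  have h2 := hasFDerivWithinAt_tangentCoordChange (I := I) (x := f u) (y := x) (z := f u)
    ⟨mem_extChartAt_source _, hx⟩
  have h3 := h2.comp u h1 (fun y _ ↦ by
    simp only [Function.comp_apply, mfld_simps])
  refine (HasFDerivWithinAt.fderivWithin ?_ hs).symm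
  refine h3.congr_of_eventuallyEq ?_ ?_
  · have := hf.continuousWithinAt.preimage_mem_nhdsWithin
      (extChartAt_source_mem_nhds (I := I) (f u))
    filter_upwards [this] with y hy
    simp only [Function.comp_apply]
    rw [(extChartAt I (f u)).left_inv hy]
  · simp

theorem mfderivWithin_extChartAt_symm_eq {x : M} {y : E} (hy : y ∈ (extChartAt I x).target) :
    (mfderivWithin 𝓘(ℝ, E) I (extChartAt I x).symm (range I) y : E →L[ℝ] E)
      = tangentCoordChange I x ((extChartAt I x).symm y) ((extChartAt I x).symm y) := by
  have h := tangentCoordChange_comp_mfderivWithin (I := I) (x := (extChartAt I x).symm y)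
    (mdifferentiableWithinAt_extChartAt_symm hy) (mem_extChartAt_source _)
    (I.uniqueDiffOn y (extChartAt_target_subset_range x hy))
  rw [tangentCoordChange_self_eq (mem_extChartAt_source _)] at h
  rw [tangentCoordChange_def, (extChartAt I x).right_inv hy, ← h]
  rfl

/-- Chart independence of `d` thereby becomes a case of its naturality, with an inverse chart as the
map. -/
theorem formInChart_eq_pullWithin {x : M} {y : E} (hy : y ∈ (extChartAt I x).target) {k : ℕ}
    (η : M → E [⋀^Fin k]→L[ℝ] ℝ) :
    formInChart I x η y = pullWithin I (extChartAt I x).symm (range I) η y := by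
  simp only [formInChart, pullWithin]
  rw [mfderivWithin_extChartAt_symm_eq hy]

theorem contMDiffWithinAt_extChartAt_symm_range {x : M} {y : E}
    (hy : y ∈ (extChartAt I x).target) :
    ContMDiffWithinAt 𝓘(ℝ, E) I ∞ (extChartAt I x).symm (range I) y :=
  (contMDiffOn_extChartAt_symm x y hy).mono_of_mem_nhdsWithin
    (extChartAt_target_mem_nhdsWithin_of_mem hy)

theorem eventually_mdifferentiableWithinAt {f : Z → M} {s : Set Z} {u : Z} (hu : u ∈ s)
    (hf : ContMDiffWithinAt 𝓘(ℝ, Z) I ∞ f s u) :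
    ∀ᶠ v in 𝓝[s] u, MDifferentiableWithinAt 𝓘(ℝ, Z) I f s v := by
  have h : ContMDiffWithinAt 𝓘(ℝ, Z) I 1 f s u := hf.of_le (by simp)
  have h' := contMDiffWithinAt_iff_contMDiffWithinAt_nhdsWithin (by simp) |>.1 h
  rw [insert_eq_of_mem hu] at h'
  exact h'.mono fun v hv ↦ hv.mdifferentiableWithinAt one_ne_zero

theorem contDiffWithinAt_extChartAt_comp {f : Z → M} {s : Set Z} {u : Z}
    (hf : ContMDiffWithinAt 𝓘(ℝ, Z) I ∞ f s u) {x : M} (hx : f u ∈ (extChartAt I x).source) :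
    ContDiffWithinAt ℝ ∞ (extChartAt I x ∘ f) s u :=
  contMDiffWithinAt_iff_contDiffWithinAt.1 ((contMDiffAt_extChartAt' (by
    simpa using hx)).comp_contMDiffWithinAt u hf)

/-- The neighbourhood is independent of `η`, so it serves all members of a family of forms at once.
-/
theorem pullWithin_eventuallyEq {f : Z → M} {s : Set Z} {u : Z} (hs : UniqueDiffOn ℝ s)
    (hu : u ∈ s) (hf : ContMDiffWithinAt 𝓘(ℝ, Z) I ∞ f s u) {x : M}
    (hx : f u ∈ (extChartAt I x).source) {k : ℕ} :
    ∀ᶠ v in 𝓝[s] u, ∀ η : M → E [⋀^Fin k]→L[ℝ] ℝ, pullWithin I f s η v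
      = (formInChart I x η (extChartAt I x (f v))).compContinuousLinearMap
          (fderivWithin ℝ (extChartAt I x ∘ f) s v) := by
  have h1 := hf.continuousWithinAt.preimage_mem_nhdsWithin
    ((isOpen_extChartAt_source (I := I) x).mem_nhds hx)
  filter_upwards [eventually_mdifferentiableWithinAt hu hf, h1, self_mem_nhdsWithin]
    with v hd hv hvs η
  rw [← tangentCoordChange_comp_mfderivWithin hd hv (hs v hvs)]
  simp only [pullWithin, formInChart]
  rw [(extChartAt I x).left_inv hv]
  exact congrArg (·.compContinuousLinearMap (mfderivWithin 𝓘(ℝ, Z) I f s v : Z →L[ℝ] E))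
    (alternating_comp_comp_of_inv
      (tangentCoordChange_inv (I := I) (mem_extChartAt_source (f v)) hv) (η (f v))).symm

theorem SmoothFamilyAt.pullWithin [FiniteDimensional ℝ E] [FiniteDimensional ℝ Z]
    {S : Type*} [NormedAddCommGroup S] [NormedSpace ℝ S]
    {f : Z → M} {s : Set Z} {u : Z} (hs : UniqueDiffOn ℝ s)
    (hu : u ∈ s) (hf : ContMDiffWithinAt 𝓘(ℝ, Z) I ∞ f s u) {k : ℕ}
    {Φ : S → M → E [⋀^Fin k]→L[ℝ] ℝ} {r : S} (h : SmoothFamilyAt I (formInChart I) Φ r (f u)) :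
    ContDiffWithinAt ℝ ∞ (fun z : S × Z ↦ pullWithin I f s (Φ z.1) z.2) (univ ×ˢ s) (r, u) := by
  have hc := contDiffWithinAt_extChartAt_comp hf (mem_extChartAt_source (I := I) (f u))
  have h1 : ContDiffWithinAt ℝ ∞
      (fun z : S × Z ↦ formInChart I (f u) (Φ z.1) (extChartAt I (f u) (f z.2)))
      (univ ×ˢ s) (r, u) := by
    unfold SmoothFamilyAt at h
    refine ContDiffWithinAt.comp (f := fun z : S × Z ↦ (z.1, extChartAt I (f u) (f z.2)))
      (r, u) h ?_ ?_
    · exact contDiffWithinAt_fst.prodMk (ContDiffWithinAt.comp (f := fun z : S × Z ↦ z.2) (r, u) hc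
        contDiffWithinAt_snd (fun z hz ↦ hz.2))
    · intro z hz
      refine ⟨trivial, ?_⟩
      simp only [mfld_simps]
  have h2 : ContDiffWithinAt ℝ ∞
      (fun z : S × Z ↦ fderivWithin ℝ (extChartAt I (f u) ∘ f) s z.2) (univ ×ˢ s) (r, u) :=
    ContDiffWithinAt.comp (f := fun z : S × Z ↦ z.2) (r, u)
      (hc.fderivWithin_right hs (m := ∞) (by simp) hu) contDiffWithinAt_snd (fun z hz ↦ hz.2)
  refine (h1.alternating_comp h2).congr_of_eventuallyEq_of_mem ?_ ⟨trivial, hu⟩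
  have h3 := pullWithin_eventuallyEq hs hu hf (mem_extChartAt_source (I := I) (f u)) (k := k)
  rw [nhdsWithin_prod_eq]
  filter_upwards [h3.prod_inr _] with z hz using hz _

/-- In a fixed chart this is naturality of `d` between normed spaces. With `f` an inverse chart it
yields chart independence of `d`; with `f` a singular cube it serves Stokes' theorem. -/
theorem extDerivWithin_pullWithin_chart {f : Z → M} {s : Set Z} {u : Z} (hs : UniqueDiffOn ℝ s)
    (hu : u ∈ s) (hu' : u ∈ closure (interior s)) (hf : ContMDiffWithinAt 𝓘(ℝ, Z) I ∞ f s u)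
    {x : M} (hx : f u ∈ (extChartAt I x).source) {k : ℕ} {η : M → E [⋀^Fin k]→L[ℝ] ℝ}
    (hη : DifferentiableWithinAt ℝ (formInChart I x η) (range I) (extChartAt I x (f u))) :
    extDerivWithin (pullWithin I f s η) s u
      = (extDerivWithin (formInChart I x η) (range I)
          (extChartAt I x (f u))).compContinuousLinearMap
          (fderivWithin ℝ (extChartAt I x ∘ f) s u) := by
  have h1 : pullWithin I f s η =ᶠ[𝓝[s] u]
      fun v ↦ (formInChart I x η ((extChartAt I x ∘ f) v)).compContinuousLinearMap
          (fderivWithin ℝ (extChartAt I x ∘ f) s v) := by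
    filter_upwards [pullWithin_eventuallyEq hs hu hf hx] with v hv using hv η
  rw [h1.extDerivWithin_eq_of_mem hu]
  refine extDerivWithin_pullback (t := range I) (r := ∞) hη
    (contDiffWithinAt_extChartAt_comp hf hx) (by simp; exact WithTop.coe_le_coe.2 le_top)
    hs hu' hu ?_
  intro v _
  simp only [mfld_simps]

/-- The chart expression of `d η` is the exterior derivative of the chart expression. -/
theorem formInChart_extD {x : M} {y : E} (hy : y ∈ (extChartAt I x).target) {k : ℕ}
    {η : M → E [⋀^Fin k]→L[ℝ] ℝ}
    (hη : DifferentiableWithinAt ℝ (formInChart I x η) (range I) y) :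
    formInChart I x (extD I η) y = extDerivWithin (formInChart I x η) (range I) y := by
  set p := (extChartAt I x).symm y with hp
  have hpx : p ∈ (extChartAt I x).source := (extChartAt I x).map_target hy
  have hpy : extChartAt I x p = y := (extChartAt I x).right_inv hy
  have hpt := mem_extChartAt_target (I := I) p
  have hpr := extChartAt_target_subset_range p hpt
  have hpp : (extChartAt I p).symm (extChartAt I p p) = p := extChartAt_to_inv p
  -- `extD` at `p` uses the chart at `p`. The expression of `η` there is a pullback along the
  -- inverse chart, and reading it in the chart at `x` brings in the transition map, whose
  -- derivative at `p` is the coordinate change.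
  have h1 : extD I η p = (extDerivWithin (formInChart I x η) (range I) y).compContinuousLinearMap
      (tangentCoordChange I p x p) := by
    have h2 : formInChart I p η =ᶠ[𝓝[range I] (extChartAt I p p)]
        pullWithin I (extChartAt I p).symm (range I) η := by
      filter_upwards [eventually_mem_target p] with z hz using formInChart_eq_pullWithin hz η
    rw [extD, h2.extDerivWithin_eq_of_mem hpr,
      extDerivWithin_pullWithin_chart I.uniqueDiffOn hpr (I.range_subset_closure_interior hpr)
        (contMDiffWithinAt_extChartAt_symm_range hpt) (x := x) (by rwa [hpp])
        (by rwa [hpp, hpy]), hpp, hpy]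
    rfl
  rw [formInChart]
  simp only [← hp, h1]
  exact alternating_comp_comp_of_inv
    (tangentCoordChange_inv (I := I) hpx (mem_extChartAt_source p)) _

theorem SmoothFamilyAt.eventually_differentiableWithinAt
    {W : Type*} [NormedAddCommGroup W] [NormedSpace ℝ W] {rep : M → (M → W) → E → W}
    {S : Type*} [NormedAddCommGroup S] [NormedSpace ℝ S]
    {Φ : S → M → W} {r : S} {x : M} (h : SmoothFamilyAt I rep Φ r x) :
    ∀ᶠ z in 𝓝[univ ×ˢ range I] (r, extChartAt I x x),
      DifferentiableWithinAt ℝ (rep x (Φ z.1)) (range I) z.2 := by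
  unfold SmoothFamilyAt at h
  have hm : (r, extChartAt I x x) ∈ (univ : Set S) ×ˢ range I :=
    ⟨trivial, mem_range_extChartAt x⟩
  have h1 := (h.of_le (m := 1) (by simp)).eventually (by simp)
  rw [insert_eq_of_mem hm] at h1
  filter_upwards [h1] with z hz
  exact DifferentiableWithinAt.comp (f := fun y : E ↦ (z.1, y)) z.2
    (hz.differentiableWithinAt one_ne_zero) (by fun_prop) (fun y hy ↦ ⟨trivial, hy⟩)

theorem SmoothFamilyAt.extD [FiniteDimensional ℝ E]
    {S : Type*} [NormedAddCommGroup S] [NormedSpace ℝ S] {k : ℕ}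
    {Φ : S → M → E [⋀^Fin k]→L[ℝ] ℝ} {r : S} {x : M}
    (h : SmoothFamilyAt I (formInChart I) Φ r x) :
    SmoothFamilyAt I (formInChart I) (fun s ↦ extD I (Φ s)) r x := by
  have hd := h.eventually_differentiableWithinAt
  unfold SmoothFamilyAt at h ⊢
  have hm : (r, extChartAt I x x) ∈ (univ : Set S) ×ˢ range I :=
    ⟨trivial, mem_range_extChartAt x⟩
  have h1 : ContDiffWithinAt ℝ ∞
      (fun z : S × E ↦ fderivWithin ℝ (formInChart I x (Φ z.1)) (range I) z.2)
      (univ ×ˢ range I) (r, extChartAt I x x) := by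
    refine ContDiffWithinAt.fderivWithin (f := fun (z : S × E) ↦ formInChart I x (Φ z.1))
      (g := fun z ↦ z.2) (n := ∞) ?_ contDiffWithinAt_snd I.uniqueDiffOn (by simp)
      hm (fun z hz ↦ hz.2)
    exact ContDiffWithinAt.comp (f := fun z : (S × E) × E ↦ (z.1.1, z.2))
      ((r, extChartAt I x x), extChartAt I x x) h (ContDiff.contDiffWithinAt (by fun_prop))
      (fun z hz ↦ ⟨trivial, hz.2⟩)
  have h2 := (ContinuousAlternatingMap.alternatizeUncurryFinCLM ℝ E ℝ
    (n := k)).contDiff.comp_contDiffWithinAt h1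
  refine h2.congr_of_eventuallyEq_of_mem ?_ hm
  filter_upwards [hd, eventually_snd_mem_target r x] with z hz hzt
  exact formInChart_extD hzt hz

/-- The pullback along a smooth map commutes with the exterior derivative. -/
theorem extDerivWithin_pullWithin {f : Z → M} {s : Set Z} {u : Z} (hs : UniqueDiffOn ℝ s)
    (hu : u ∈ s) (hu' : u ∈ closure (interior s)) (hf : ContMDiffWithinAt 𝓘(ℝ, Z) I ∞ f s u)
    {k : ℕ} {η : M → E [⋀^Fin k]→L[ℝ] ℝ} (hη : SmoothSectionAt I (formInChart I) η (f u)) :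
    extDerivWithin (pullWithin I f s η) s u = pullWithin I f s (extD I η) u := by
  rw [extDerivWithin_pullWithin_chart hs hu hu' hf (mem_extChartAt_source _)
    (ContDiffWithinAt.differentiableWithinAt hη (by simp))]
  simp only [pullWithin, CovariantPhaseSpace.extD]
  rw [← tangentCoordChange_comp_mfderivWithin (hf.mdifferentiableWithinAt (by simp))
    (mem_extChartAt_source _) (hs u hu), tangentCoordChange_self_eq (mem_extChartAt_source _)]
  rfl

/-- Vectors and forms are transformed with mutually inverse coordinate changes, which cancel in the
contracted slot. -/
theorem contract_formInChart {x : M} {y : E} (hy : y ∈ (extChartAt I x).target) {k : ℕ}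
    (X : M → E) (η : M → E [⋀^Fin (k + 1)]→L[ℝ] ℝ) :
    formInChart I x (contract X η) y = (formInChart I x η y).curryLeft (vecInChart I x X y) := by
  have := DFunLike.congr_fun (tangentCoordChange_inv (I := I)
    (mem_extChartAt_source ((extChartAt I x).symm y)) ((extChartAt I x).map_target hy))
  simp only [ContinuousLinearMap.comp_apply, ContinuousLinearMap.id_apply] at this
  ext w
  simp only [formInChart, contract, vecInChart,
    ContinuousAlternatingMap.compContinuousLinearMap_apply,
    ContinuousAlternatingMap.curryLeft_apply_apply]
  congr 1
  funext i
  refine Fin.cases ?_ (fun j ↦ ?_) i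
  · exact (this _).symm
  · rfl

theorem SmoothFamilyAt.contract [FiniteDimensional ℝ E]
    {S : Type*} [NormedAddCommGroup S] [NormedSpace ℝ S] {k : ℕ}
    {X : S → M → E} {Φ : S → M → E [⋀^Fin (k + 1)]→L[ℝ] ℝ} {r : S} {x : M}
    (hX : SmoothFamilyAt I (vecInChart I) X r x) (h : SmoothFamilyAt I (formInChart I) Φ r x) :
    SmoothFamilyAt I (formInChart I) (fun s ↦ contract (X s) (Φ s)) r x := by
  unfold SmoothFamilyAt at *
  refine (h.curryLeft hX).congr_of_eventuallyEq_of_mem ?_ ⟨trivial, mem_range_extChartAt x⟩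
  filter_upwards [eventually_snd_mem_target r x] with z hz using contract_formInChart hz _ _

end Pull

/-! ### Exterior calculus on the manifold, and derivatives along curves of forms. -/

section ExteriorCalculus

variable {E : Type*} [NormedAddCommGroup E] [NormedSpace ℝ E]
  {H : Type*} [TopologicalSpace H] {I : ModelWithCorners ℝ E H}
  {M : Type*} [TopologicalSpace M] [ChartedSpace H M] [IsManifold I ∞ M]

theorem extD_add {k : ℕ} {η ζ : M → E [⋀^Fin k]→L[ℝ] ℝ} (hη : SmoothForm I η)
    (hζ : SmoothForm I ζ) : extD I (η + ζ) = extD I η + extD I ζ := by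
  ext1 x
  have h : formInChart I x (η + ζ) = formInChart I x η + formInChart I x ζ :=
    funext fun y ↦ (isLinearRep_form k).map_add x η ζ y
  rw [extD, h, extDerivWithin_add (I.uniqueDiffOn _ (mem_range_extChartAt x))
    (ContDiffWithinAt.differentiableWithinAt (hη x) (by simp))
    (ContDiffWithinAt.differentiableWithinAt (hζ x) (by simp))]
  rfl

theorem extD_smul {k : ℕ} (a : ℝ) (η : M → E [⋀^Fin k]→L[ℝ] ℝ) :
    extD I (a • η) = a • extD I η := by
  ext1 x
  have h : formInChart I x (a • η) = a • formInChart I x η :=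
    funext fun y ↦ (isLinearRep_form k).map_smul x a η y
  rw [extD, h, extDerivWithin_smul _ _ (I.uniqueDiffOn _ (mem_range_extChartAt x))]
  rfl

theorem extD_neg {k : ℕ} (η : M → E [⋀^Fin k]→L[ℝ] ℝ) : extD I (-η) = -extD I η := by
  rw [← neg_one_smul ℝ η, extD_smul]
  exact neg_one_smul ℝ (extD I η)

theorem SmoothForm.add {k : ℕ} {η ζ : M → E [⋀^Fin k]→L[ℝ] ℝ} (hη : SmoothForm I η)
    (hζ : SmoothForm I ζ) : SmoothForm I (η + ζ) :=
  fun x ↦ SmoothSectionAt.add (isLinearRep_form k) (hη x) (hζ x)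

theorem SmoothForm.sub {k : ℕ} {η ζ : M → E [⋀^Fin k]→L[ℝ] ℝ} (hη : SmoothForm I η)
    (hζ : SmoothForm I ζ) : SmoothForm I (η - ζ) :=
  fun x ↦ SmoothSectionAt.sub (isLinearRep_form k) (hη x) (hζ x)

theorem SmoothForm.neg {k : ℕ} {η : M → E [⋀^Fin k]→L[ℝ] ℝ} (hη : SmoothForm I η) :
    SmoothForm I (-η) := by
  rw [← neg_one_smul ℝ η]
  exact fun x ↦ SmoothSectionAt.smul (isLinearRep_form k) (-1) (hη x)

theorem extD_sub {k : ℕ} {η ζ : M → E [⋀^Fin k]→L[ℝ] ℝ} (hη : SmoothForm I η)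
    (hζ : SmoothForm I ζ) : extD I (η - ζ) = extD I η - extD I ζ := by
  rw [sub_eq_add_neg, extD_add hη hζ.neg, extD_neg, sub_eq_add_neg]

theorem SmoothForm.extD [FiniteDimensional ℝ E] {k : ℕ} {η : M → E [⋀^Fin k]→L[ℝ] ℝ}
    (hη : SmoothForm I η) : SmoothForm I (extD I η) :=
  fun x ↦ ((hη x).family (0 : ℝ)).extD.section

theorem SmoothVec.contract [FiniteDimensional ℝ E] {k : ℕ} {X : M → E}
    {η : M → E [⋀^Fin (k + 1)]→L[ℝ] ℝ}
    (hX : SmoothVec I X) (hη : SmoothForm I η) : SmoothForm I (contract X η) :=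
  fun x ↦ (((hX x).family (0 : ℝ)).contract ((hη x).family 0)).section

theorem extD_extD [FiniteDimensional ℝ E] {k : ℕ} {η : M → E [⋀^Fin k]→L[ℝ] ℝ}
    (hη : SmoothForm I η) : CovariantPhaseSpace.extD I (CovariantPhaseSpace.extD I η) = 0 := by
  ext1 x
  have hx := mem_range_extChartAt (I := I) x
  have hd := (eventually_mem_target (I := I) x)
  have hs : ∀ᶠ y in 𝓝[range I] (extChartAt I x x),
      DifferentiableWithinAt ℝ (formInChart I x η) (range I) y := by
    have h1 := (ContDiffWithinAt.of_le (m := 1) (hη x) (by simp)).eventually (by simp)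
    rw [insert_eq_of_mem hx] at h1
    exact h1.mono fun y hy ↦ hy.differentiableWithinAt one_ne_zero
  have h : formInChart I x (CovariantPhaseSpace.extD I η) =ᶠ[𝓝[range I] (extChartAt I x x)]
      extDerivWithin (formInChart I x η) (range I) := by
    filter_upwards [hd, hs] with y hy hys using formInChart_extD hy hys
  rw [CovariantPhaseSpace.extD, h.extDerivWithin_eq_of_mem hx]
  exact extDerivWithin_extDerivWithin_apply (hη x) (by simp; exact WithTop.coe_le_coe.2 le_top)
    I.uniqueDiffOn (I.range_subset_closure_interior hx) hx

theorem contract_add_form {k : ℕ} (X : M → E) (η ζ : M → E [⋀^Fin (k + 1)]→L[ℝ] ℝ) :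
    contract X (η + ζ) = contract X η + contract X ζ := rfl

theorem contract_sub_form {k : ℕ} (X : M → E) (η ζ : M → E [⋀^Fin (k + 1)]→L[ℝ] ℝ) :
    contract X (η - ζ) = contract X η - contract X ζ := rfl

theorem contract_zero_form {k : ℕ} (X : M → E) :
    contract X (0 : M → E [⋀^Fin (k + 1)]→L[ℝ] ℝ) = 0 := rfl

/-! Derivatives along curves of forms, at the parameter `0`. -/

/-- The derivative at `0` of a curve of sections. -/
def curveDeriv {P W : Type*} [NormedAddCommGroup W] [NormedSpace ℝ W] (η : ℝ → P → W) : P → W :=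
  fun p ↦ deriv (fun t ↦ η t p) 0

theorem SmoothFamilyAt.hasDerivAt {W : Type*} [NormedAddCommGroup W] [NormedSpace ℝ W]
    {rep : M → (M → W) → E → W} (hrep : IsLinearRep I rep) {Φ : ℝ → M → W} {x : M}
    (h : SmoothFamilyAt I rep Φ 0 x) : HasDerivAt (fun t ↦ Φ t x) (curveDeriv Φ x) 0 :=
  ((h.contDiffAt hrep).differentiableAt (by simp)).hasDerivAt

theorem SmoothFamilyAt.smoothForm_curveDeriv {k : ℕ} {Φ : ℝ → M → E [⋀^Fin k]→L[ℝ] ℝ}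
    (h : ∀ x, SmoothFamilyAt I (formInChart I) Φ 0 x) : SmoothForm I (curveDeriv Φ) :=
  fun x ↦ ((h x).deriv_curve (isLinearRep_form k)).section

theorem curveDeriv_add {k : ℕ} {Φ Ψ : ℝ → M → E [⋀^Fin k]→L[ℝ] ℝ}
    (h : ∀ x, SmoothFamilyAt I (formInChart I) Φ 0 x)
    (h' : ∀ x, SmoothFamilyAt I (formInChart I) Ψ 0 x) :
    curveDeriv (fun t ↦ Φ t + Ψ t) = curveDeriv Φ + curveDeriv Ψ :=
  funext fun x ↦ (((h x).hasDerivAt (isLinearRep_form k)).add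
    ((h' x).hasDerivAt (isLinearRep_form k))).deriv

theorem curveDeriv_sub {k : ℕ} {Φ Ψ : ℝ → M → E [⋀^Fin k]→L[ℝ] ℝ}
    (h : ∀ x, SmoothFamilyAt I (formInChart I) Φ 0 x)
    (h' : ∀ x, SmoothFamilyAt I (formInChart I) Ψ 0 x) :
    curveDeriv (fun t ↦ Φ t - Ψ t) = curveDeriv Φ - curveDeriv Ψ :=
  funext fun x ↦ (((h x).hasDerivAt (isLinearRep_form k)).sub
    ((h' x).hasDerivAt (isLinearRep_form k))).deriv

/-- The exterior derivative is the alternatization of the spatial derivative, which commutes with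
the derivative in the parameter. This is the source of `δd = dδ`. -/
theorem curveDeriv_extD {k : ℕ} {Φ : ℝ → M → E [⋀^Fin k]→L[ℝ] ℝ}
    (h : ∀ x, SmoothFamilyAt I (formInChart I) Φ 0 x) :
    curveDeriv (fun t ↦ extD I (Φ t)) = extD I (curveDeriv Φ) :=
  funext fun x ↦ ((ContinuousAlternatingMap.alternatizeUncurryFinCLM ℝ E ℝ
    (n := k)).hasFDerivAt.comp_hasDerivAt 0
      ((h x).hasDerivAt_fderivWithin (isLinearRep_form k))).deriv

theorem curveDeriv_contract {k : ℕ} {X : ℝ → M → E} {Φ : ℝ → M → E [⋀^Fin (k + 1)]→L[ℝ] ℝ}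
    {X' : M → E} (hX : ∀ x, HasDerivAt (fun t ↦ X t x) (X' x) 0)
    (h : ∀ x, SmoothFamilyAt I (formInChart I) Φ 0 x) :
    curveDeriv (fun t ↦ contract (X t) (Φ t))
      = contract X' (Φ 0) + contract (X 0) (curveDeriv Φ) := by
  ext1 x
  have h1 : HasDerivAt (fun t ↦ curryLeftCLM E k (Φ t x)) (curryLeftCLM E k (curveDeriv Φ x)) 0 :=
    HasFDerivAt.comp_hasDerivAt (𝕜 := ℝ) (F := E [⋀^Fin (k + 1)]→L[ℝ] ℝ)
      (E := E →L[ℝ] E [⋀^Fin k]→L[ℝ] ℝ) (l := curryLeftCLM E k) (f := fun t ↦ Φ t x) (0 : ℝ)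
      (hasFDerivAt_curryLeftCLM k (Φ 0 x)) ((h x).hasDerivAt (isLinearRep_form _))
  rw [add_comm]
  exact (h1.clm_apply (hX x)).deriv

end ExteriorCalculus

/-! ### Pullback to the hypersurface. -/

section Pullbacks

variable {E : Type*} [NormedAddCommGroup E] [NormedSpace ℝ E]
  {H : Type*} [TopologicalSpace H] {I : ModelWithCorners ℝ E H}
  {M : Type*} [TopologicalSpace M] [ChartedSpace H M] [IsManifold I ∞ M]
  {F : Type*} [NormedAddCommGroup F] [NormedSpace ℝ F]
  {G : Type*} [TopologicalSpace G] {J : ModelWithCorners ℝ F G}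
  {N : Type*} [TopologicalSpace N] [ChartedSpace G N] [IsManifold J ∞ N] {ι : N → M}

theorem pullback_add {k : ℕ} (η ζ : M → E [⋀^Fin k]→L[ℝ] ℝ) :
    pullback I J ι (η + ζ) = pullback I J ι η + pullback I J ι ζ := rfl

theorem pullback_sub {k : ℕ} (η ζ : M → E [⋀^Fin k]→L[ℝ] ℝ) :
    pullback I J ι (η - ζ) = pullback I J ι η - pullback I J ι ζ := rfl

theorem pullback_contract {k : ℕ} {X : M → E} {XN : N → F}
    (h : ∀ p, (mfderiv J I ι p : F →L[ℝ] E) (XN p) = X (ι p)) (η : M → E [⋀^Fin (k + 1)]→L[ℝ] ℝ) :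
    pullback I J ι (contract X η) = contract XN (pullback I J ι η) := by
  ext p v
  change η (ι p) (Matrix.vecCons (X (ι p)) fun i ↦ (mfderiv J I ι p : F →L[ℝ] E) (v i))
    = η (ι p) fun i ↦ (mfderiv J I ι p : F →L[ℝ] E) (Matrix.vecCons (XN p) v i)
  rw [← h]
  congr 1
  funext i
  exact Fin.cases rfl (fun j ↦ rfl) i

theorem curveDeriv_pullback {k : ℕ} {Φ : ℝ → M → E [⋀^Fin k]→L[ℝ] ℝ}
    (h : ∀ x, SmoothFamilyAt I (formInChart I) Φ 0 x) :
    curveDeriv (fun t ↦ pullback I J ι (Φ t)) = pullback I J ι (curveDeriv Φ) := by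
  ext1 p
  let A : (E [⋀^Fin k]→L[ℝ] ℝ) →L[ℝ] F [⋀^Fin k]→L[ℝ] ℝ :=
    ContinuousAlternatingMap.compContinuousLinearMapCLM (mfderiv J I ι p : F →L[ℝ] E)
  exact (A.hasFDerivAt.comp_hasDerivAt 0 ((h (ι p)).hasDerivAt (isLinearRep_form k))).deriv

theorem pullWithin_pullback {Z : Type*} [NormedAddCommGroup Z] [NormedSpace ℝ Z]
    {f : Z → N} {s : Set Z} {u : Z} (hι : MDifferentiableAt J I ι (f u))
    (hf : MDifferentiableWithinAt 𝓘(ℝ, Z) J f s u) (hs : UniqueDiffWithinAt ℝ s u) {k : ℕ}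
    (η : M → E [⋀^Fin k]→L[ℝ] ℝ) :
    pullWithin J f s (pullback I J ι η) u = pullWithin I (ι ∘ f) s η u := by
  have h := mfderiv_comp_mfderivWithin (I := 𝓘(ℝ, Z)) (I' := J) (I'' := I) u hι hf
    hs.uniqueMDiffWithinAt
  simp only [pullWithin, h]
  rfl

variable [FiniteDimensional ℝ E] [FiniteDimensional ℝ F]

theorem SmoothFamilyAt.pullback {S : Type*} [NormedAddCommGroup S] [NormedSpace ℝ S]
    (hι : ContMDiff J I ∞ ι) {k : ℕ} {Φ : S → M → E [⋀^Fin k]→L[ℝ] ℝ} {r : S} {p : N}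
    (h : SmoothFamilyAt I (formInChart I) Φ r (ι p)) :
    SmoothFamilyAt J (formInChart J) (fun s ↦ pullback I J ι (Φ s)) r p := by
  have hp := mem_range_extChartAt (I := J) p
  have hf : ContMDiffWithinAt 𝓘(ℝ, F) I ∞ (ι ∘ (extChartAt J p).symm) (range J)
      (extChartAt J p p) :=
    hι.contMDiffAt.comp_contMDiffWithinAt _
      (contMDiffWithinAt_extChartAt_symm_range (mem_extChartAt_target p))
  have h1 := SmoothFamilyAt.pullWithin (f := ι ∘ (extChartAt J p).symm) J.uniqueDiffOn hp hf
    (Φ := Φ) (r := r) (by simpa [extChartAt_to_inv] using h)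
  unfold SmoothFamilyAt
  refine h1.congr_of_eventuallyEq_of_mem ?_ ⟨trivial, hp⟩
  filter_upwards [eventually_snd_mem_target r p] with z hz
  rw [formInChart_eq_pullWithin hz]
  exact pullWithin_pullback (hι.mdifferentiableAt (by simp))
    (mdifferentiableWithinAt_extChartAt_symm hz)
    (J.uniqueDiffOn _ (extChartAt_target_subset_range p hz)) _

theorem SmoothForm.pullback (hι : ContMDiff J I ∞ ι) {k : ℕ} {η : M → E [⋀^Fin k]→L[ℝ] ℝ}
    (h : SmoothForm I η) : SmoothForm J (pullback I J ι η) :=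
  fun p ↦ (((h (ι p)).family (0 : ℝ)).pullback hι).section

/-- In a chart of `N`, pulling back along `ι` is pulling back along `ι` composed with the inverse
chart, so naturality for maps out of a normed space suffices. -/
theorem pullback_extD (hι : ContMDiff J I ∞ ι) {k : ℕ} {η : M → E [⋀^Fin k]→L[ℝ] ℝ}
    (h : SmoothForm I η) :
    CovariantPhaseSpace.pullback I J ι (extD I η)
      = extD J (CovariantPhaseSpace.pullback I J ι η) := by
  ext1 p
  have hp := mem_range_extChartAt (I := J) p
  have hf : ContMDiffWithinAt 𝓘(ℝ, F) I ∞ (ι ∘ (extChartAt J p).symm) (range J)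
      (extChartAt J p p) :=
    hι.contMDiffAt.comp_contMDiffWithinAt _
      (contMDiffWithinAt_extChartAt_symm_range (mem_extChartAt_target p))
  have key : ∀ {j : ℕ} (ζ : M → E [⋀^Fin j]→L[ℝ] ℝ) (y : F), y ∈ (extChartAt J p).target →
      formInChart J p (CovariantPhaseSpace.pullback I J ι ζ) y
        = pullWithin I (ι ∘ (extChartAt J p).symm) (range J) ζ y := by
    intro j ζ y hy
    rw [formInChart_eq_pullWithin hy]
    exact pullWithin_pullback (hι.mdifferentiableAt (by simp))
      (mdifferentiableWithinAt_extChartAt_symm hy)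
      (J.uniqueDiffOn _ (extChartAt_target_subset_range p hy)) _
  have h2 : formInChart J p (CovariantPhaseSpace.pullback I J ι η)
      =ᶠ[𝓝[range J] (extChartAt J p p)]
      CovariantPhaseSpace.pullWithin I (ι ∘ (extChartAt J p).symm) (range J) η := by
    filter_upwards [eventually_mem_target p] with y hy using key η y hy
  rw [← (isLinearRep_form (I := J) (k + 1)).center p
    (CovariantPhaseSpace.pullback I J ι (extD I η)), key _ _ (mem_extChartAt_target p),
    ← extDerivWithin_pullWithin J.uniqueDiffOn hp (J.range_subset_closure_interior hp) hf (h _),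
    extD, h2.extDerivWithin_eq_of_mem hp]

end Pullbacks

/-! ### Differentials of the representation that defines the field bundle. -/

section Representations

variable {E V : Type*} [NormedAddCommGroup E] [NormedSpace ℝ E] [FiniteDimensional ℝ E]
  [NormedAddCommGroup V] [NormedSpace ℝ V] (ρ : FieldType E V)

theorem FieldType.contDiffAt {A : E →L[ℝ] E} (hA : IsUnit A) : ContDiffAt ℝ ∞ ρ.act A :=
  ρ.smooth.contDiffAt (Units.isOpen.mem_nhds hA)

theorem FieldType.hasFDerivAt {A : E →L[ℝ] E} (hA : IsUnit A) :
    HasFDerivAt ρ.act (fderiv ℝ ρ.act A) A :=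
  ((ρ.contDiffAt hA).differentiableAt (by simp)).hasFDerivAt

/-- Differentiate `act (A B) = act A ∘ act B` in `A` at the identity. With its mirror image for left
multiplication, this reduces the differential of `act` at a coordinate change to that at the
identity, which occurs in `lieField`. -/
theorem FieldType.fderiv_comp_right {B : E →L[ℝ] E} (hB : IsUnit B) (C : E →L[ℝ] E) :
    fderiv ℝ ρ.act B (C.comp B)
      = (fderiv ℝ ρ.act (ContinuousLinearMap.id ℝ E) C).comp (ρ.act B) := by
  have h1 : HasFDerivAt (fun A : E →L[ℝ] E ↦ ρ.act (A.comp B))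
      ((fderiv ℝ ρ.act B).comp ((ContinuousLinearMap.compL ℝ E E E).flip B))
      (ContinuousLinearMap.id ℝ E) := by
    refine HasFDerivAt.comp (f := fun A : E →L[ℝ] E ↦ A.comp B) (ContinuousLinearMap.id ℝ E) ?_
      ((ContinuousLinearMap.compL ℝ E E E).flip B).hasFDerivAt
    simpa using ρ.hasFDerivAt hB
  have h2 : HasFDerivAt (fun A : E →L[ℝ] E ↦ (ρ.act A).comp (ρ.act B))
      (((ContinuousLinearMap.compL ℝ V V V).flip (ρ.act B)).comp
        (fderiv ℝ ρ.act (ContinuousLinearMap.id ℝ E))) (ContinuousLinearMap.id ℝ E) :=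
    ((ContinuousLinearMap.compL ℝ V V V).flip (ρ.act B)).hasFDerivAt.comp _
      (ρ.hasFDerivAt isUnit_one)
  have h3 : (fun A : E →L[ℝ] E ↦ (ρ.act A).comp (ρ.act B))
      =ᶠ[𝓝 (ContinuousLinearMap.id ℝ E)] fun A ↦ ρ.act (A.comp B) := by
    filter_upwards [Units.isOpen.mem_nhds (isUnit_one (M := E →L[ℝ] E))] with A hA
    exact (ρ.act_comp A B hA hB).symm
  exact DFunLike.congr_fun (h1.unique (h2.congr_of_eventuallyEq h3.symm)) C

theorem FieldType.fderiv_comp_left {B : E →L[ℝ] E} (hB : IsUnit B) (C : E →L[ℝ] E) :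
    fderiv ℝ ρ.act B (B.comp C)
      = (ρ.act B).comp (fderiv ℝ ρ.act (ContinuousLinearMap.id ℝ E) C) := by
  have h1 : HasFDerivAt (fun A : E →L[ℝ] E ↦ ρ.act (B.comp A))
      ((fderiv ℝ ρ.act B).comp (ContinuousLinearMap.compL ℝ E E E B))
      (ContinuousLinearMap.id ℝ E) := by
    refine HasFDerivAt.comp (f := fun A : E →L[ℝ] E ↦ B.comp A) (ContinuousLinearMap.id ℝ E) ?_
      (ContinuousLinearMap.compL ℝ E E E B).hasFDerivAt
    simpa using ρ.hasFDerivAt hB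
  have h2 : HasFDerivAt (fun A : E →L[ℝ] E ↦ (ρ.act B).comp (ρ.act A))
      ((ContinuousLinearMap.compL ℝ V V V (ρ.act B)).comp
        (fderiv ℝ ρ.act (ContinuousLinearMap.id ℝ E))) (ContinuousLinearMap.id ℝ E) :=
    (ContinuousLinearMap.compL ℝ V V V (ρ.act B)).hasFDerivAt.comp _
      (ρ.hasFDerivAt isUnit_one)
  have h3 : (fun A : E →L[ℝ] E ↦ (ρ.act B).comp (ρ.act A))
      =ᶠ[𝓝 (ContinuousLinearMap.id ℝ E)] fun A ↦ ρ.act (B.comp A) := by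
    filter_upwards [Units.isOpen.mem_nhds (isUnit_one (M := E →L[ℝ] E))] with A hA
    exact (ρ.act_comp B A hB hA).symm
  exact DFunLike.congr_fun (h1.unique (h2.congr_of_eventuallyEq h3.symm)) C

variable (E) in
/-- The representation of `GL(E)` on `E`; the fields are the vector fields. -/
def FieldType.vector : FieldType E E where
  act A := A
  act_one := rfl
  act_comp _ _ _ _ := rfl
  smooth := contDiff_id.contDiffOn

end Representations

/-! ### Chart independence, smoothness and product rule of the Lie derivative of fields. -/

section LieDerivative

variable {E V : Type*} [NormedAddCommGroup E] [NormedSpace ℝ E] [FiniteDimensional ℝ E]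
  [NormedAddCommGroup V] [NormedSpace ℝ V] (ρ : FieldType E V)
  {H : Type*} [TopologicalSpace H] {I : ModelWithCorners ℝ E H}
  {M : Type*} [TopologicalSpace M] [ChartedSpace H M] [IsManifold I ∞ M]

variable (I) in
/-- The transition map between the charts at `a` and `b`. -/
def transition (a b : M) : E → E := extChartAt I b ∘ (extChartAt I a).symm

theorem mapsTo_transition (a b : M) (s : Set E) : MapsTo (transition I a b) s (range I) := by
  intro y _
  simp only [transition, Function.comp_apply, mfld_simps]

theorem contDiffWithinAt_transition {a b : M} {w : E} (ha : w ∈ (extChartAt I a).target)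
    (hb : (extChartAt I a).symm w ∈ (extChartAt I b).source) :
    ContDiffWithinAt ℝ ∞ (transition I a b) (range I) w :=
  contDiffWithinAt_extChartAt_comp (contMDiffWithinAt_extChartAt_symm_range ha) hb

theorem fderivWithin_transition {a b : M} {w : E} (ha : w ∈ (extChartAt I a).target) :
    fderivWithin ℝ (transition I a b) (range I) w
      = tangentCoordChange I a b ((extChartAt I a).symm w) := by
  rw [tangentCoordChange_def, (extChartAt I a).right_inv ha]
  rfl

theorem fieldInChart_transition {a b : M} {w : E} (ha : w ∈ (extChartAt I a).target)
    (hb : (extChartAt I a).symm w ∈ (extChartAt I b).source) (φ : M → V) :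
    fieldInChart ρ I b φ (transition I a b w)
      = ρ.act (fderivWithin ℝ (transition I a b) (range I) w) (fieldInChart ρ I a φ w) := by
  have haq := (extChartAt I a).map_target ha
  rw [fderivWithin_transition ha]
  simp only [fieldInChart, transition, Function.comp_apply]
  rw [(extChartAt I b).left_inv hb, ← ContinuousLinearMap.comp_apply, ← ρ.act_comp _ _
    (isUnit_tangentCoordChange haq hb) (isUnit_tangentCoordChange (mem_extChartAt_source _) haq),
    tangentCoordChange_comp_eq (mem_extChartAt_source _) haq hb]

theorem eventually_fieldInChart_transition {a b : M} {w : E} (ha : w ∈ (extChartAt I a).target)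
    (hb : (extChartAt I a).symm w ∈ (extChartAt I b).source) :
    ∀ᶠ z in 𝓝[range I] w, z ∈ (extChartAt I a).target ∧
      (extChartAt I a).symm z ∈ (extChartAt I b).source := by
  have h1 := extChartAt_target_mem_nhdsWithin_of_mem (I := I) ha
  have h2 := (contMDiffWithinAt_extChartAt_symm_range ha).continuousWithinAt
    |>.preimage_mem_nhdsWithin ((isOpen_extChartAt_source (I := I) b).mem_nhds hb)
  filter_upwards [h1, h2] with z hz1 hz2 using ⟨hz1, hz2⟩

/-- Read the transformation law backwards, through the inverse transition map. -/
theorem differentiableWithinAt_fieldInChart {a b : M} {w : E} (ha : w ∈ (extChartAt I a).target)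
    (hb : (extChartAt I a).symm w ∈ (extChartAt I b).source) {φ : M → V}
    (h : DifferentiableWithinAt ℝ (fieldInChart ρ I b φ) (range I) (transition I a b w)) :
    DifferentiableWithinAt ℝ (fieldInChart ρ I a φ) (range I) w := by
  have haq := (extChartAt I a).map_target ha
  have hbt : transition I a b w ∈ (extChartAt I b).target := (extChartAt I b).map_source hb
  have hbs : (extChartAt I b).symm (transition I a b w) = (extChartAt I a).symm w :=
    (extChartAt I b).left_inv hb
  have hτ := (contDiffWithinAt_transition ha hb).differentiableWithinAt (by simp)
  have hτ' := contDiffWithinAt_transition hbt (b := a) (by rwa [hbs])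
  have hD := (hτ'.fderivWithin_right I.uniqueDiffOn (m := ∞) (by simp)
    (mapsTo_transition a b univ trivial)).differentiableWithinAt (by simp)
  have hu : IsUnit (fderivWithin ℝ (transition I b a) (range I) (transition I a b w)) := by
    rw [fderivWithin_transition hbt, hbs]
    exact isUnit_tangentCoordChange hb haq
  have hact : DifferentiableWithinAt ℝ
      (fun z ↦ ρ.act (fderivWithin ℝ (transition I b a) (range I) z)) (range I)
      (transition I a b w) :=
    ((ρ.contDiffAt hu).differentiableAt (by simp)).comp_differentiableWithinAt _ hD
  have h1 := (hact.clm_apply h).comp w hτ (mapsTo_transition a b _)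
  refine h1.congr_of_eventuallyEq_of_mem ?_ (extChartAt_target_subset_range a ha)
  filter_upwards [eventually_fieldInChart_transition ha hb] with z hz
  have hzt : transition I a b z ∈ (extChartAt I b).target := (extChartAt I b).map_source hz.2
  have hzs : (extChartAt I b).symm (transition I a b z) = (extChartAt I a).symm z :=
    (extChartAt I b).left_inv hz.2
  rw [Function.comp_apply, ← fieldInChart_transition ρ hzt (by
    rw [hzs]; exact (extChartAt I a).map_target hz.1)]
  congr 1
  rw [transition, Function.comp_apply, hzs, (extChartAt I a).right_inv hz.1]

/-- The Lie derivative in a chart. -/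
def lieInChart (x : M) (X : M → E) (φ : M → V) (y : E) : V :=
  fderivWithin ℝ (fieldInChart ρ I x φ) (range I) y (vecInChart I x X y)
    - fderiv ℝ ρ.act (ContinuousLinearMap.id ℝ E)
        (fderivWithin ℝ (vecInChart I x X) (range I) y) (fieldInChart ρ I x φ y)

theorem fieldInChart_lieField {x : M} {y : E} (hy : y ∈ (extChartAt I x).target)
    {X : M → E} {φ : M → V}
    (hX : DifferentiableWithinAt ℝ (vecInChart I x X) (range I) y)
    (hφ : DifferentiableWithinAt ℝ (fieldInChart ρ I x φ) (range I) y) :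
    fieldInChart ρ I x (lieField ρ I X φ) y = lieInChart ρ (I := I) x X φ y := by
  set p := (extChartAt I x).symm y with hp
  have hpx : p ∈ (extChartAt I x).source := (extChartAt I x).map_target hy
  have hpy : extChartAt I x p = y := (extChartAt I x).right_inv hy
  set w := extChartAt I p p with hw
  have hpt : w ∈ (extChartAt I p).target := mem_extChartAt_target (I := I) p
  have hpr : w ∈ range I := extChartAt_target_subset_range p hpt
  have hpp : (extChartAt I p).symm w = p := extChartAt_to_inv p
  have hb : (extChartAt I p).symm w ∈ (extChartAt I x).source := by rwa [hpp]
  set τ := transition I p x with hτ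
  have hτw : τ w = y := by rw [hτ, transition, Function.comp_apply, hpp, hpy]
  have hu := I.uniqueDiffOn w hpr
  have hφp := differentiableWithinAt_fieldInChart ρ hpt hb (φ := φ) (by rwa [← hτ, hτw])
  have hXp : DifferentiableWithinAt ℝ (vecInChart I p X) (range I) w :=
    differentiableWithinAt_fieldInChart (FieldType.vector E) hpt hb (φ := X) (by
      rw [← hτ, hτw]; exact hX)
  have hcτ : ContDiffWithinAt ℝ ∞ τ (range I) w := contDiffWithinAt_transition hpt hb
  have hdτ := (hcτ.differentiableWithinAt (by simp)).hasFDerivWithinAt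
  have hDτ := ((hcτ.fderivWithin_right I.uniqueDiffOn (m := ∞) (by simp)
    hpr).differentiableWithinAt (by simp)).hasFDerivWithinAt
  have hsymm := hcτ.isSymmSndFDerivWithinAt (by simp; exact WithTop.coe_le_coe.2 le_top)
    I.uniqueDiffOn (I.range_subset_closure_interior hpr) hpr
  set B := fderivWithin ℝ τ (range I) w with hB
  set B' := fderivWithin ℝ (fderivWithin ℝ τ (range I)) (range I) w with hB'
  have hBT : B = tangentCoordChange I p x p := by
    rw [hB, hτ, fderivWithin_transition hpt, hpp]
  have hBu : IsUnit B := by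
    rw [hBT]; exact isUnit_tangentCoordChange (mem_extChartAt_source p) hpx
  have hXw : vecInChart I p X w = X p := isLinearRep_vec.center p X
  have hφw : fieldInChart ρ I p φ w = φ p := (isLinearRep_field ρ).center p φ
  have hev := eventually_fieldInChart_transition hpt hb
  have hm := mapsTo_transition (I := I) p x (range I)
  -- the derivative of the transformation law of `φ`
  have e1 : (fderivWithin ℝ (fieldInChart ρ I x φ) (range I) y).comp B
      = (ρ.act B).comp (fderivWithin ℝ (fieldInChart ρ I p φ) (range I) w)
        + ((fderiv ℝ ρ.act B).comp B').flip (φ p) := by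
    have h1 : HasFDerivWithinAt (fun z ↦ fieldInChart ρ I x φ (τ z))
        ((fderivWithin ℝ (fieldInChart ρ I x φ) (range I) y).comp B) (range I) w := by
      have h0 : HasFDerivWithinAt (fieldInChart ρ I x φ)
          (fderivWithin ℝ (fieldInChart ρ I x φ) (range I) y) (range I) (τ w) := by
        rw [hτw]; exact hφ.hasFDerivWithinAt
      exact h0.comp w hdτ hm
    have h2 : HasFDerivWithinAt
        (fun z ↦ ρ.act (fderivWithin ℝ τ (range I) z) (fieldInChart ρ I p φ z)) _ (range I) w :=
      ((ρ.hasFDerivAt hBu).comp_hasFDerivWithinAt w hDτ).clm_apply hφp.hasFDerivWithinAt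
    have h3 : (fun z ↦ fieldInChart ρ I x φ (τ z)) =ᶠ[𝓝[range I] w]
        fun z ↦ ρ.act (fderivWithin ℝ τ (range I) z) (fieldInChart ρ I p φ z) := by
      filter_upwards [hev] with z hz using fieldInChart_transition ρ hz.1 hz.2 φ
    rw [← hφw]
    exact hu.eq h1 (h2.congr_of_eventuallyEq h3 (h3.self_of_nhdsWithin hpr))
  have e2 : (fderivWithin ℝ (vecInChart I x X) (range I) y).comp B
      = B.comp (fderivWithin ℝ (vecInChart I p X) (range I) w) + B'.flip (X p) := by
    have h1 : HasFDerivWithinAt (fun z ↦ vecInChart I x X (τ z))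
        ((fderivWithin ℝ (vecInChart I x X) (range I) y).comp B) (range I) w := by
      have h0 : HasFDerivWithinAt (vecInChart I x X)
          (fderivWithin ℝ (vecInChart I x X) (range I) y) (range I) (τ w) := by
        rw [hτw]; exact hX.hasFDerivWithinAt
      exact h0.comp w hdτ hm
    have h2 : HasFDerivWithinAt
        (fun z ↦ (fderivWithin ℝ τ (range I) z) (vecInChart I p X z)) _ (range I) w :=
      hDτ.clm_apply hXp.hasFDerivWithinAt
    have h3 : (fun z ↦ vecInChart I x X (τ z)) =ᶠ[𝓝[range I] w]
        fun z ↦ (fderivWithin ℝ τ (range I) z) (vecInChart I p X z) := by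
      filter_upwards [hev] with z hz
      exact fieldInChart_transition (FieldType.vector E) hz.1 hz.2 X
    rw [← hXw]
    exact hu.eq h1 (h2.congr_of_eventuallyEq h3 (h3.self_of_nhdsWithin hpr))
  -- The inhomogeneous term in the transformation of `∂φ` contains the second derivative `B'` of the
  -- transition map. Symmetry of `B'` expresses it through the derivatives of `X` in the two charts.
  -- By `fderiv_comp_right` and `fderiv_comp_left` these are exactly the corrections `dρ(∂X) φ` in
  -- the two charts.
  have e3 : B' (X p) = (fderivWithin ℝ (vecInChart I x X) (range I) y).comp B
      - B.comp (fderivWithin ℝ (vecInChart I p X) (range I) w) := by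
    rw [e2]
    ext e
    simpa using hsymm (X p) e
  have e4 : vecInChart I x X y = B (X p) := by
    rw [← hτw, ← hXw]
    exact fieldInChart_transition (FieldType.vector E) hpt hb X
  have e5 : fieldInChart ρ I x φ y = ρ.act B (φ p) := by
    rw [← hτw, ← hφw]
    exact fieldInChart_transition ρ hpt hb φ
  have e6 := DFunLike.congr_fun e1 (X p)
  simp only [ContinuousLinearMap.comp_apply, add_apply,
    ContinuousLinearMap.flip_apply, e3, map_sub, ρ.fderiv_comp_right hBu, ρ.fderiv_comp_left hBu,
    sub_apply] at e6
  have e7 : fieldInChart ρ I x (lieField ρ I X φ) y = ρ.act B (lieField ρ I X φ p) := by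
    rw [hBT]; rfl
  rw [e7, lieInChart, e4, e5, e6]
  simp only [lieField, map_sub]
  rw [← hw]
  abel

theorem SmoothFamilyAt.lieField {S : Type*} [NormedAddCommGroup S] [NormedSpace ℝ S]
    {X : S → M → E} {Φ : S → M → V} {s : S} {x : M}
    (hX : SmoothFamilyAt I (vecInChart I) X s x)
    (hΦ : SmoothFamilyAt I (fieldInChart ρ I) Φ s x) :
    SmoothFamilyAt I (fieldInChart ρ I) (fun s ↦ lieField ρ I (X s) (Φ s)) s x := by
  have hdX := hX.eventually_differentiableWithinAt
  have hdΦ := hΦ.eventually_differentiableWithinAt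
  unfold SmoothFamilyAt at *
  have hm : (s, extChartAt I x x) ∈ (univ : Set S) ×ˢ range I :=
    ⟨trivial, mem_range_extChartAt x⟩
  have key : ∀ {W : Type _} [NormedAddCommGroup W] [NormedSpace ℝ W] {g : S → E → W},
      ContDiffWithinAt ℝ ∞ (fun z : S × E ↦ g z.1 z.2) (univ ×ˢ range I) (s, extChartAt I x x) →
      ContDiffWithinAt ℝ ∞ (fun z : S × E ↦ fderivWithin ℝ (g z.1) (range I) z.2)
        (univ ×ˢ range I) (s, extChartAt I x x) := by
    intro W _ _ g h
    refine ContDiffWithinAt.fderivWithin (f := fun (z : S × E) ↦ g z.1)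
      (g := fun z ↦ z.2) (n := ∞) ?_ contDiffWithinAt_snd I.uniqueDiffOn (by simp)
      hm (fun z hz ↦ hz.2)
    exact ContDiffWithinAt.comp (f := fun z : (S × E) × E ↦ (z.1.1, z.2))
      ((s, extChartAt I x x), extChartAt I x x) h (ContDiff.contDiffWithinAt (by fun_prop))
      (fun z hz ↦ ⟨trivial, hz.2⟩)
  have hX' : ContDiffWithinAt ℝ ∞
      (fun z : S × E ↦ fderivWithin ℝ (vecInChart I x (X z.1)) (range I) z.2)
        (univ ×ˢ range I) (s, extChartAt I x x) := by
    refine ContDiffWithinAt.fderivWithin (f := fun (z : S × E) ↦ vecInChart I x (X z.1))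
      (g := fun z ↦ z.2) (n := ∞) ?_ contDiffWithinAt_snd I.uniqueDiffOn (by simp)
      hm (fun z hz ↦ hz.2)
    exact ContDiffWithinAt.comp (f := fun z : (S × E) × E ↦ (z.1.1, z.2))
      ((s, extChartAt I x x), extChartAt I x x) hX (ContDiff.contDiffWithinAt (by fun_prop))
      (fun z hz ↦ ⟨trivial, hz.2⟩)
  have h1 := (key (g := fun s ↦ fieldInChart ρ I x (Φ s)) hΦ).clm_apply hX
  have h2 := ((contDiffWithinAt_const (c := fderiv ℝ ρ.act
    (ContinuousLinearMap.id ℝ E))).clm_apply hX').clm_apply hΦ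
  refine (h1.sub h2).congr_of_eventuallyEq_of_mem ?_ hm
  filter_upwards [hdX, hdΦ, eventually_snd_mem_target s x] with z hz1 hz2 hz3
  exact fieldInChart_lieField ρ hz3 hz1 hz2

/-- For a field-dependent generator this reads `δ(£_ξ φ) = £_{δξ} φ + £_ξ δφ`, the origin of the
`δξ` terms in the anomaly and in the flux. -/
theorem hasDerivAt_lieField {X : ℝ → M → E} {Φ : ℝ → M → V} {x : M}
    (hX : SmoothFamilyAt I (vecInChart I) X 0 x)
    (hΦ : SmoothFamilyAt I (fieldInChart ρ I) Φ 0 x) :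
    HasDerivAt (fun t ↦ lieField ρ I (X t) (Φ t) x)
      (lieField ρ I (curveDeriv X) (Φ 0) x + lieField ρ I (X 0) (curveDeriv Φ) x) 0 := by
  have h1 := hX.hasDerivAt isLinearRep_vec
  have h2 := hΦ.hasDerivAt (isLinearRep_field ρ)
  have h3 := hX.hasDerivAt_fderivWithin isLinearRep_vec
  have h4 := hΦ.hasDerivAt_fderivWithin (isLinearRep_field ρ)
  have h5 := (fderiv ℝ ρ.act (ContinuousLinearMap.id ℝ E)).hasFDerivAt.comp_hasDerivAt 0 h3
  refine ((h4.clm_apply h1).sub (h5.clm_apply h2)).congr_deriv ?_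
  have hc1 : (fun x ↦ deriv (fun t ↦ X t x) 0) = curveDeriv X := rfl
  have hc2 : (fun x ↦ deriv (fun t ↦ Φ t x) 0) = curveDeriv Φ := rfl
  simp only [hc1, hc2, CovariantPhaseSpace.lieField, Function.comp_apply]
  abel

end LieDerivative

/-! ### Stokes' theorem and differentiation under the integral for singular chains. -/

section Integration

open MeasureTheory

theorem interior_unitCube_nonempty (k : ℕ) : (interior (Icc (0 : Fin k → ℝ) 1)).Nonempty := by
  refine ⟨fun _ ↦ 1 / 2, ?_⟩
  rw [← pi_univ_Icc, interior_pi_set finite_univ]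
  intro i _
  change (1 / 2 : ℝ) ∈ interior (Icc (0 : ℝ) 1)
  rw [interior_Icc]
  norm_num

theorem uniqueDiffOn_unitCube (k : ℕ) : UniqueDiffOn ℝ (Icc (0 : Fin k → ℝ) 1) :=
  uniqueDiffOn_convex (convex_Icc 0 1) (interior_unitCube_nonempty k)

theorem unitCube_subset_closure_interior (k : ℕ) :
    Icc (0 : Fin k → ℝ) 1 ⊆ closure (interior (Icc (0 : Fin k → ℝ) 1)) := by
  rw [(convex_Icc (𝕜 := ℝ) (0 : Fin k → ℝ) 1).closure_interior_eq_closure_of_nonempty_interior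
    (interior_unitCube_nonempty k)]
  exact subset_closure

theorem insertNth_mem_unitCube {k : ℕ} (i : Fin (k + 1)) {c : ℝ} (hc : c ∈ Icc (0 : ℝ) 1) :
    MapsTo (fun u : Fin k → ℝ ↦ (i.insertNth c u : Fin (k + 1) → ℝ)) (Icc 0 1) (Icc 0 1) := by
  intro u hu
  refine ⟨fun j ↦ ?_, fun j ↦ ?_⟩
  · refine Fin.succAboveCases i ?_ (fun l ↦ ?_) j
    · simpa using hc.1
    · simpa using hu.1 l
  · refine Fin.succAboveCases i ?_ (fun l ↦ ?_) j
    · simpa using hc.2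
    · simpa using hu.2 l

/-- The linear part of the inclusion of the `i`-th face of the unit cube. -/
def faceCLM {k : ℕ} (i : Fin (k + 1)) : (Fin k → ℝ) →L[ℝ] (Fin (k + 1) → ℝ) :=
  ContinuousLinearMap.pi fun j ↦ i.succAboveCases (α := fun _ ↦ (Fin k → ℝ) →L[ℝ] ℝ) 0
    (fun l ↦ ContinuousLinearMap.proj l) j

theorem hasFDerivAt_insertNth {k : ℕ} (i : Fin (k + 1)) (c : ℝ) (u : Fin k → ℝ) :
    HasFDerivAt (fun u : Fin k → ℝ ↦ (i.insertNth c u : Fin (k + 1) → ℝ)) (faceCLM i) u := by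
  rw [hasFDerivAt_pi']
  intro j
  refine Fin.succAboveCases i ?_ (fun l ↦ ?_) j
  · have h : (ContinuousLinearMap.proj i).comp (faceCLM i) = (0 : (Fin k → ℝ) →L[ℝ] ℝ) := by
      ext v; simp [faceCLM]
    rw [h]
    simpa using hasFDerivAt_const (𝕜 := ℝ) c u
  · have h : (ContinuousLinearMap.proj (i.succAbove l)).comp (faceCLM i)
        = (ContinuousLinearMap.proj l : (Fin k → ℝ) →L[ℝ] ℝ) := by
      ext v; simp [faceCLM]
    rw [h]
    simp only [Fin.insertNth_apply_succAbove]
    exact (ContinuousLinearMap.proj (R := ℝ) (φ := fun _ : Fin k ↦ ℝ) l).hasFDerivAt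

theorem faceCLM_single {k : ℕ} (i : Fin (k + 1)) (j : Fin k) :
    faceCLM i (Pi.single j 1) = Pi.single (i.succAbove j) 1 := by
  ext n
  refine Fin.succAboveCases i ?_ (fun l ↦ ?_) n
  · simp [faceCLM, Fin.ne_succAbove]
  · simp [faceCLM, Pi.single_apply]

variable {E : Type*} [NormedAddCommGroup E] [NormedSpace ℝ E]
  {H : Type*} [TopologicalSpace H] {I : ModelWithCorners ℝ E H}
  {M : Type*} [TopologicalSpace M] [ChartedSpace H M] [IsManifold I ∞ M]

/-- The standard frame of `ℝ ^ k`. -/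
def stdFrame (k : ℕ) : Fin k → Fin k → ℝ := fun i ↦ Pi.single i 1

theorem SmoothCube.integral_eq {k : ℕ} (σ : SmoothCube I M k) (η : M → E [⋀^Fin k]→L[ℝ] ℝ) :
    σ.integral η = ∫ u in Icc (0 : Fin k → ℝ) 1,
      pullWithin I σ.toFun (Icc 0 1) η u (stdFrame k) := rfl

/-- Chain rule: the face inclusion sends the standard frame to the larger frame with its `i`-th
vector deleted, the tuple that occurs in the `i`-th term of the exterior derivative. -/
theorem SmoothCube.pullWithin_face {k : ℕ} (σ : SmoothCube I M (k + 1)) (i : Fin (k + 1)) {c : ℝ}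
    (hc : c ∈ Icc (0 : ℝ) 1) (η : M → E [⋀^Fin k]→L[ℝ] ℝ) {u : Fin k → ℝ}
    (hu : u ∈ Icc (0 : Fin k → ℝ) 1) :
    pullWithin I (σ.face i c hc).toFun (Icc 0 1) η u (stdFrame k)
      = pullWithin I σ.toFun (Icc 0 1) η (i.insertNth c u)
          (i.removeNth (stdFrame (k + 1))) := by
  have h1 : HasMFDerivWithinAt 𝓘(ℝ, Fin k → ℝ) 𝓘(ℝ, Fin (k + 1) → ℝ)
      (fun u : Fin k → ℝ ↦ (i.insertNth c u : Fin (k + 1) → ℝ)) (Icc 0 1) u (faceCLM i) :=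
    (hasFDerivAt_insertNth i c u).hasFDerivWithinAt.hasMFDerivWithinAt
  have h2 := ((σ.smooth (i.insertNth c u) (insertNth_mem_unitCube i hc hu)).mdifferentiableWithinAt
    (by simp)).hasMFDerivWithinAt
  have h3 := (HasMFDerivWithinAt.comp (f := fun u : Fin k → ℝ ↦
    (i.insertNth c u : Fin (k + 1) → ℝ)) u h2 h1 (insertNth_mem_unitCube i hc)).mfderivWithin
    (uniqueDiffOn_unitCube k u hu).uniqueMDiffWithinAt
  simp only [pullWithin]
  have h4 : mfderivWithin 𝓘(ℝ, Fin k → ℝ) I (σ.face i c hc).toFun (Icc 0 1) u = _ := h3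
  rw [h4]
  refine congrArg (η (σ.toFun (i.insertNth c u))) (funext fun j ↦ ?_)
  exact congrArg (mfderivWithin 𝓘(ℝ, Fin (k + 1) → ℝ) I σ.toFun (Icc 0 1)
    (i.insertNth c u) : (Fin (k + 1) → ℝ) →L[ℝ] E) (faceCLM_single i j)

variable [FiniteDimensional ℝ E]

theorem SmoothCube.contDiffOn_pullWithin {k q : ℕ} (σ : SmoothCube I M k)
    {η : M → E [⋀^Fin q]→L[ℝ] ℝ} (hη : SmoothForm I η) :
    ContDiffOn ℝ ∞ (pullWithin I σ.toFun (Icc 0 1) η) (Icc 0 1) := by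
  intro u hu
  have h := SmoothFamilyAt.pullWithin (uniqueDiffOn_unitCube k) hu (σ.smooth u hu)
    ((hη (σ.toFun u)).family (0 : ℝ))
  exact h.comp u (contDiffWithinAt_const.prodMk contDiffWithinAt_id) fun v hv ↦ ⟨trivial, hv⟩

theorem SmoothCube.integrableOn {k : ℕ} (σ : SmoothCube I M k)
    {η : M → E [⋀^Fin k]→L[ℝ] ℝ} (hη : SmoothForm I η) :
    IntegrableOn (fun u ↦ pullWithin I σ.toFun (Icc 0 1) η u (stdFrame k))
      (Icc (0 : Fin k → ℝ) 1) := by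
  refine ContinuousOn.integrableOn_compact isCompact_Icc ?_
  exact (ContinuousAlternatingMap.apply ℝ (Fin k → ℝ) ℝ (stdFrame k)).continuous.comp_continuousOn
    (σ.contDiffOn_pullWithin hη).continuousOn

/-- Stokes' theorem for a singular cube. -/
theorem SmoothCube.integral_extD {k : ℕ} (σ : SmoothCube I M (k + 1))
    {η : M → E [⋀^Fin k]→L[ℝ] ℝ} (hη : SmoothForm I η) :
    σ.integral (extD I η) = ∑ i : Fin (k + 1),
      ((-1) ^ (i : ℕ) * (σ.face i 1 (by simp)).integral η
        - (-1) ^ (i : ℕ) * (σ.face i 0 (by simp)).integral η) := by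
  set K := Icc (0 : Fin (k + 1) → ℝ) 1 with hK
  set g := pullWithin I σ.toFun K η with hg
  have hgd : ContDiffOn ℝ ∞ g K := σ.contDiffOn_pullWithin hη
  -- The components of a vector field whose divergence is the coefficient of the pulled-back `dη`,
  -- and whose fluxes through the faces are the boundary terms.
  set f : Fin (k + 1) → (Fin (k + 1) → ℝ) → ℝ :=
    fun i u ↦ (-1) ^ (i : ℕ) * g u (i.removeNth (stdFrame (k + 1))) with hf
  have hfd : ∀ i, DifferentiableOn ℝ (f i) K := fun i ↦ by
    refine DifferentiableOn.const_mul ?_ _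
    exact (ContinuousAlternatingMap.apply ℝ (Fin (k + 1) → ℝ) ℝ
      (i.removeNth (stdFrame (k + 1)))).differentiable.comp_differentiableOn
      (hgd.differentiableOn (by simp))
  have hdiv : ∀ u ∈ K, ∑ i, fderivWithin ℝ (f i) K u (Pi.single i 1)
      = pullWithin I σ.toFun K (extD I η) u (stdFrame (k + 1)) := fun u hu ↦ by
    have hgu := hgd.differentiableOn (by simp) u hu
    have huq := uniqueDiffOn_unitCube (k + 1) u hu
    rw [← extDerivWithin_pullWithin (uniqueDiffOn_unitCube (k + 1)) hu
      (unitCube_subset_closure_interior _ hu) (σ.smooth u hu) (hη _),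
      extDerivWithin_apply hgu huq]
    refine Finset.sum_congr rfl fun i _ ↦ ?_
    have h1 : DifferentiableWithinAt ℝ
        (fun u ↦ g u (i.removeNth (stdFrame (k + 1)))) K u :=
      (ContinuousAlternatingMap.apply ℝ (Fin (k + 1) → ℝ) ℝ
        (i.removeNth (stdFrame (k + 1)))).differentiableAt.comp_differentiableWithinAt u hgu
    have h2 := fderivWithin_const_mul huq h1 ((-1 : ℝ) ^ (i : ℕ))
    simp only [hf]
    rw [h2, smul_apply, zsmul_eq_mul, smul_eq_mul]
    push_cast
    rfl
  have key := integral_divergence_of_hasFDerivAt_off_countable' (0 : Fin (k + 1) → ℝ) 1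
    (fun _ ↦ zero_le_one) f (fun i u ↦ fderivWithin ℝ (f i) K u) ∅ countable_empty
    (fun i ↦ (hfd i).continuousOn)
    (fun u hu i ↦ by
      -- The divergence theorem needs derivatives only in the open cube, where the derivative within
      -- `K` is a full derivative.
      have hmem : K ∈ 𝓝 u := by
        refine mem_of_superset ((isOpen_set_pi finite_univ fun _ _ ↦ isOpen_Ioo).mem_nhds hu.1) ?_
        rw [hK, ← pi_univ_Icc]
        exact pi_mono fun _ _ ↦ Ioo_subset_Icc_self
      exact ((hfd i) u (mem_of_mem_nhds hmem)).hasFDerivWithinAt.hasFDerivAt hmem)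
    ((σ.integrableOn hη.extD).congr_fun (fun u hu ↦ (hdiv u hu).symm) measurableSet_Icc)
  have hface : ∀ (i : Fin (k + 1)) (c : ℝ) (hc : c ∈ Icc (0 : ℝ) 1),
      ∫ u in Icc ((0 : Fin (k + 1) → ℝ) ∘ i.succAbove)
        ((1 : Fin (k + 1) → ℝ) ∘ i.succAbove), f i (i.insertNth c u)
        = (-1) ^ (i : ℕ) * (σ.face i c hc).integral η := fun i c hc ↦ by
    rw [SmoothCube.integral_eq, ← integral_const_mul]
    refine setIntegral_congr_fun measurableSet_Icc fun u hu ↦ ?_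
    simp only [hf]
    rw [σ.pullWithin_face i hc η hu]
  rw [SmoothCube.integral_eq, ← setIntegral_congr_fun measurableSet_Icc hdiv, key]
  refine Finset.sum_congr rfl fun i _ ↦ ?_
  rw [← hface, ← hface]
  rfl

/-- As a linear map of the chain, the integral passes through the sums in `chainBoundary`. -/
theorem chainIntegral_eq_linearCombination {k : ℕ} (C : SmoothChain I M k)
    (η : M → E [⋀^Fin k]→L[ℝ] ℝ) :
    chainIntegral C η = Finsupp.linearCombination ℝ (fun σ : SmoothCube I M k ↦ σ.integral η) C :=
  rfl

/-- Stokes' theorem for chains. -/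
theorem chainIntegral_extD {k : ℕ} (C : SmoothChain I M (k + 1))
    {η : M → E [⋀^Fin k]→L[ℝ] ℝ} (hη : SmoothForm I η) :
    chainIntegral C (extD I η) = chainIntegral (chainBoundary C) η := by
  rw [chainIntegral_eq_linearCombination (chainBoundary C), chainBoundary, map_finsuppSum,
    chainIntegral]
  refine Finsupp.sum_congr fun σ _ ↦ ?_
  rw [σ.integral_extD hη, map_sum, Finset.mul_sum]
  refine Finset.sum_congr rfl fun i _ ↦ ?_
  rw [map_sub, Finsupp.linearCombination_single, Finsupp.linearCombination_single]
  simp only [smul_eq_mul]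
  ring

theorem chainIntegral_add {k : ℕ} (C : SmoothChain I M k)
    {η ζ : M → E [⋀^Fin k]→L[ℝ] ℝ} (hη : SmoothForm I η) (hζ : SmoothForm I ζ) :
    chainIntegral C (η + ζ) = chainIntegral C η + chainIntegral C ζ := by
  simp only [chainIntegral, ← Finsupp.sum_add]
  refine Finsupp.sum_congr fun σ _ ↦ ?_
  rw [← mul_add, σ.integral_eq η, σ.integral_eq ζ,
    ← integral_add (σ.integrableOn hη) (σ.integrableOn hζ)]
  rfl

theorem chainIntegral_sub {k : ℕ} (C : SmoothChain I M k)
    {η ζ : M → E [⋀^Fin k]→L[ℝ] ℝ} (hη : SmoothForm I η) (hζ : SmoothForm I ζ) :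
    chainIntegral C (η - ζ) = chainIntegral C η - chainIntegral C ζ := by
  have h := chainIntegral_add C (hη.sub hζ) hζ
  rw [sub_add_cancel] at h
  linarith

theorem SmoothCube.hasDerivAt_integral {k : ℕ} (σ : SmoothCube I M k)
    {Φ : ℝ → M → E [⋀^Fin k]→L[ℝ] ℝ} (h : ∀ t x, SmoothFamilyAt I (formInChart I) Φ t x) :
    HasDerivAt (fun t ↦ σ.integral (Φ t)) (σ.integral (curveDeriv Φ)) 0 := by
  set K := Icc (0 : Fin k → ℝ) 1 with hK
  set ev := ContinuousAlternatingMap.apply ℝ (Fin k → ℝ) ℝ (stdFrame k)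
  set g : ℝ × (Fin k → ℝ) → ℝ := fun z ↦ pullWithin I σ.toFun K (Φ z.1) z.2 (stdFrame k) with hg
  have hgd : ContDiffOn ℝ ∞ g (univ ×ˢ K) := fun z hz ↦ by
    have h1 := SmoothFamilyAt.pullWithin (uniqueDiffOn_unitCube k) hz.2 (σ.smooth z.2 hz.2)
      (h z.1 (σ.toFun z.2))
    exact ev.contDiff.contDiffAt.comp_contDiffWithinAt z h1
  have hu : UniqueDiffOn ℝ ((univ : Set ℝ) ×ˢ K) :=
    uniqueDiffOn_univ.prod (uniqueDiffOn_unitCube k)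
  set g' : ℝ → (Fin k → ℝ) → ℝ := fun t u ↦ fderivWithin ℝ g (univ ×ˢ K) (t, u) (1, 0) with hg'
  have hd : ∀ t, ∀ u ∈ K, HasDerivAt (fun t ↦ g (t, u)) (g' t u) t := fun t u hu' ↦ by
    have h1 := (hgd.differentiableOn (by simp) (t, u) ⟨trivial, hu'⟩).hasFDerivWithinAt
    have h2 : HasDerivWithinAt (fun t : ℝ ↦ (t, u)) ((1 : ℝ), (0 : Fin k → ℝ)) univ t :=
      ((hasDerivAt_id t).prodMk (hasDerivAt_const t u)).hasDerivWithinAt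
    rw [← hasDerivWithinAt_univ]
    exact h1.comp_hasDerivWithinAt t h2 fun s _ ↦ mk_mem_prod trivial hu'
  have hg'c : ContinuousOn (fun z : ℝ × (Fin k → ℝ) ↦ g' z.1 z.2) (univ ×ˢ K) :=
    (hgd.continuousOn_fderivWithin hu (by simp)).clm_apply continuousOn_const
  -- Joint continuity on a compact set of times and points supplies the constant dominating
  -- function.
  obtain ⟨B, hB⟩ := ((isCompact_Icc (a := (-1 : ℝ)) (b := 1)).prod
    (isCompact_Icc (a := (0 : Fin k → ℝ)) (b := 1))).exists_bound_of_continuousOn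
    (hg'c.mono (prod_mono (subset_univ _) subset_rfl))
  have hgc : ∀ t, ContinuousOn (fun u ↦ g (t, u)) K := fun t ↦
    hgd.continuousOn.comp (f := fun u ↦ (t, u)) (by fun_prop) fun u hu ↦ mk_mem_prod trivial hu
  have hg'c0 : ContinuousOn (g' 0) K :=
    hg'c.comp (f := fun u ↦ ((0 : ℝ), u)) (by fun_prop) fun u hu ↦ mk_mem_prod trivial hu
  have main := (hasDerivAt_integral_of_dominated_loc_of_deriv_le (μ := volume.restrict K)
    (F := fun t u ↦ g (t, u)) (F' := g') (x₀ := 0) (s := Icc (-1) 1) (bound := fun _ ↦ B)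
    (Icc_mem_nhds (by norm_num) (by norm_num))
    (Eventually.of_forall fun t ↦ (hgc t).aestronglyMeasurable measurableSet_Icc)
    ((hgc 0).integrableOn_compact isCompact_Icc)
    (hg'c0.aestronglyMeasurable measurableSet_Icc)
    ((ae_restrict_iff' measurableSet_Icc).2 (Eventually.of_forall fun u hu t ht ↦
      hB (t, u) ⟨ht, hu⟩))
    (integrableOn_const isCompact_Icc.measure_lt_top.ne)
    ((ae_restrict_iff' measurableSet_Icc).2 (Eventually.of_forall fun u hu t _ ↦
      hd t u hu))).2
  refine main.congr_deriv (setIntegral_congr_fun measurableSet_Icc fun u hu ↦ ?_)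
  refine (hd 0 u hu).unique ?_
  exact (ContinuousAlternatingMap.apply ℝ E ℝ (fun i ↦
    (mfderivWithin 𝓘(ℝ, Fin k → ℝ) I σ.toFun K u : (Fin k → ℝ) →L[ℝ] E)
      (stdFrame k i))).hasFDerivAt.comp_hasDerivAt 0
    ((h 0 (σ.toFun u)).hasDerivAt (isLinearRep_form k))

theorem hasDerivAt_chainIntegral {k : ℕ} (C : SmoothChain I M k)
    {Φ : ℝ → M → E [⋀^Fin k]→L[ℝ] ℝ} (h : ∀ t x, SmoothFamilyAt I (formInChart I) Φ t x) :
    HasDerivAt (fun t ↦ chainIntegral C (Φ t)) (chainIntegral C (curveDeriv Φ)) 0 := by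
  simp only [chainIntegral, Finsupp.sum]
  exact HasDerivAt.fun_sum fun σ _ ↦ (σ.hasDerivAt_integral h).const_mul _

end Integration

/-! ### Closure properties of local forms on field space. -/

section LocalForms

variable {E : Type*} [NormedAddCommGroup E] [NormedSpace ℝ E] [FiniteDimensional ℝ E]
  {V : Type*} [NormedAddCommGroup V] [NormedSpace ℝ V] [FiniteDimensional ℝ V]
  {ρ : FieldType E V}
  {H : Type*} [TopologicalSpace H] {I : ModelWithCorners ℝ E H}
  {M : Type*} [TopologicalSpace M] [ChartedSpace H M] [IsManifold I ∞ M]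
  {F : Type*} [NormedAddCommGroup F] [NormedSpace ℝ F] [FiniteDimensional ℝ F]
  {G : Type*} [TopologicalSpace G] {J : ModelWithCorners ℝ F G}
  {P : Type*} [TopologicalSpace P] [ChartedSpace G P] [IsManifold J ∞ P] {ι : P → M}
  {A : Set (M → V)} {q : ℕ}

variable (ρ I J ι A) in
/-- A field-space `1`-form which is smooth, like the local ones, and linear on smooth variations. -/
structure IsSmoothOneForm (α : (M → V) → (M → V) → P → F [⋀^Fin q]→L[ℝ] ℝ) : Prop where
  linear : ∀ φ ∈ A, ∀ (v w : M → V) (a b : ℝ), SmoothField ρ I v → SmoothField ρ I w →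
    α φ (a • v + b • w) = a • α φ v + b • α φ w
  smooth : ∀ (S : Type) [NormedAddCommGroup S] [NormedSpace ℝ S] [FiniteDimensional ℝ S]
    (Φ v : S → M → V) (s : S) (p : P), Φ s ∈ A →
    SmoothFamilyAt I (fieldInChart ρ I) Φ s (ι p) →
    SmoothFamilyAt I (fieldInChart ρ I) v s (ι p) →
    SmoothFamilyAt J (formInChart J) (fun s ↦ α (Φ s) (v s)) s p

/-- The weaker class, linear only on globally smooth variations, is closed under `extD` by
identities between global forms; `covθ` is treated in it. -/
theorem IsLocalOneForm.isSmoothOneForm {α : (M → V) → (M → V) → P → F [⋀^Fin q]→L[ℝ] ℝ}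
    (h : IsLocalOneForm ρ I J ι A α) : IsSmoothOneForm ρ I J ι A α where
  linear φ hφ v w a b hv hw := funext fun p ↦ h.linear φ hφ v w a b p (hv _) (hw _)
  smooth := h.smooth

section Closure

variable {α α' : (M → V) → P → F [⋀^Fin q]→L[ℝ] ℝ}

theorem IsLocalZeroForm.add (h : IsLocalZeroForm ρ I J ι A α)
    (h' : IsLocalZeroForm ρ I J ι A α') :
    IsLocalZeroForm ρ I J ι A (fun φ ↦ α φ + α' φ) := fun S _ _ _ Φ s p hs hΦ ↦
  (h S Φ s p hs hΦ).add (isLinearRep_form q) (h' S Φ s p hs hΦ)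

theorem IsLocalZeroForm.sub (h : IsLocalZeroForm ρ I J ι A α)
    (h' : IsLocalZeroForm ρ I J ι A α') :
    IsLocalZeroForm ρ I J ι A (fun φ ↦ α φ - α' φ) := fun S _ _ _ Φ s p hs hΦ ↦
  (h S Φ s p hs hΦ).sub (isLinearRep_form q) (h' S Φ s p hs hΦ)

theorem IsLocalZeroForm.extD (h : IsLocalZeroForm ρ I J ι A α) :
    IsLocalZeroForm ρ I J ι A (fun φ ↦ extD J (α φ)) := fun S _ _ _ Φ s p hs hΦ ↦
  (h S Φ s p hs hΦ).extD

theorem IsLocalZeroForm.pullback {α : (M → V) → M → E [⋀^Fin q]→L[ℝ] ℝ}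
    (hι : ContMDiff J I ∞ ι) (h : IsLocalZeroForm ρ I I id A α) :
    IsLocalZeroForm ρ I J ι A (fun φ ↦ pullback I J ι (α φ)) := fun S _ _ _ Φ s p hs hΦ ↦
  (h S Φ s (ι p) hs hΦ).pullback hι

variable {β β' : (M → V) → (M → V) → P → F [⋀^Fin q]→L[ℝ] ℝ}

theorem IsSmoothOneForm.add (h : IsSmoothOneForm ρ I J ι A β)
    (h' : IsSmoothOneForm ρ I J ι A β') :
    IsSmoothOneForm ρ I J ι A (fun φ v ↦ β φ v + β' φ v) where
  linear φ hφ v w a b hv hw := by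
    rw [h.linear φ hφ v w a b hv hw, h'.linear φ hφ v w a b hv hw]
    module
  smooth S _ _ _ Φ v s p hs hΦ hv :=
    (h.smooth S Φ v s p hs hΦ hv).add (isLinearRep_form q) (h'.smooth S Φ v s p hs hΦ hv)

theorem IsSmoothOneForm.sub (h : IsSmoothOneForm ρ I J ι A β)
    (h' : IsSmoothOneForm ρ I J ι A β') :
    IsSmoothOneForm ρ I J ι A (fun φ v ↦ β φ v - β' φ v) where
  linear φ hφ v w a b hv hw := by
    rw [h.linear φ hφ v w a b hv hw, h'.linear φ hφ v w a b hv hw]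
    module
  smooth S _ _ _ Φ v s p hs hΦ hv :=
    (h.smooth S Φ v s p hs hΦ hv).sub (isLinearRep_form q) (h'.smooth S Φ v s p hs hΦ hv)

theorem IsLocalOneForm.add (h : IsLocalOneForm ρ I J ι A β)
    (h' : IsLocalOneForm ρ I J ι A β') :
    IsLocalOneForm ρ I J ι A (fun φ v ↦ β φ v + β' φ v) where
  linear φ hφ v w a b p hv hw := by
    simp only [Pi.add_apply]
    rw [h.linear φ hφ v w a b p hv hw, h'.linear φ hφ v w a b p hv hw]
    module
  smooth S _ _ _ Φ v s p hs hΦ hv :=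
    (h.smooth S Φ v s p hs hΦ hv).add (isLinearRep_form q) (h'.smooth S Φ v s p hs hΦ hv)

theorem IsLocalOneForm.sub (h : IsLocalOneForm ρ I J ι A β)
    (h' : IsLocalOneForm ρ I J ι A β') :
    IsLocalOneForm ρ I J ι A (fun φ v ↦ β φ v - β' φ v) where
  linear φ hφ v w a b p hv hw := by
    simp only [Pi.sub_apply]
    rw [h.linear φ hφ v w a b p hv hw, h'.linear φ hφ v w a b p hv hw]
    module
  smooth S _ _ _ Φ v s p hs hΦ hv :=
    (h.smooth S Φ v s p hs hΦ hv).sub (isLinearRep_form q) (h'.smooth S Φ v s p hs hΦ hv)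

theorem IsSmoothOneForm.smoothForm (hA : ∀ φ ∈ A, SmoothField ρ I φ)
    (h : IsSmoothOneForm ρ I J ι A β) {φ v : M → V} (hφ : φ ∈ A) (hv : SmoothField ρ I v) :
    SmoothForm J (β φ v) := fun p ↦
  (h.smooth ℝ (fun _ ↦ φ) (fun _ ↦ v) 0 p hφ ((hA φ hφ _).family 0) ((hv _).family 0)).section

theorem IsLocalZeroForm.smoothForm (hA : ∀ φ ∈ A, SmoothField ρ I φ)
    (h : IsLocalZeroForm ρ I J ι A α) {φ : M → V} (hφ : φ ∈ A) : SmoothForm J (α φ) := fun p ↦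
  (h ℝ (fun _ ↦ φ) 0 p hφ ((hA φ hφ _).family 0)).section

theorem IsSmoothOneForm.extD (hA : ∀ φ ∈ A, SmoothField ρ I φ)
    (h : IsSmoothOneForm ρ I J ι A β) :
    IsSmoothOneForm ρ I J ι A (fun φ v ↦ extD J (β φ v)) where
  linear φ hφ v w a b hv hw := by
    have hs : ∀ (c : ℝ) {v}, SmoothField ρ I v → SmoothForm J (c • β φ v) := fun c v hv p ↦
      (h.smoothForm hA hφ hv p).smul (isLinearRep_form q) c
    rw [h.linear φ hφ v w a b hv hw, extD_add (hs a hv) (hs b hw), extD_smul, extD_smul]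
  smooth S _ _ _ Φ v s p hs hΦ hv := (h.smooth S Φ v s p hs hΦ hv).extD

theorem IsSmoothOneForm.pullback {β : (M → V) → (M → V) → M → E [⋀^Fin q]→L[ℝ] ℝ}
    (hι : ContMDiff J I ∞ ι) (h : IsSmoothOneForm ρ I I id A β) :
    IsSmoothOneForm ρ I J ι A (fun φ v ↦ pullback I J ι (β φ v)) where
  linear φ hφ v w a b hv hw := by rw [h.linear φ hφ v w a b hv hw]; rfl
  smooth S _ _ _ Φ v s p hs hΦ hv := (h.smooth S Φ v s (ι p) hs hΦ hv).pullback hι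

/-- The contraction of a `1`-form with a fixed variation. -/
theorem IsSmoothOneForm.isLocalZeroForm (h : IsSmoothOneForm ρ I J ι A β) {v : M → V}
    (hv : SmoothField ρ I v) : IsLocalZeroForm ρ I J ι A (fun φ ↦ β φ v) :=
  fun S _ _ _ Φ s p hs hΦ ↦ h.smooth S Φ (fun _ ↦ v) s p hs hΦ ((hv _).family s)

end Closure

/-! ### The variational calculus: `δ² = 0`, `δd = dδ`, chain rules along curves. -/

section Variation

variable {α : (M → V) → P → F [⋀^Fin q]→L[ℝ] ℝ}

theorem IsLocalZeroForm.line (hA : ∀ φ ∈ A, SmoothField ρ I φ)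
    (h : IsLocalZeroForm ρ I J ι A α) {φ v : M → V} (hφ : φ ∈ A) (hv : SmoothField ρ I v) (p : P) :
    SmoothFamilyAt J (formInChart J) (fun t : ℝ ↦ α (φ + t • v)) 0 p :=
  h ℝ _ 0 p (by simpa using hφ) ((hA φ hφ _).line (isLinearRep_field ρ) (hv _) 0)

theorem smoothFamilyAt_plane {φ v w : M → V} {x : M}
    (hφ : SmoothSectionAt I (fieldInChart ρ I) φ x) (hv : SmoothSectionAt I (fieldInChart ρ I) v x)
    (hw : SmoothSectionAt I (fieldInChart ρ I) w x) (z : ℝ × ℝ) :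
    SmoothFamilyAt I (fieldInChart ρ I) (fun z : ℝ × ℝ ↦ φ + z.1 • v + z.2 • w) z x :=
  ((hφ.family z).add (isLinearRep_field ρ)
    ((hv.family z).smul (isLinearRep_field ρ) contDiffAt_fst)).add (isLinearRep_field ρ)
    ((hw.family z).smul (isLinearRep_field ρ) contDiffAt_snd)

theorem IsLocalZeroForm.isLocalOneForm_var (hA : ∀ φ ∈ A, SmoothField ρ I φ)
    (h : IsLocalZeroForm ρ I J ι A α) : IsLocalOneForm ρ I J ι A (var α) where
  linear φ hφ v w a b p hv hw := by
    have h1 : SmoothFamilyAt J (formInChart J)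
        (fun z : ℝ × ℝ ↦ α (φ + z.1 • v + z.2 • w)) (0, 0) p :=
      h (ℝ × ℝ) _ (0, 0) p (by simpa using hφ) (smoothFamilyAt_plane (hA φ hφ _) hv hw _)
    have h2 := ((h1.contDiffAt (isLinearRep_form q)).differentiableAt (by simp)).hasFDerivAt
    -- On the plane `φ + z.1 • v + z.2 • w` every directional variation is a value of one Fréchet
    -- derivative on `ℝ × ℝ`, and linearity in the direction follows.
    have h3 : ∀ (c : ℝ × ℝ) (u : M → V), u = c.1 • v + c.2 • w →
        var α φ u p = fderiv ℝ (fun z : ℝ × ℝ ↦ α (φ + z.1 • v + z.2 • w) p) (0, 0) c := by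
      intro c u hu
      have h4 : HasDerivAt (fun t : ℝ ↦ t • c) c 0 := by
        simpa using (hasDerivAt_id (0 : ℝ)).smul_const c
      have h5 := HasFDerivAt.comp_hasDerivAt (f := fun t : ℝ ↦ t • c) 0
        (by rw [zero_smul]; exact h2) h4
      rw [var, ← h5.deriv]
      congr 1
      ext1 t
      simp only [Function.comp_apply, hu, Prod.smul_fst, Prod.smul_snd, smul_add, smul_smul,
        smul_eq_mul, add_assoc]
    rw [h3 (a, b) _ rfl, h3 (1, 0) v (by simp), h3 (0, 1) w (by simp), ← map_smul, ← map_smul,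
      ← map_add]
    simp
  smooth S _ _ _ Φ v s p hs hΦ hv := by
    have h1 : SmoothFamilyAt I (fieldInChart ρ I) (fun z : S × ℝ ↦ Φ z.1 + z.2 • v z.1) (s, 0)
        (ι p) :=
      (hΦ.comp (f := Prod.fst) (s' := (s, (0 : ℝ))) contDiffAt_fst).add (isLinearRep_field ρ)
        ((hv.comp (f := Prod.fst) (s' := (s, (0 : ℝ))) contDiffAt_fst).smul (isLinearRep_field ρ)
          contDiffAt_snd)
    exact (h (S × ℝ) _ (s, 0) p (by simpa using hs) h1).deriv (isLinearRep_form q)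

theorem deriv_deriv_eq_fderiv_fderiv {W : Type*} [NormedAddCommGroup W] [NormedSpace ℝ W]
    {Z : Type*} [NormedAddCommGroup Z] [NormedSpace ℝ Z] {g : Z → W}
    (hc : ContDiffAt ℝ ∞ g 0) (a b : Z) :
    deriv (fun t : ℝ ↦ deriv (fun s : ℝ ↦ g (t • a + s • b)) 0) 0
      = fderiv ℝ (fderiv ℝ g) 0 a b := by
  have hd : ∀ᶠ z in 𝓝 (0 : Z), DifferentiableAt ℝ g z :=
    ((hc.of_le (m := 1) (by exact_mod_cast le_top)).eventually (by simp)).mono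
      fun z hz ↦ hz.differentiableAt (by simp)
  have hd2 : HasFDerivAt (fderiv ℝ g) (fderiv ℝ (fderiv ℝ g) 0) 0 :=
    ((hc.fderiv_right (m := ∞) (by simp)).differentiableAt (by simp)).hasFDerivAt
  have hl : HasDerivAt (fun t : ℝ ↦ t • a) a 0 := by
    simpa using (hasDerivAt_id (0 : ℝ)).smul_const a
  have hev : ∀ᶠ t : ℝ in 𝓝 0, DifferentiableAt ℝ g (t • a) := by
    refine hl.continuousAt.tendsto.eventually ?_
    rwa [zero_smul]
  have h1 : HasDerivAt (fun t : ℝ ↦ fderiv ℝ g (t • a)) (fderiv ℝ (fderiv ℝ g) 0 a) 0 :=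
    HasFDerivAt.comp_hasDerivAt (f := fun t : ℝ ↦ t • a) 0 (by rwa [zero_smul]) hl
  have h2 : HasDerivAt (fun t : ℝ ↦ fderiv ℝ g (t • a) b) (fderiv ℝ (fderiv ℝ g) 0 a b) 0 := by
    simpa using h1.clm_apply (hasDerivAt_const 0 b)
  refine (h2.congr_of_eventuallyEq ?_).deriv
  filter_upwards [hev] with t ht
  have h3 : HasDerivAt (fun s : ℝ ↦ t • a + s • b) b 0 := by
    simpa using ((hasDerivAt_id (0 : ℝ)).smul_const b).const_add (t • a)
  have h4 : HasFDerivAt g (fderiv ℝ g (t • a)) (t • a + (0 : ℝ) • b) := by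
    simpa using ht.hasFDerivAt
  exact (h4.comp_hasDerivAt 0 h3).deriv

/-- Second variations commute. -/
theorem IsLocalZeroForm.var_var_comm (hA : ∀ φ ∈ A, SmoothField ρ I φ)
    (h : IsLocalZeroForm ρ I J ι A α) {φ v w : M → V} (hφ : φ ∈ A) (hv : SmoothField ρ I v)
    (hw : SmoothField ρ I w) :
    var (fun ψ ↦ var α ψ w) φ v = var (fun ψ ↦ var α ψ v) φ w := by
  ext1 p
  set g : ℝ × ℝ → F [⋀^Fin q]→L[ℝ] ℝ := fun z ↦ α (φ + z.1 • v + z.2 • w) p with hg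
  have h1 : SmoothFamilyAt J (formInChart J)
      (fun z : ℝ × ℝ ↦ α (φ + z.1 • v + z.2 • w)) 0 p :=
    h (ℝ × ℝ) _ 0 p (by simpa using hφ) (smoothFamilyAt_plane (hA φ hφ _) (hv _) (hw _) _)
  have hc : ContDiffAt ℝ ∞ g 0 := h1.contDiffAt (isLinearRep_form q)
  have hsymm := hc.isSymmSndFDerivAt (by simp; exact WithTop.coe_le_coe.2 le_top)
  have e1 := deriv_deriv_eq_fderiv_fderiv hc (1, 0) (0, 1)
  have e2 := deriv_deriv_eq_fderiv_fderiv hc (0, 1) (1, 0)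
  simp only [hg, Prod.smul_mk, smul_eq_mul, mul_one, mul_zero, Prod.mk_add_mk, add_zero,
    zero_add] at e1 e2
  refine e1.trans ((hsymm _ _).trans (e2.symm.trans ?_))
  simp only [var, add_right_comm]

theorem IsLocalZeroForm.var₂_var (hA : ∀ φ ∈ A, SmoothField ρ I φ)
    (h : IsLocalZeroForm ρ I J ι A α) {φ v w : M → V} (hφ : φ ∈ A) (hv : SmoothField ρ I v)
    (hw : SmoothField ρ I w) : var₂ (var α) φ v w = 0 := by
  rw [var₂, h.var_var_comm hA hφ hv hw, sub_self]

/-- Lets the two places where a curve parameter occurs be varied independently. -/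
theorem hasDerivAt_diagonal {W : Type*} [NormedAddCommGroup W] [NormedSpace ℝ W] {g : ℝ × ℝ → W}
    {a b : W} (hg : DifferentiableAt ℝ g (0, 0)) (ha : HasDerivAt (fun s ↦ g (s, 0)) a 0)
    (hb : HasDerivAt (fun r ↦ g (0, r)) b 0) : HasDerivAt (fun t ↦ g (t, t)) (a + b) 0 := by
  have h1 := HasFDerivAt.comp_hasDerivAt (f := fun t : ℝ ↦ (t, t)) 0 hg.hasFDerivAt
    ((hasDerivAt_id 0).prodMk (hasDerivAt_id 0))
  have h2 := HasFDerivAt.comp_hasDerivAt (f := fun t : ℝ ↦ (t, (0 : ℝ))) 0 hg.hasFDerivAt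
    ((hasDerivAt_id 0).prodMk (hasDerivAt_const _ _))
  have h3 := HasFDerivAt.comp_hasDerivAt (f := fun t : ℝ ↦ ((0 : ℝ), t)) 0 hg.hasFDerivAt
    ((hasDerivAt_const _ _).prodMk (hasDerivAt_id 0))
  refine h1.congr_deriv ?_
  rw [ha.unique h2, hb.unique h3, ← map_add]
  simp

/-- The derivative of a local form along a smooth curve of fields. -/
theorem IsLocalZeroForm.hasDerivAt (h : IsLocalZeroForm ρ I J ι A α) {u : ℝ → M → V}
    (hu : ∀ t x, SmoothFamilyAt I (fieldInChart ρ I) u t x) (h0 : u 0 ∈ A) (p : P) :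
    HasDerivAt (fun t ↦ α (u t) p) (var α (u 0) (velocity u) p) 0 := by
  have := FiniteDimensional.complete ℝ V
  -- On the diagonal `g` is `α (u t)`. At `r = 0` its first variable runs along the straight line in
  -- the direction of the velocity, which is `var`; at `s = 0` it does not depend on the second
  -- variable.
  set g : ℝ × ℝ → F [⋀^Fin q]→L[ℝ] ℝ := fun z ↦ α (u 0 + z.1 • meanVelocity u z.2) p with hg
  have h1 : SmoothFamilyAt I (fieldInChart ρ I)
      (fun z : ℝ × ℝ ↦ u 0 + z.1 • meanVelocity u z.2) (0, 0) (ι p) :=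
    ((hu 0 (ι p)).section.family _).add (isLinearRep_field ρ)
      (((SmoothFamilyAt.meanVelocity (isLinearRep_field ρ) hu (ι p)).comp (f := Prod.snd)
        (s' := ((0 : ℝ), (0 : ℝ))) contDiffAt_snd).smul (isLinearRep_field ρ) contDiffAt_fst)
  have hd : DifferentiableAt ℝ g (0, 0) :=
    ((h (ℝ × ℝ) _ (0, 0) p (by simpa using h0) h1).contDiffAt
      (isLinearRep_form q)).differentiableAt (by simp)
  have ha : HasDerivAt (fun s ↦ g (s, 0)) (var α (u 0) (velocity u) p) 0 := by
    have h2 : (fun s ↦ g (s, 0)) = fun s ↦ α (u 0 + s • velocity u) p := by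
      simp only [hg, meanVelocity_zero]
    rw [h2, var]
    have h3 : DifferentiableAt ℝ (fun s ↦ g (s, 0)) 0 :=
      hd.comp (0 : ℝ) (f := fun s : ℝ ↦ (s, (0 : ℝ))) (by fun_prop)
    rw [h2] at h3
    exact h3.hasDerivAt
  have hb : HasDerivAt (fun r ↦ g (0, r)) 0 0 := by
    simpa only [hg, zero_smul, add_zero] using hasDerivAt_const (0 : ℝ) (α (u 0) p)
  have h5 := hasDerivAt_diagonal hd ha hb
  rw [add_zero] at h5
  refine h5.congr_of_eventuallyEq (Eventually.of_forall fun t ↦ ?_)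
  simp only [hg, ← eq_add_smul_meanVelocity (isLinearRep_field ρ) hu t]

theorem IsLocalZeroForm.curveDeriv_eq (h : IsLocalZeroForm ρ I J ι A α) {u : ℝ → M → V}
    (hu : ∀ t x, SmoothFamilyAt I (fieldInChart ρ I) u t x) (h0 : u 0 ∈ A) :
    curveDeriv (fun t ↦ α (u t)) = var α (u 0) (velocity u) :=
  funext fun p ↦ (h.hasDerivAt hu h0 p).deriv

variable {β : (M → V) → (M → V) → P → F [⋀^Fin q]→L[ℝ] ℝ}

/-- The two arguments are varied separately. In the second one, linearity makes the difference
quotient equal to `β (u 0) (meanVelocity k t)`, and smoothness on families makes this continuous at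
`0`; no topology on the space of fields is involved. -/
theorem IsSmoothOneForm.hasDerivAt (hA : ∀ φ ∈ A, SmoothField ρ I φ)
    (h : IsSmoothOneForm ρ I J ι A β) {u k : ℝ → M → V}
    (hu : ∀ t x, SmoothFamilyAt I (fieldInChart ρ I) u t x) (h0 : u 0 ∈ A)
    (hk : ∀ t x, SmoothFamilyAt I (fieldInChart ρ I) k t x) (p : P) :
    HasDerivAt (fun t ↦ β (u t) (k t) p)
      (var (fun ψ ↦ β ψ (k 0)) (u 0) (velocity u) p + β (u 0) (velocity k) p) 0 := by
  have := FiniteDimensional.complete ℝ V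
  have hsk : ∀ t, SmoothField ρ I (k t) := fun t x ↦ (hk t x).section
  have hd : DifferentiableAt ℝ (fun z : ℝ × ℝ ↦ β (u z.1) (k z.2) p) (0, 0) :=
    ((h.smooth (ℝ × ℝ) (fun z ↦ u z.1) (fun z ↦ k z.2) (0, 0) p h0
      ((hu 0 (ι p)).comp (f := Prod.fst) (s' := ((0 : ℝ), (0 : ℝ))) contDiffAt_fst)
      ((hk 0 (ι p)).comp (f := Prod.snd) (s' := ((0 : ℝ), (0 : ℝ))) contDiffAt_snd)).contDiffAt
      (isLinearRep_form q)).differentiableAt (by simp)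
  refine hasDerivAt_diagonal (g := fun z : ℝ × ℝ ↦ β (u z.1) (k z.2) p) hd
    ((h.isLocalZeroForm (hsk 0)).hasDerivAt hu h0 p) ?_
  have hc : ContinuousAt (fun r ↦ β (u 0) (meanVelocity k r) p) 0 :=
    ((h.smooth ℝ (fun _ ↦ u 0) (meanVelocity k) 0 p h0 ((hA _ h0 _).family 0)
      (SmoothFamilyAt.meanVelocity (isLinearRep_field ρ) hk (ι p))).contDiffAt
      (isLinearRep_form q)).continuousAt
  rw [hasDerivAt_iff_tendsto_slope]
  rw [ContinuousAt, meanVelocity_zero] at hc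
  refine (hc.mono_left nhdsWithin_le_nhds).congr' ?_
  filter_upwards [self_mem_nhdsWithin] with t ht
  have h1 : meanVelocity k t = t⁻¹ • k t + (-t⁻¹) • k 0 := by
    have h2 := eq_add_smul_meanVelocity (isLinearRep_field ρ) hk t
    conv_rhs => rw [h2]
    rw [smul_add, smul_smul, inv_mul_cancel₀ ht]
    module
  rw [h1, h.linear _ h0 _ _ _ _ (hsk t) (hsk 0), slope_def_module]
  simp only [Pi.add_apply, Pi.smul_apply, sub_zero]
  module

theorem IsSmoothOneForm.curveDeriv_eq (hA : ∀ φ ∈ A, SmoothField ρ I φ)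
    (h : IsSmoothOneForm ρ I J ι A β) {u k : ℝ → M → V}
    (hu : ∀ t x, SmoothFamilyAt I (fieldInChart ρ I) u t x) (h0 : u 0 ∈ A)
    (hk : ∀ t x, SmoothFamilyAt I (fieldInChart ρ I) k t x) :
    curveDeriv (fun t ↦ β (u t) (k t))
      = var (fun ψ ↦ β ψ (k 0)) (u 0) (velocity u) + β (u 0) (velocity k) :=
  funext fun p ↦ (h.hasDerivAt hA hu h0 hk p).deriv

theorem var_add (hA : ∀ φ ∈ A, SmoothField ρ I φ)
    {α α' : (M → V) → P → F [⋀^Fin q]→L[ℝ] ℝ} (h : IsLocalZeroForm ρ I J ι A α)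
    (h' : IsLocalZeroForm ρ I J ι A α') {φ v : M → V} (hφ : φ ∈ A) (hv : SmoothField ρ I v) :
    var (fun ψ ↦ α ψ + α' ψ) φ v = var α φ v + var α' φ v :=
  curveDeriv_add (h.line hA hφ hv) (h'.line hA hφ hv)

theorem var_sub (hA : ∀ φ ∈ A, SmoothField ρ I φ)
    {α α' : (M → V) → P → F [⋀^Fin q]→L[ℝ] ℝ} (h : IsLocalZeroForm ρ I J ι A α)
    (h' : IsLocalZeroForm ρ I J ι A α') {φ v : M → V} (hφ : φ ∈ A) (hv : SmoothField ρ I v) :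
    var (fun ψ ↦ α ψ - α' ψ) φ v = var α φ v - var α' φ v :=
  curveDeriv_sub (h.line hA hφ hv) (h'.line hA hφ hv)

theorem var_extD (hA : ∀ φ ∈ A, SmoothField ρ I φ) (h : IsLocalZeroForm ρ I J ι A α)
    {φ v : M → V} (hφ : φ ∈ A) (hv : SmoothField ρ I v) :
    var (fun ψ ↦ extD J (α ψ)) φ v = extD J (var α φ v) :=
  curveDeriv_extD (h.line hA hφ hv)

theorem var_pullback (hA : ∀ φ ∈ A, SmoothField ρ I φ)
    {α : (M → V) → M → E [⋀^Fin q]→L[ℝ] ℝ} (h : IsLocalZeroForm ρ I I id A α)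
    {φ v : M → V} (hφ : φ ∈ A) (hv : SmoothField ρ I v) :
    var (fun ψ ↦ pullback I J ι (α ψ)) φ v = pullback I J ι (var α φ v) :=
  curveDeriv_pullback (h.line hA hφ hv)

theorem var₂_add (hA : ∀ φ ∈ A, SmoothField ρ I φ)
    {β β' : (M → V) → (M → V) → P → F [⋀^Fin q]→L[ℝ] ℝ} (h : IsSmoothOneForm ρ I J ι A β)
    (h' : IsSmoothOneForm ρ I J ι A β') {φ v w : M → V} (hφ : φ ∈ A) (hv : SmoothField ρ I v)
    (hw : SmoothField ρ I w) :
    var₂ (fun ψ v ↦ β ψ v + β' ψ v) φ v w = var₂ β φ v w + var₂ β' φ v w := by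
  rw [var₂, var_add hA (h.isLocalZeroForm hw) (h'.isLocalZeroForm hw) hφ hv,
    var_add hA (h.isLocalZeroForm hv) (h'.isLocalZeroForm hv) hφ hw, var₂, var₂]
  abel

theorem var₂_sub (hA : ∀ φ ∈ A, SmoothField ρ I φ)
    {β β' : (M → V) → (M → V) → P → F [⋀^Fin q]→L[ℝ] ℝ} (h : IsSmoothOneForm ρ I J ι A β)
    (h' : IsSmoothOneForm ρ I J ι A β') {φ v w : M → V} (hφ : φ ∈ A) (hv : SmoothField ρ I v)
    (hw : SmoothField ρ I w) :
    var₂ (fun ψ v ↦ β ψ v - β' ψ v) φ v w = var₂ β φ v w - var₂ β' φ v w := by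
  rw [var₂, var_sub hA (h.isLocalZeroForm hw) (h'.isLocalZeroForm hw) hφ hv,
    var_sub hA (h.isLocalZeroForm hv) (h'.isLocalZeroForm hv) hφ hw, var₂, var₂]
  abel

theorem IsLocalZeroForm.smoothForm_var (hA : ∀ φ ∈ A, SmoothField ρ I φ)
    (h : IsLocalZeroForm ρ I J ι A α) {φ v : M → V} (hφ : φ ∈ A) (hv : SmoothField ρ I v) :
    SmoothForm J (var α φ v) :=
  (h.isLocalOneForm_var hA).isSmoothOneForm.smoothForm hA hφ hv

theorem IsSmoothOneForm.smoothForm_var₂ (hA : ∀ φ ∈ A, SmoothField ρ I φ)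
    (h : IsSmoothOneForm ρ I J ι A β) {φ v w : M → V} (hφ : φ ∈ A) (hv : SmoothField ρ I v)
    (hw : SmoothField ρ I w) : SmoothForm J (var₂ β φ v w) :=
  ((h.isLocalZeroForm hw).smoothForm_var hA hφ hv).sub
    ((h.isLocalZeroForm hv).smoothForm_var hA hφ hw)

theorem var₂_extD (hA : ∀ φ ∈ A, SmoothField ρ I φ) (h : IsSmoothOneForm ρ I J ι A β)
    {φ v w : M → V} (hφ : φ ∈ A) (hv : SmoothField ρ I v) (hw : SmoothField ρ I w) :
    var₂ (fun ψ v ↦ extD J (β ψ v)) φ v w = extD J (var₂ β φ v w) := by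
  rw [var₂, var_extD hA (h.isLocalZeroForm hw) hφ hv, var_extD hA (h.isLocalZeroForm hv) hφ hw,
    var₂, extD_sub ((h.isLocalZeroForm hw).smoothForm_var hA hφ hv)
    ((h.isLocalZeroForm hv).smoothForm_var hA hφ hw)]

theorem var₂_pullback (hA : ∀ φ ∈ A, SmoothField ρ I φ)
    {β : (M → V) → (M → V) → M → E [⋀^Fin q]→L[ℝ] ℝ} (h : IsSmoothOneForm ρ I I id A β)
    {φ v w : M → V} (hφ : φ ∈ A) (hv : SmoothField ρ I v) (hw : SmoothField ρ I w) :
    var₂ (fun ψ v ↦ pullback I J ι (β ψ v)) φ v w = pullback I J ι (var₂ β φ v w) := by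
  rw [var₂, var_pullback hA (h.isLocalZeroForm hw) hφ hv,
    var_pullback hA (h.isLocalZeroForm hv) hφ hw, var₂, pullback_sub]

theorem SmoothField.lieField {X : M → E} {φ : M → V} (hX : SmoothVec I X)
    (hφ : SmoothField ρ I φ) : SmoothField ρ I (lieField ρ I X φ) := fun x ↦
  (SmoothFamilyAt.lieField ρ ((hX x).family (0 : ℝ)) ((hφ x).family 0)).section

theorem curveDeriv_line {W : Type*} [NormedAddCommGroup W] [NormedSpace ℝ W] {Q : Type*}
    (φ v : Q → W) : curveDeriv (fun t : ℝ ↦ φ + t • v) = v := by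
  ext1 x
  have h : HasDerivAt (fun t : ℝ ↦ φ x + t • v x) (v x) 0 := by
    simpa using ((hasDerivAt_id (0 : ℝ)).smul_const (v x)).const_add (φ x)
  exact h.deriv

/-- The anomaly of a `1`-form, in terms of the variation of its value on a fixed variation. -/
theorem anomaly₁_eq {α : (M → V) → (M → V) → P → F [⋀^Fin (q + 1)]→L[ℝ] ℝ}
    (hA : ∀ φ ∈ A, SmoothField ρ I φ) (h : IsSmoothOneForm ρ I J ι A α) {φ v : M → V} {X Y : M → E}
    (hφ : φ ∈ A) (hv : SmoothField ρ I v) (hX : SmoothVec I X) (hY : SmoothVec I Y) (XP : P → F) :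
    anomaly₁ ρ I J α φ X XP Y v
      = var (fun ψ ↦ α ψ v) φ (lieField ρ I X φ) + α φ (lieField ρ I X v)
        - lieForm J XP (α φ v) := by
  have hu : ∀ (t : ℝ) x, SmoothFamilyAt I (fieldInChart ρ I) (fun t : ℝ ↦ φ + t • v) t x :=
    fun t x ↦ (hA φ hφ x).line (isLinearRep_field ρ) (hv x) t
  have hZ : ∀ (t : ℝ) x, SmoothFamilyAt I (vecInChart I) (fun t : ℝ ↦ X + t • Y) t x :=
    fun t x ↦ (hX x).line isLinearRep_vec (hY x) t
  have hk : ∀ (t : ℝ) x, SmoothFamilyAt I (fieldInChart ρ I)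
      (fun t : ℝ ↦ lieField ρ I (X + t • Y) (φ + t • v)) t x :=
    fun t x ↦ (hZ t x).lieField ρ (hu t x)
  have hvel : velocity (fun t : ℝ ↦ lieField ρ I (X + t • Y) (φ + t • v))
      -- The contribution of `£_Y φ` cancels the term `I_{δξ̂} α` of the anomaly, so the anomaly
      -- does not depend on `Y`.
      = lieField ρ I Y φ + lieField ρ I X v := by
    ext1 x
    have h1 := (hasDerivAt_lieField ρ (hZ 0 x) (hu 0 x)).deriv
    rw [curveDeriv_line, curveDeriv_line] at h1
    simp only [zero_smul, add_zero] at h1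
    exact h1
  have h1 := h.curveDeriv_eq hA hu (by simpa using hφ) hk
  have hvel' : velocity (fun t : ℝ ↦ φ + t • v) = v := curveDeriv_line φ v
  rw [hvel, hvel'] at h1
  simp only [zero_smul, add_zero] at h1
  have h2 := h.linear φ hφ (lieField ρ I Y φ) (lieField ρ I X v) 1 1
    (SmoothField.lieField hY (hA φ hφ)) (SmoothField.lieField hX hv)
  simp only [one_smul] at h2
  rw [h2] at h1
  have h3 : (fun p ↦ deriv (fun t : ℝ ↦ α (φ + t • v) (lieField ρ I (X + t • Y) (φ + t • v)) p) 0)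
      = curveDeriv (fun t : ℝ ↦ α (φ + t • v) (lieField ρ I (X + t • Y) (φ + t • v))) := rfl
  rw [anomaly₁, h3, h1, var₂]
  abel

end Variation

section FieldSpace

variable (𝓕 : FieldSpace ρ I M) {α α' : (M → V) → P → F [⋀^Fin q]→L[ℝ] ℝ}

/-- The variation of a form along a tangent vector is determined by its values on the field
space. -/
theorem FieldSpace.var_congr (h : IsLocalZeroForm ρ I J ι 𝓕.configs α)
    (h' : IsLocalZeroForm ρ I J ι 𝓕.configs α') (heq : ∀ ψ ∈ 𝓕.configs, α ψ = α' ψ)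
    {φ v : M → V} (hφ : φ ∈ 𝓕.configs) (hv : v ∈ 𝓕.variations) : var α φ v = var α' φ v := by
  -- The defining straight line may leave the field space, but the variation is also the derivative
  -- along a curve inside it.
  obtain ⟨c, hc, rfl, rfl⟩ := (𝓕.mem_variations_iff φ hφ v).1 hv
  rw [← h.curveDeriv_eq hc.smooth hφ, ← h'.curveDeriv_eq hc.smooth hφ]
  congr 1
  ext1 t
  exact heq _ (hc.mem t)

end FieldSpace

end LocalForms

/-! ### The Noether current, the corner identities and the variation of the charge. -/

section Charges

variable {E : Type*} [NormedAddCommGroup E] [NormedSpace ℝ E] [FiniteDimensional ℝ E]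
  {V : Type*} [NormedAddCommGroup V] [NormedSpace ℝ V] [FiniteDimensional ℝ V]
  {ρ : FieldType E V}
  {H : Type*} [TopologicalSpace H] {I : ModelWithCorners ℝ E H}
  {M : Type*} [TopologicalSpace M] [ChartedSpace H M] [IsManifold I ∞ M]
  {F : Type*} [NormedAddCommGroup F] [NormedSpace ℝ F] [FiniteDimensional ℝ F]
  {G : Type*} [TopologicalSpace G] {J : ModelWithCorners ℝ F G}
  {N : Type*} [TopologicalSpace N] [ChartedSpace G N] [IsManifold J ∞ N] {ι : N → M}
  {𝓕 : FieldSpace ρ I M}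

section Generators

theorem FieldSpace.isCurveIn_const {φ : M → V} (hφ : φ ∈ 𝓕.configs) :
    IsCurveIn ρ I 𝓕.configs (fun _ ↦ φ) where
  mem _ := hφ
  smooth t x := (𝓕.smooth_configs φ hφ x).family t

theorem FieldSpace.velocity_mem {u : ℝ → M → V} (hu : IsCurveIn ρ I 𝓕.configs u) :
    velocity u ∈ 𝓕.variations :=
  (𝓕.mem_variations_iff _ (hu.mem 0) _).2 ⟨u, hu, rfl, rfl⟩

variable (ξ : Generator J ι 𝓕)

theorem Generator.smoothVec {φ : M → V} (hφ : φ ∈ 𝓕.configs) : SmoothVec I (ξ.vec φ) := fun x ↦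
  (ξ.smooth _ (FieldSpace.isCurveIn_const hφ) 0 x).section

theorem Generator.smoothVecN {φ : M → V} (hφ : φ ∈ 𝓕.configs) : SmoothVec J (ξ.vecN φ) :=
  fun p ↦ (ξ.smoothN _ (FieldSpace.isCurveIn_const hφ) 0 p).section

theorem Generator.curveDeriv_vec {u : ℝ → M → V} (hu : IsCurveIn ρ I 𝓕.configs u) :
    curveDeriv (fun t ↦ ξ.vec (u t)) = ξ.varVec (u 0) (velocity u) :=
  funext fun x ↦ (ξ.hasVar u hu x).deriv

theorem Generator.curveDeriv_vecN {u : ℝ → M → V} (hu : IsCurveIn ρ I 𝓕.configs u) :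
    curveDeriv (fun t ↦ ξ.vecN (u t)) = ξ.varVecN (u 0) (velocity u) :=
  funext fun x ↦ (ξ.hasVarN u hu x).deriv

theorem Generator.smoothVec_varVec {u : ℝ → M → V} (hu : IsCurveIn ρ I 𝓕.configs u) :
    SmoothVec I (ξ.varVec (u 0) (velocity u)) := by
  rw [← ξ.curveDeriv_vec hu]
  exact fun x ↦ ((ξ.smooth u hu 0 x).deriv_curve isLinearRep_vec).section

theorem Generator.smoothVec_varVecN {u : ℝ → M → V} (hu : IsCurveIn ρ I 𝓕.configs u) :
    SmoothVec J (ξ.varVecN (u 0) (velocity u)) := by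
  rw [← ξ.curveDeriv_vecN hu]
  exact fun x ↦ ((ξ.smoothN u hu 0 x).deriv_curve isLinearRep_vec).section

/-- Tangency is a linear condition at each point, so it passes to the derivative along a curve. Thus
the density formula also applies to `δξ`. -/
theorem Generator.tangent_varVec {u : ℝ → M → V} (hu : IsCurveIn ρ I 𝓕.configs u) (p : N) :
    (mfderiv J I ι p : F →L[ℝ] E) (ξ.varVecN (u 0) (velocity u) p)
      = ξ.varVec (u 0) (velocity u) (ι p) := by
  let A : F →L[ℝ] E := mfderiv J I ι p
  have h : HasDerivAt (fun t ↦ A (ξ.vecN (u t) p)) (A (ξ.varVecN (u 0) (velocity u) p)) 0 :=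
    A.hasFDerivAt.comp_hasDerivAt 0 (ξ.hasVarN u hu p)
  refine h.unique ((ξ.hasVar u hu (ι p)).congr_of_eventuallyEq (Eventually.of_forall fun t ↦ ?_))
  exact ξ.tangent _ (hu.mem t) p

end Generators

namespace PhaseSpaceData

variable {m : ℕ} {D : PhaseSpaceData E V M F N m}

/-- The improved charge density in terms of the Noether potential and the corner flux. -/
theorem improvedDensityAt_eq (hD : D.IsAdmissible J ι 𝓕) {φ : M → V}
    (hφ : φ ∈ 𝓕.configs) {X : M → E} {XN : N → F} (hX : SmoothVec I X) (hXN : SmoothVec J XN)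
    (ht : ∀ p, (mfderiv J I ι p : F →L[ℝ] E) (XN p) = X (ι p)) :
    D.improvedDensityAt ρ I J ι φ X XN = pullback I J ι (D.Q φ X)
      + contract XN (D.ell φ + pullback I J ι (D.b φ) + extD J (D.c φ))
      - D.ε φ (lieField ρ I X φ)
      + extD J (contract XN (D.c φ) - D.γ φ (lieField ρ I X φ)) := by
  have hK := 𝓕.lie_mem φ hφ X hX
  have hc := hD.local_c.smoothForm 𝓕.smooth_configs hφ
  have hγ := hD.local_γ.isSmoothOneForm.smoothForm 𝓕.smooth_configs hφ
    (𝓕.smooth_variations _ hK)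
  -- The corner decomposition at `δφ = £_ξ φ`: its `I_ξ̂ δc'` cancels the `L_ξ̂ c'` part of the
  -- anomaly, and its `λ'` cancels the one in `Q'_ξ`. The Lie derivative part leaves `i_ξ dc'` and
  -- `d i_ξ c'`.
  have h := hD.decomp_β φ hφ _ hK
  rw [sub_eq_iff_eq_add] at h
  rw [improvedDensityAt, density, noetherCharge, anomaly, lieForm, h, extD_sub (hXN.contract hc) hγ,
    pullback_add, pullback_add, pullback_contract ht, contract_add_form, contract_add_form]
  abel

theorem isLocalZeroForm_covL (hD : D.IsAdmissible J ι 𝓕) :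
    IsLocalZeroForm ρ I I id 𝓕.configs (D.covL I) :=
  hD.local_L.sub hD.local_b.extD

theorem isSmoothOneForm_covθ (hD : D.IsAdmissible J ι 𝓕) :
    IsSmoothOneForm ρ I I id 𝓕.configs (D.covθ I) :=
  (hD.local_θ.isSmoothOneForm.sub
    (hD.local_b.isLocalOneForm_var 𝓕.smooth_configs).isSmoothOneForm).sub
    (hD.local_lam.isSmoothOneForm.extD 𝓕.smooth_configs)

/-- The covariant symplectic potential is covariant. -/
theorem var_covθ (hD : D.IsAdmissible J ι 𝓕) {φ v : M → V} (hφ : φ ∈ 𝓕.configs)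
    (hv : v ∈ 𝓕.variations) {X : M → E} (hX : SmoothVec I X) :
    var (fun ψ ↦ D.covθ I ψ v) φ (lieField ρ I X φ) + D.covθ I φ (lieField ρ I X v)
      = lieForm I X (D.covθ I φ v) := by
  have hA := 𝓕.smooth_configs
  have hv' := 𝓕.smooth_variations v hv
  have hXv : SmoothField ρ I (lieField ρ I X v) := SmoothField.lieField hX hv'
  have hK : SmoothField ρ I (lieField ρ I X φ) := SmoothField.lieField hX (hA φ hφ)
  have h0 : SmoothVec I (0 : M → E) := fun x ↦ SmoothSectionAt.zero isLinearRep_vec x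
  have hθ := hD.local_θ.isSmoothOneForm
  have hb := (hD.local_b.isLocalOneForm_var hA).isSmoothOneForm
  have hl := hD.local_lam.isSmoothOneForm
  have h := hD.anomaly_θ φ hφ v hv X hX
  rw [anomaly₁_eq hA hθ hφ hv' hX h0, anomaly₁_eq hA hb hφ hv' hX h0,
    anomaly₁_eq hA hl hφ hv' hX h0] at h
  have sθ := hθ.smoothForm hA hφ hv'
  have sb := hb.smoothForm hA hφ hv'
  have sl := hl.smoothForm hA hφ hv'
  have sl1 := (hl.isLocalZeroForm hv').smoothForm_var hA hφ hK
  have sl2 := hl.smoothForm hA hφ hXv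
  have e1 : var (fun ψ ↦ D.covθ I ψ v) φ (lieField ρ I X φ)
      = var (fun ψ ↦ D.θ ψ v) φ (lieField ρ I X φ)
        - var (fun ψ ↦ var D.b ψ v) φ (lieField ρ I X φ)
        - extD I (var (fun ψ ↦ D.lam ψ v) φ (lieField ρ I X φ)) := by
    have h1 := var_sub hA ((hθ.sub hb).isLocalZeroForm hv') ((hl.extD hA).isLocalZeroForm hv') hφ hK
    rw [var_sub hA (hθ.isLocalZeroForm hv') (hb.isLocalZeroForm hv') hφ hK,
      var_extD hA (hl.isLocalZeroForm hv') hφ hK] at h1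
    exact h1
  -- The Lie derivative commutes with `d`, by Cartan's formula and `d² = 0`.
  have e2 : lieForm I X (D.covθ I φ v) = lieForm I X (D.θ φ v) - lieForm I X (var D.b φ v)
      - extD I (lieForm I X (D.lam φ v)) := by
    simp only [lieForm, covθ, contract_sub_form]
    rw [extD_sub ((hX.contract sθ).sub (hX.contract sb)) (hX.contract sl.extD),
      extD_sub (hX.contract sθ) (hX.contract sb), extD_sub (sθ.sub sb) sl.extD,
      extD_sub sθ sb, extD_extD sl,
      extD_add (hX.contract sl).extD (hX.contract sl.extD), extD_extD (hX.contract sl)]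
    simp only [contract_sub_form, contract_zero_form]
    abel
  have sL : SmoothForm I (lieForm I X (D.lam φ v)) :=
    (hX.contract sl).extD.add (hX.contract sl.extD)
  rw [extD_sub (sl1.add sl2) sL, extD_add sl1 sl2] at h
  rw [← sub_eq_zero] at h ⊢
  rw [e1, e2, covθ, ← h]
  abel

theorem smoothForm_currentPotential (hD : D.IsAdmissible J ι 𝓕) {u : ℝ → M → V}
    (hu : IsCurveIn ρ I (D.solutions 𝓕) u) {X : ℝ → M → E}
    (hX : ∀ t x, SmoothFamilyAt I (vecInChart I) X t x) :
    SmoothForm I (contract (X 0) (D.covθ I (u 0) (velocity u)) + D.Q (u 0) (curveDeriv X)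
      - curveDeriv (fun t ↦ D.Q (u t) (X t))) := by
  have hA := 𝓕.smooth_configs
  have hc : IsCurveIn ρ I 𝓕.configs u := ⟨fun t ↦ (hu.mem t).1, hu.smooth⟩
  have hφ := hc.mem 0
  have hv := 𝓕.smooth_variations _ (FieldSpace.velocity_mem hc)
  have hX0 : SmoothVec I (X 0) := fun x ↦ (hX 0 x).section
  refine ((hX0.contract ((isSmoothOneForm_covθ hD).smoothForm hA hφ hv)).add fun x ↦ ?_).sub
    (SmoothFamilyAt.smoothForm_curveDeriv fun x ↦
      hD.local_Q.smooth ℝ u X 0 x hφ (hc.smooth 0 x) (hX 0 x))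
  exact (hD.local_Q.smooth ℝ (fun _ ↦ u 0) (fun _ ↦ curveDeriv X) 0 x hφ
    ((hA _ hφ x).family 0) (((hX 0 x).deriv_curve isLinearRep_vec).section.family 0)).section

/-- On shell, the presymplectic current of the covariant potential is exact when contracted with
an infinitesimal diffeomorphism. -/
theorem var₂_covθ (hD : D.IsAdmissible J ι 𝓕) {u : ℝ → M → V}
    (hu : IsCurveIn ρ I (D.solutions 𝓕) u) {X : ℝ → M → E}
    (hX : ∀ t x, SmoothFamilyAt I (vecInChart I) X t x) :
    var₂ (D.covθ I) (u 0) (lieField ρ I (X 0) (u 0)) (velocity u)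
      = extD I (contract (X 0) (D.covθ I (u 0) (velocity u)) + D.Q (u 0) (curveDeriv X)
        - curveDeriv (fun t ↦ D.Q (u t) (X t))) := by
  have hA := 𝓕.smooth_configs
  have hc : IsCurveIn ρ I 𝓕.configs u := ⟨fun t ↦ (hu.mem t).1, hu.smooth⟩
  have hφ := hc.mem 0
  have hv := FieldSpace.velocity_mem hc
  have hv' := 𝓕.smooth_variations _ hv
  have hXt : ∀ t, SmoothVec I (X t) := fun t x ↦ (hX t x).section
  have hY : SmoothVec I (curveDeriv X) :=
    fun x ↦ ((hX 0 x).deriv_curve isLinearRep_vec).section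
  have hk : ∀ t x, SmoothFamilyAt I (fieldInChart ρ I)
      (fun t ↦ lieField ρ I (X t) (u t)) t x := fun t x ↦ (hX t x).lieField ρ (hc.smooth t x)
  have hθ := isSmoothOneForm_covθ hD
  have hL := isLocalZeroForm_covL hD
  have sQ : ∀ t x, SmoothFamilyAt I (formInChart I) (fun t ↦ D.Q (u t) (X t)) t x := fun t x ↦
    hD.local_Q.smooth ℝ u X t x (hc.mem t) (hc.smooth t x) (hX t x)
  have sθ : ∀ t x, SmoothFamilyAt I (formInChart I)
      (fun t ↦ D.covθ I (u t) (lieField ρ I (X t) (u t))) t x := fun t x ↦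
    hθ.smooth ℝ u _ t x (hc.mem t) (hc.smooth t x) (hk t x)
  have sL : ∀ t x, SmoothFamilyAt I (formInChart I) (fun t ↦ D.covL I (u t)) t x := fun t x ↦
    hL ℝ u t x (hc.mem t) (hc.smooth t x)
  have hvel : velocity (fun t ↦ lieField ρ I (X t) (u t))
      = lieField ρ I (curveDeriv X) (u 0) + lieField ρ I (X 0) (velocity u) :=
    funext fun x ↦ (hasDerivAt_lieField ρ (hX 0 x) (hc.smooth 0 x)).deriv
  -- the variation of the covariant Lagrangian
  have hvL : var (D.covL I) (u 0) (velocity u) = extD I (D.covθ I (u 0) (velocity u)) := by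
    have h1 := var_sub hA hD.local_L hD.local_b.extD hφ hv'
    rw [var_extD hA hD.local_b hφ hv', hD.var_L _ hφ _ hv] at h1
    -- Being on shell leaves `δL' = dθ'`; the `λ'` term of `covθ` is exact and drops out of `d
    -- covθ`.
    have h2 : (fun x ↦ D.eom (u 0) x (velocity u x)) = 0 := funext ((hu.mem 0).2 _ hv)
    have s1 := hD.local_θ.isSmoothOneForm.smoothForm hA hφ hv'
    have s2 := hD.local_b.smoothForm_var hA hφ hv'
    have s3 := hD.local_lam.isSmoothOneForm.smoothForm hA hφ hv'
    rw [covθ, extD_sub (s1.sub s2) s3.extD, extD_sub s1 s2, extD_extD s3, sub_zero]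
    rw [h2, zero_add] at h1
    exact h1
  -- the variation of the Noether identity
  have h1 : curveDeriv (fun t ↦ D.covθ I (u t) (lieField ρ I (X t) (u t))
      - contract (X t) (D.covL I (u t))) = curveDeriv (fun t ↦ extD I (D.Q (u t) (X t))) := by
    congr 1
    ext1 t
    exact hD.noether _ (hu.mem t) _ (hXt t)
  rw [curveDeriv_sub (sθ 0) (fun x ↦ (hX 0 x).contract (sL 0 x)),
    hθ.curveDeriv_eq hA hc.smooth hφ hk, hvel,
    curveDeriv_contract (fun x ↦ (hX 0 x).hasDerivAt isLinearRep_vec) (sL 0),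
    curveDeriv_extD (sQ 0), hL.curveDeriv_eq hc.smooth hφ, hvL] at h1
  have h2 := hθ.linear _ hφ (lieField ρ I (curveDeriv X) (u 0)) (lieField ρ I (X 0) (velocity u))
    1 1 (SmoothField.lieField hY (hA _ hφ)) (SmoothField.lieField (hXt 0) hv')
  simp only [one_smul] at h2
  rw [h2] at h1
  -- The Noether identity for `δξ` trades `I_{δξ̂} θ - i_{δξ} L`, left over from differentiating the
  -- generator, for `dQ_{δξ}`.
  have h3 := hD.noether _ (hu.mem 0) _ hY
  have h4 := var_covθ hD hφ hv (hXt 0)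
  have s1 := (hXt 0).contract (hθ.smoothForm hA hφ hv')
  have s2 : SmoothForm I (D.Q (u 0) (curveDeriv X)) := fun x ↦
    (hD.local_Q.smooth ℝ (fun _ ↦ u 0) (fun _ ↦ curveDeriv X) 0 x hφ
      ((hA _ hφ x).family 0) ((hY x).family 0)).section
  have s3 : SmoothForm I (curveDeriv fun t ↦ D.Q (u t) (X t)) :=
    SmoothFamilyAt.smoothForm_curveDeriv (sQ 0)
  rw [extD_sub (s1.add s2) s3, extD_add s1 s2, var₂, ← h1, ← h3]
  rw [lieForm, ← eq_sub_iff_add_eq] at h4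
  rw [h4]
  abel

/-- On shell, the presymplectic current is exact when contracted with an infinitesimal
diffeomorphism. -/
theorem var₂_θ (hD : D.IsAdmissible J ι 𝓕) {u : ℝ → M → V}
    (hu : IsCurveIn ρ I (D.solutions 𝓕) u) {X : ℝ → M → E}
    (hX : ∀ t x, SmoothFamilyAt I (vecInChart I) X t x) :
    var₂ D.θ (u 0) (lieField ρ I (X 0) (u 0)) (velocity u)
      = extD I (contract (X 0) (D.covθ I (u 0) (velocity u)) + D.Q (u 0) (curveDeriv X)
        - curveDeriv (fun t ↦ D.Q (u t) (X t))
        + var₂ D.lam (u 0) (lieField ρ I (X 0) (u 0)) (velocity u)) := by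
  have hA := 𝓕.smooth_configs
  have hc : IsCurveIn ρ I 𝓕.configs u := ⟨fun t ↦ (hu.mem t).1, hu.smooth⟩
  have hφ := hc.mem 0
  have hv := 𝓕.smooth_variations _ (FieldSpace.velocity_mem hc)
  have hK : SmoothField ρ I (lieField ρ I (X 0) (u 0)) :=
    SmoothField.lieField (fun x ↦ (hX 0 x).section) (hA _ hφ)
  have hθ := hD.local_θ.isSmoothOneForm
  have hb := (hD.local_b.isLocalOneForm_var hA).isSmoothOneForm
  have hl := hD.local_lam.isSmoothOneForm
  have h := var₂_covθ hD hu hX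
  -- `δ²b' = 0` and `δd = dδ`, so `δθ'` and `δ covθ` differ only by `dδλ'`.
  have h1 := var₂_sub hA (hθ.sub hb) (hl.extD hA) hφ hK hv
  rw [var₂_sub hA hθ hb hφ hK hv, hD.local_b.var₂_var hA hφ hK hv, sub_zero,
    var₂_extD hA hl hφ hK hv] at h1
  rw [extD_add (smoothForm_currentPotential hD hu hX) (hl.smoothForm_var₂ hA hφ hK hv), ← h]
  exact (sub_eq_iff_eq_add.1 h1.symm)

/-- The corner identity for the second variations. -/
theorem var₂_β (hι : ContMDiff J I ∞ ι) (hD : D.IsAdmissible J ι 𝓕) {φ v w : M → V}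
    (hφ : φ ∈ 𝓕.configs) (hv : v ∈ 𝓕.variations) (hw : w ∈ 𝓕.variations) :
    var₂ D.β φ v w = pullback I J ι (var₂ D.lam φ v w) + extD J (var₂ D.γ φ v w)
      + var₂ D.ε φ v w := by
  have hA := 𝓕.smooth_configs
  have hv' := 𝓕.smooth_variations v hv
  have hw' := 𝓕.smooth_variations w hw
  have hβ := hD.local_β.isSmoothOneForm
  have hc := (hD.local_c.isLocalOneForm_var hA).isSmoothOneForm
  have hl := hD.local_lam.isSmoothOneForm
  have hγ := hD.local_γ.isSmoothOneForm
  have hε := hD.local_ε.isSmoothOneForm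
  have h1 := hβ.add hc
  have h2 := ((hl.pullback hι).add (hγ.extD hA)).add hε
  -- Collecting `δc'` on the left makes it disappear under a second `δ`.
  have key : ∀ ψ ∈ 𝓕.configs, ∀ k ∈ 𝓕.variations, D.β ψ k + var D.c ψ k
      = pullback I J ι (D.lam ψ k) + extD J (D.γ ψ k) + D.ε ψ k := fun ψ hψ k hk ↦ by
    have h := hD.decomp_β ψ hψ k hk
    rw [← sub_eq_zero] at h ⊢
    rw [← h]
    abel
  -- The identity holds only on the field space, so `var_congr` is needed to vary it.
  have h3 : var₂ (fun ψ k ↦ D.β ψ k + var D.c ψ k) φ v w = var₂ (fun ψ k ↦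
      pullback I J ι (D.lam ψ k) + extD J (D.γ ψ k) + D.ε ψ k) φ v w := by
    rw [var₂, var₂, 𝓕.var_congr (h1.isLocalZeroForm hw') (h2.isLocalZeroForm hw')
      (fun ψ hψ ↦ key ψ hψ w hw) hφ hv, 𝓕.var_congr (h1.isLocalZeroForm hv')
      (h2.isLocalZeroForm hv') (fun ψ hψ ↦ key ψ hψ v hv) hφ hw]
  rw [var₂_add hA hβ hc hφ hv' hw', hD.local_c.var₂_var hA hφ hv' hw', add_zero,
    var₂_add hA ((hl.pullback hι).add (hγ.extD hA)) hε hφ hv' hw',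
    var₂_add hA (hl.pullback hι) (hγ.extD hA) hφ hv' hw', var₂_pullback hA hl hφ hv' hw',
    var₂_extD hA hγ hφ hv' hw'] at h3
  exact h3

/-- Applying `d` to the corner decomposition gives `dβ' - dλ' = -dδc' + dε`; inserting this into the
decomposition of `θ'` turns `covθ` into minus the variation of the full boundary term, plus fluxes.
-/
theorem var_boundary_add_pullback_covθ (hι : ContMDiff J I ∞ ι) (hD : D.IsAdmissible J ι 𝓕)
    {φ v : M → V} (hφ : φ ∈ 𝓕.configs) (hv : v ∈ 𝓕.variations) :
    var (fun ψ ↦ D.ell ψ + pullback I J ι (D.b ψ) + extD J (D.c ψ)) φ v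
      + pullback I J ι (D.covθ I φ v) = D.flux φ v + extD J (D.ε φ v) := by
  have hA := 𝓕.smooth_configs
  have hv' := 𝓕.smooth_variations v hv
  have sc := hD.local_c.smoothForm_var hA hφ hv'
  have sl := hD.local_lam.isSmoothOneForm.smoothForm hA hφ hv'
  have sβ := hD.local_β.isSmoothOneForm.smoothForm hA hφ hv'
  have sγ := hD.local_γ.isSmoothOneForm.smoothForm hA hφ hv'
  have sε := hD.local_ε.isSmoothOneForm.smoothForm hA hφ hv'
  have h := congrArg (extD J) (hD.decomp_β φ hφ v hv)
  rw [extD_sub sβ (sl.pullback hι), extD_add (sc.neg.add sγ.extD) sε, extD_add sc.neg sγ.extD,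
    extD_extD sγ, extD_neg] at h
  rw [var_add hA (hD.local_ell.add (hD.local_b.pullback hι)) hD.local_c.extD hφ hv',
    var_add hA hD.local_ell (hD.local_b.pullback hι) hφ hv', var_pullback hA hD.local_b hφ hv',
    var_extD hA hD.local_c hφ hv', covθ, pullback_sub, pullback_sub, hD.decomp_θ φ hφ v hv,
    pullback_extD hι sl]
  rw [← sub_eq_zero] at h ⊢
  rw [← h]
  abel

/-- The variation of the improved charge along a curve of solutions. -/
theorem hasDerivAt_improvedCharge (hι : ContMDiff J I ∞ ι) (hD : D.IsAdmissible J ι 𝓕)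
    (ξ : Generator J ι 𝓕) {slice : SmoothChain I M (m + 2)} {cut : SmoothChain J N (m + 1)}
    (hslice : ∀ η, SmoothForm I η →
      chainIntegral (chainBoundary slice) η = chainIntegral cut (pullback I J ι η))
    (hcut : ∀ η, SmoothForm J η → chainIntegral (chainBoundary cut) η = 0)
    {u : ℝ → M → V} (hu : IsCurveIn ρ I (D.solutions 𝓕) u) :
    HasDerivAt (fun t ↦ D.improvedCharge ξ cut (u t))
      (-D.symplecticForm slice cut (u 0) (lieField ρ I (ξ.vec (u 0)) (u 0)) (velocity u)
        + D.improvedFlux ξ cut (u 0) (velocity u)) 0 := by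
  have hA := 𝓕.smooth_configs
  have hc : IsCurveIn ρ I 𝓕.configs u := ⟨fun t ↦ (hu.mem t).1, hu.smooth⟩
  have hφ := hc.mem 0
  have hv := FieldSpace.velocity_mem hc
  have hv' := 𝓕.smooth_variations _ hv
  have hX := ξ.smooth u hc
  have hXN := ξ.smoothN u hc
  have hXt : ∀ t, SmoothVec I (ξ.vec (u t)) := fun t x ↦ (hX t x).section
  have hXNt : ∀ t, SmoothVec J (ξ.vecN (u t)) := fun t x ↦ (hXN t x).section
  have hK := 𝓕.lie_mem _ hφ _ (hXt 0)
  have hK' := 𝓕.smooth_variations _ hK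
  have hY := ξ.smoothVec_varVec hc
  have hYN := ξ.smoothVec_varVecN hc
  have hkt : ∀ t x, SmoothFamilyAt I (fieldInChart ρ I)
      (fun t ↦ lieField ρ I (ξ.vec (u t)) (u t)) t x := fun t x ↦
    (hX t x).lieField ρ (hc.smooth t x)
  have hε := hD.local_ε.isSmoothOneForm
  have hγ := hD.local_γ.isSmoothOneForm
  have hβ := hD.local_β.isSmoothOneForm
  have hB := (hD.local_ell.add (hD.local_b.pullback hι)).add hD.local_c.extD
  have hdQ : ∀ t x, SmoothFamilyAt I (formInChart I) (fun t ↦ D.Q (u t) (ξ.vec (u t))) t x :=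
    fun t x ↦ hD.local_Q.smooth ℝ u (fun t ↦ ξ.vec (u t)) t x (hc.mem t) (hc.smooth t x) (hX t x)
  have hT1 : ∀ t p, SmoothFamilyAt J (formInChart J)
      (fun t ↦ pullback I J ι (D.Q (u t) (ξ.vec (u t)))) t p := fun t p ↦ (hdQ t (ι p)).pullback hι
  have hBt : ∀ t p, SmoothFamilyAt J (formInChart J)
      (fun t ↦ D.ell (u t) + pullback I J ι (D.b (u t)) + extD J (D.c (u t))) t p := fun t p ↦
    hB ℝ u t p (hc.mem t) (hc.smooth t _)
  have hT3 : ∀ t p, SmoothFamilyAt J (formInChart J)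
      (fun t ↦ D.ε (u t) (lieField ρ I (ξ.vec (u t)) (u t))) t p := fun t p ↦
    hε.smooth ℝ u _ t p (hc.mem t) (hc.smooth t _) (hkt t _)
  have hR : ∀ t p, SmoothFamilyAt J (formInChart J) (fun t ↦ contract (ξ.vecN (u t)) (D.c (u t))
      - D.γ (u t) (lieField ρ I (ξ.vec (u t)) (u t))) t p := fun t p ↦
    ((hXN t p).contract (hD.local_c ℝ u t p (hc.mem t) (hc.smooth t _))).sub (isLinearRep_form _)
      (hγ.smooth ℝ u _ t p (hc.mem t) (hc.smooth t _) (hkt t _))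
  have hT2 := fun t p ↦ (hXN t p).contract (hBt t p)
  have hdens : (fun t ↦ D.improvedDensity ξ (u t)) = fun t ↦
      pullback I J ι (D.Q (u t) (ξ.vec (u t)))
        + contract (ξ.vecN (u t)) (D.ell (u t) + pullback I J ι (D.b (u t)) + extD J (D.c (u t)))
        - D.ε (u t) (lieField ρ I (ξ.vec (u t)) (u t))
        + extD J (contract (ξ.vecN (u t)) (D.c (u t))
          - D.γ (u t) (lieField ρ I (ξ.vec (u t)) (u t))) := by
    ext1 t
    exact improvedDensityAt_eq hD (hc.mem t) (hXt t) (hXNt t) (ξ.tangent _ (hc.mem t))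
  have hT12 := fun t p ↦ (hT1 t p).add (isLinearRep_form _) (hT2 t p)
  have hT123 := fun t p ↦ (hT12 t p).sub (isLinearRep_form _) (hT3 t p)
  have hsmooth : ∀ t p, SmoothFamilyAt J (formInChart J)
      (fun t ↦ D.improvedDensity ξ (u t)) t p := by
    rw [hdens]
    exact fun t p ↦ (hT123 t p).add (isLinearRep_form _) (hR t p).extD
  have hvel : velocity (fun t ↦ lieField ρ I (ξ.vec (u t)) (u t))
      = lieField ρ I (ξ.varVec (u 0) (velocity u)) (u 0)
        + lieField ρ I (ξ.vec (u 0)) (velocity u) := by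
    rw [← ξ.curveDeriv_vec hc]
    exact funext fun x ↦ (hasDerivAt_lieField ρ (hX 0 x) (hc.smooth 0 x)).deriv
  have hlin := hε.linear _ hφ (lieField ρ I (ξ.varVec (u 0) (velocity u)) (u 0))
    (lieField ρ I (ξ.vec (u 0)) (velocity u)) 1 1 (SmoothField.lieField hY (hA _ hφ))
    (SmoothField.lieField (hXt 0) hv')
  simp only [one_smul] at hlin
  -- the variation of the improved charge density
  have hder := congrArg curveDeriv hdens
  rw [curveDeriv_add (hT123 0) (fun p ↦ (hR 0 p).extD), curveDeriv_sub (hT12 0) (hT3 0),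
    curveDeriv_add (hT1 0) (hT2 0), curveDeriv_pullback (hdQ 0),
    curveDeriv_contract (fun p ↦ ξ.hasVarN u hc p) (hBt 0), curveDeriv_extD (hR 0),
    hε.curveDeriv_eq hA hc.smooth hφ hkt, hvel, hlin,
    hB.curveDeriv_eq hc.smooth hφ] at hder
  set φ := u 0
  set v := velocity u
  set X := ξ.vec φ
  set XN := ξ.vecN φ
  set Y := ξ.varVec φ v
  set YN := ξ.varVecN φ v
  set K := lieField ρ I X φ
  set R' := curveDeriv (fun t ↦ contract (ξ.vecN (u t)) (D.c (u t))
    - D.γ (u t) (lieField ρ I (ξ.vec (u t)) (u t)))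
  -- The potential of the contracted presymplectic current: `I_ξ̂ δθ' = dμ`.
  set μ := contract X (D.covθ I φ v) + D.Q φ Y - curveDeriv (fun t ↦ D.Q (u t) (ξ.vec (u t)))
    + var₂ D.lam φ K v
  -- All exact terms gathered: from the density of `ξ` and that of `δξ`, from `£_ξ ε` in the anomaly
  -- of `ε`, and from `δβ'`.
  set ν := R' - (contract YN (D.c φ) - D.γ φ (lieField ρ I Y φ)) - contract XN (D.ε φ v)
    - var₂ D.γ φ K v
  set Z := contract XN (D.flux φ v) - anomaly₁ ρ I J D.ε φ X XN Y v
    + D.improvedDensityAt ρ I J ι φ Y YN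
  have hY' : curveDeriv (fun t ↦ ξ.vec (u t)) = Y := ξ.curveDeriv_vec hc
  have sμ : SmoothForm I μ := by
    have h1 := (smoothForm_currentPotential hD hu hX).add
      (hD.local_lam.isSmoothOneForm.smoothForm_var₂ hA hφ hK' hv')
    rw [hY'] at h1
    exact h1
  have hθμ : var₂ D.θ φ K v = extD I μ := by
    have h1 := var₂_θ hD hu hX
    rw [hY'] at h1
    exact h1
  have sRY : SmoothForm J (contract YN (D.c φ) - D.γ φ (lieField ρ I Y φ)) :=
    (hYN.contract (hD.local_c.smoothForm hA hφ)).sub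
      (hγ.smoothForm hA hφ (SmoothField.lieField hY (hA _ hφ)))
  have sR' : SmoothForm J R' := SmoothFamilyAt.smoothForm_curveDeriv (hR 0)
  have sXε : SmoothForm J (contract XN (D.ε φ v)) := (hXNt 0).contract (hε.smoothForm hA hφ hv')
  have sγ₂ : SmoothForm J (var₂ D.γ φ K v) := hγ.smoothForm_var₂ hA hφ hK' hv'
  have sβ₂ : SmoothForm J (var₂ D.β φ K v) := hβ.smoothForm_var₂ hA hφ hK' hv'
  have sν : SmoothForm J ν := ((sR'.sub sRY).sub sXε).sub sγ₂
  have hcorner := var_boundary_add_pullback_covθ hι hD hφ hv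
  have hpμ : pullback I J ι μ = contract XN (pullback I J ι (D.covθ I φ v))
      + pullback I J ι (D.Q φ Y)
      - pullback I J ι (curveDeriv (fun t ↦ D.Q (u t) (ξ.vec (u t))))
      + pullback I J ι (var₂ D.lam φ K v) := by
    rw [pullback_add, pullback_sub, pullback_add, pullback_contract (ξ.tangent _ hφ)]
  -- The local balance law. The terms in `δQ_ξ` and `δλ'` cancel between the density, `μ` and `δβ'`;
  -- contracting `hcorner` with `ξ` produces `i_ξ 𝓔 + i_ξ dε`, and the remaining terms in `ε` form
  -- its anomaly.
  have hZ : Z = curveDeriv (fun t ↦ D.improvedDensity ξ (u t)) - var₂ D.β φ K v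
      + pullback I J ι μ - extD J ν := by
    have h1 : anomaly₁ ρ I J D.ε φ X XN Y v = var (fun ψ ↦ D.ε ψ v) φ K
        + D.ε φ (lieField ρ I X v) - lieForm J XN (D.ε φ v) :=
      anomaly₁_eq hA hε hφ hv' (hXt 0) hY XN
    have h3 : var₂ D.ε φ K v = var (fun ψ ↦ D.ε ψ v) φ K - var (fun ψ ↦ D.ε ψ K) φ v := rfl
    have h2 := congrArg (contract XN) hcorner
    rw [contract_add_form, contract_add_form] at h2
    simp only [Z]
    rw [h1, improvedDensityAt_eq hD hφ hY hYN (ξ.tangent_varVec hc), hder, hpμ,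
      extD_sub ((sR'.sub sRY).sub sXε) sγ₂, extD_sub (sR'.sub sRY) sXε, extD_sub sR' sRY,
      var₂_β hι hD hφ hK hv, lieForm, h3]
    rw [← sub_eq_zero] at h2 ⊢
    rw [← neg_eq_zero, ← h2]
    abel
  have sD : SmoothForm J (curveDeriv (fun t ↦ D.improvedDensity ξ (u t))) :=
    SmoothFamilyAt.smoothForm_curveDeriv (hsmooth 0)
  refine (hasDerivAt_chainIntegral cut hsmooth).congr_deriv ?_
  have e1 : D.improvedFlux ξ cut φ v = chainIntegral cut Z := rfl
  -- Stokes is used twice: `dν` vanishes on the closed cut, and `dμ` on the slice becomes `μ` on the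
  -- cut.
  rw [e1, hZ, chainIntegral_sub cut ((sD.sub sβ₂).add (sμ.pullback hι)) sν.extD,
    chainIntegral_add cut (sD.sub sβ₂) (sμ.pullback hι), chainIntegral_sub cut sD sβ₂,
    chainIntegral_extD cut sν, hcut ν sν, symplecticForm, hθμ, chainIntegral_extD slice sμ,
    hslice μ sμ]
  ring

end PhaseSpaceData

end Charges

/-! ### Invariance under the `e` and `f` ambiguities. -/

section Ambiguities

variable {E : Type*} [NormedAddCommGroup E] [NormedSpace ℝ E] [FiniteDimensional ℝ E]
  {V : Type*} [NormedAddCommGroup V] [NormedSpace ℝ V] [FiniteDimensional ℝ V]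
  {ρ : FieldType E V}
  {H : Type*} [TopologicalSpace H] {I : ModelWithCorners ℝ E H}
  {M : Type*} [TopologicalSpace M] [ChartedSpace H M] [IsManifold I ∞ M]
  {F : Type*} [NormedAddCommGroup F] [NormedSpace ℝ F] [FiniteDimensional ℝ F]
  {G : Type*} [TopologicalSpace G] {J : ModelWithCorners ℝ F G}
  {N : Type*} [TopologicalSpace N] [ChartedSpace G N] [IsManifold J ∞ N] {ι : N → M}
  {𝓕 : FieldSpace ρ I M}

namespace PhaseSpaceData

variable {m : ℕ} {D : PhaseSpaceData E V M F N m}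
  {e : (M → V) → M → E [⋀^Fin (m + 1)]→L[ℝ] ℝ} {f : (M → V) → N → F [⋀^Fin (m + 1)]→L[ℝ] ℝ}

theorem covL_shift (he : IsLocalZeroForm ρ I I id 𝓕.configs e) (hD : D.IsAdmissible J ι 𝓕)
    {φ : M → V} (hφ : φ ∈ 𝓕.configs) : (D.shift I J ι e f).covL I φ = D.covL I φ := by
  have hA := 𝓕.smooth_configs
  have se := he.smoothForm hA hφ
  have sb := hD.local_b.smoothForm hA hφ
  simp only [covL, shift]
  rw [extD_add sb se.extD, extD_extD se, add_zero]

theorem var_b_shift (he : IsLocalZeroForm ρ I I id 𝓕.configs e) (hD : D.IsAdmissible J ι 𝓕)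
    {φ v : M → V} (hφ : φ ∈ 𝓕.configs) (hv : SmoothField ρ I v) :
    var (fun ψ ↦ D.b ψ + extD I (e ψ)) φ v = var D.b φ v + extD I (var e φ v) := by
  have hA := 𝓕.smooth_configs
  rw [var_add hA hD.local_b he.extD hφ hv, var_extD hA he hφ hv]

/-- The form `dδe` enters with opposite signs through `b'` and `λ'`. Since `covL` is also unchanged,
the same `Q_ξ` satisfies the Noether identity. -/
theorem covθ_shift (he : IsLocalZeroForm ρ I I id 𝓕.configs e) (hD : D.IsAdmissible J ι 𝓕)
    {φ v : M → V} (hφ : φ ∈ 𝓕.configs) (hv : SmoothField ρ I v) :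
    (D.shift I J ι e f).covθ I φ v = D.covθ I φ v := by
  have hA := 𝓕.smooth_configs
  have sl := hD.local_lam.isSmoothOneForm.smoothForm hA hφ hv
  have se := he.smoothForm_var hA hφ hv
  simp only [covθ, shift]
  rw [var_b_shift he hD hφ hv, extD_sub sl se]
  abel

/-- The defining equations are invariant under the ambiguities. -/
theorem isAdmissible_shift (hι : ContMDiff J I ∞ ι) (hD : D.IsAdmissible J ι 𝓕)
    (he : IsLocalZeroForm ρ I I id 𝓕.configs e) (hf : IsLocalZeroForm ρ I J ι 𝓕.configs f) :
    (D.shift I J ι e f).IsAdmissible J ι 𝓕 where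
  local_L := hD.local_L
  local_θ := hD.local_θ
  local_b := hD.local_b.add he.extD
  local_lam := hD.local_lam.sub (he.isLocalOneForm_var 𝓕.smooth_configs)
  local_Q := hD.local_Q
  local_ell := hD.local_ell.add hf.extD
  local_β := hD.local_β.add (hf.isLocalOneForm_var 𝓕.smooth_configs)
  local_flux := hD.local_flux
  local_c := (hD.local_c.sub hf).sub (he.pullback hι)
  local_γ := hD.local_γ
  local_ε := hD.local_ε
  var_L := hD.var_L
  anomaly_L φ hφ X hX := by
    have hA := 𝓕.smooth_configs
    have hK := 𝓕.smooth_variations _ (𝓕.lie_mem φ hφ X hX)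
    have se := he.smoothForm hA hφ
    have sb := hD.local_b.smoothForm hA hφ
    have se' := he.smoothForm_var hA hφ hK
    have sb' := hD.local_b.smoothForm_var hA hφ hK
    -- The added anomaly of `de` is exact, because `£_ξ de = d i_ξ de`; it is therefore annihilated
    -- by the outer `d`.
    have h : anomaly ρ I I (fun ψ ↦ D.b ψ + extD I (e ψ)) φ X X
        = anomaly ρ I I D.b φ X X
          + extD I (var e φ (lieField ρ I X φ) - contract X (extD I (e φ))) := by
      simp only [anomaly, lieForm]
      rw [var_b_shift he hD hφ hK, contract_add_form, extD_add sb se.extD, extD_extD se, add_zero,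
        extD_add (hX.contract sb) (hX.contract se.extD), extD_sub se' (hX.contract se.extD)]
      abel
    have sa : SmoothForm I (anomaly ρ I I D.b φ X X) :=
      sb'.sub ((hX.contract sb).extD.add (hX.contract sb.extD))
    have s1 := se'.sub (hX.contract se.extD)
    have h2 := hD.anomaly_L φ hφ X hX
    change anomaly ρ I I D.L φ X X = extD I (anomaly ρ I I (fun ψ ↦ D.b ψ + extD I (e ψ)) φ X X)
    rw [h, extD_add sa s1.extD, extD_extD s1, add_zero, h2]
  anomaly_θ φ hφ v hv X hX := by
    have hA := 𝓕.smooth_configs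
    have hv' := 𝓕.smooth_variations v hv
    have hKm := 𝓕.lie_mem φ hφ X hX
    have hK := 𝓕.smooth_variations _ hKm
    have hXv : SmoothField ρ I (lieField ρ I X v) := SmoothField.lieField hX hv'
    have h0 : SmoothVec I (0 : M → E) := fun x ↦ SmoothSectionAt.zero isLinearRep_vec x
    have hb := (hD.local_b.isLocalOneForm_var hA).isSmoothOneForm
    have hl := hD.local_lam.isSmoothOneForm
    have he' := (he.isLocalOneForm_var hA).isSmoothOneForm
    have hbs := ((hD.local_b.add he.extD).isLocalOneForm_var hA).isSmoothOneForm
    have sb := hb.smoothForm hA hφ hv'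
    have sl := hl.smoothForm hA hφ hv'
    have se := he'.smoothForm hA hφ hv'
    have slX := hl.smoothForm hA hφ hXv
    have seX := he'.smoothForm hA hφ hXv
    have slK := (hl.isLocalZeroForm hv').smoothForm_var hA hφ hK
    have seK := (he'.isLocalZeroForm hv').smoothForm_var hA hφ hK
    have sLl : SmoothForm I (lieForm I X (D.lam φ v)) :=
      (hX.contract sl).extD.add (hX.contract sl.extD)
    have sLe : SmoothForm I (lieForm I X (var e φ v)) :=
      (hX.contract se).extD.add (hX.contract se.extD)
    have h := hD.anomaly_θ φ hφ v hv X hX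
    rw [anomaly₁_eq hA hb hφ hv' hX h0, anomaly₁_eq hA hl hφ hv' hX h0] at h
    change anomaly₁ ρ I I D.θ φ X X 0 v
      = anomaly₁ ρ I I (var fun ψ ↦ D.b ψ + extD I (e ψ)) φ X X 0 v
        + extD I (anomaly₁ ρ I I (fun ψ k ↦ D.lam ψ k - var e ψ k) φ X X 0 v)
    rw [h, anomaly₁_eq hA hbs hφ hv' hX h0, anomaly₁_eq hA (hl.sub he') hφ hv' hX h0]
    -- The inner variation is rewritten only at fields of the field space, so `var_congr` justifies
    -- varying it again. The anomaly of `dδe` is then `d` of the anomaly of `δe`, and it cancels the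
    -- contribution of the shifted `λ'`.
    have e1 : var (fun ψ ↦ var (fun ψ ↦ D.b ψ + extD I (e ψ)) ψ v) φ (lieField ρ I X φ)
        = var (fun ψ ↦ var D.b ψ v) φ (lieField ρ I X φ)
          + extD I (var (fun ψ ↦ var e ψ v) φ (lieField ρ I X φ)) := by
      rw [𝓕.var_congr (hbs.isLocalZeroForm hv') ((hb.add (he'.extD hA)).isLocalZeroForm hv')
        (fun ψ hψ ↦ var_b_shift he hD hψ hv') hφ hKm,
        var_add hA (hb.isLocalZeroForm hv') ((he'.extD hA).isLocalZeroForm hv') hφ hK,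
        var_extD hA (he'.isLocalZeroForm hv') hφ hK]
    have e2 : lieForm I X (var D.b φ v + extD I (var e φ v))
        = lieForm I X (var D.b φ v) + extD I (lieForm I X (var e φ v)) := by
      simp only [lieForm]
      rw [extD_add sb se.extD, extD_extD se, add_zero, contract_add_form,
        extD_add (hX.contract sb) (hX.contract se.extD),
        extD_add (hX.contract se).extD (hX.contract se.extD), extD_extD (hX.contract se)]
      abel
    have e3 : lieForm I X (D.lam φ v - var e φ v)
        = lieForm I X (D.lam φ v) - lieForm I X (var e φ v) := by
      simp only [lieForm]
      rw [extD_sub sl se, contract_sub_form, contract_sub_form,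
        extD_sub (hX.contract sl) (hX.contract se)]
      abel
    rw [e1, e3, var_b_shift he hD hφ hv', var_b_shift he hD hφ hXv, e2,
      var_sub hA (hl.isLocalZeroForm hv') (he'.isLocalZeroForm hv') hφ hK,
      extD_sub (slK.add slX) sLl, extD_add slK slX,
      extD_sub ((slK.sub seK).add (slX.sub seX)) (sLl.sub sLe),
      extD_add (slK.sub seK) (slX.sub seX), extD_sub slK seK, extD_sub slX seX, extD_sub sLl sLe]
    abel
  noether φ hφ X hX := by
    have hφ' : φ ∈ D.solutions 𝓕 := hφ
    have hK := 𝓕.smooth_variations _ (𝓕.lie_mem φ hφ'.1 X hX)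
    rw [covL_shift he hD hφ'.1, covθ_shift he hD hφ'.1 hK]
    exact hD.noether φ hφ' X hX
  decomp_θ φ hφ v hv := by
    have hA := 𝓕.smooth_configs
    have hv' := 𝓕.smooth_variations v hv
    have h := hD.decomp_θ φ hφ v hv
    simp only [shift]
    rw [h, var_add hA hD.local_ell hf.extD hφ hv', var_extD hA hf hφ hv',
      extD_add (hD.local_β.isSmoothOneForm.smoothForm hA hφ hv') (hf.smoothForm_var hA hφ hv')]
    abel
  decomp_β φ hφ v hv := by
    have hA := 𝓕.smooth_configs
    have hv' := 𝓕.smooth_variations v hv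
    have h := hD.decomp_β φ hφ v hv
    simp only [shift]
    -- The shift of `c'` contributes `δf + δe`, equal to the `δf` in `β'` plus the `δe` in `-λ'`;
    -- hence `γ'` and `ε` may stay fixed.
    rw [var_sub hA (hD.local_c.sub hf) (he.pullback hι) hφ hv',
      var_sub hA hD.local_c hf hφ hv', var_pullback hA he hφ hv', pullback_sub]
    rw [← sub_eq_zero] at h ⊢
    rw [← h]
    abel

/-- By the closed formula: `ℓ' + b' + dc'` is invariant, since `df` and `de` are compensated by the
shift of `c'`. Only `d i_ξ c'` changes. -/
theorem improvedDensity_shift (hι : ContMDiff J I ∞ ι) (hD : D.IsAdmissible J ι 𝓕)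
    (he : IsLocalZeroForm ρ I I id 𝓕.configs e) (hf : IsLocalZeroForm ρ I J ι 𝓕.configs f)
    (ξ : Generator J ι 𝓕) {φ : M → V} (hφ : φ ∈ 𝓕.configs) :
    (D.shift I J ι e f).improvedDensity ξ φ = D.improvedDensity ξ φ
      - extD J (contract (ξ.vecN φ) (pullback I J ι (e φ) + f φ)) := by
  have hA := 𝓕.smooth_configs
  have hX := ξ.smoothVec hφ
  have hXN := ξ.smoothVecN hφ
  have sc := hD.local_c.smoothForm hA hφ
  have sf := hf.smoothForm hA hφ
  have se := he.smoothForm hA hφ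
  have sp := se.pullback hι
  have sγ := hD.local_γ.isSmoothOneForm.smoothForm hA hφ (SmoothField.lieField hX (hA φ hφ))
  rw [improvedDensity, improvedDensity,
    improvedDensityAt_eq (isAdmissible_shift hι hD he hf) hφ hX hXN (ξ.tangent φ hφ),
    improvedDensityAt_eq hD hφ hX hXN (ξ.tangent φ hφ)]
  have s1 := hXN.contract sc
  have s2 := hXN.contract sf
  have s3 := hXN.contract sp
  simp only [shift, pullback_add, contract_add_form, contract_sub_form]
  rw [pullback_extD hι se, extD_sub (sc.sub sf) sp, extD_sub sc sf,
    extD_sub ((s1.sub s2).sub s3) sγ, extD_sub (s1.sub s2) s3, extD_sub s1 s2, extD_add s3 s2,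
    extD_sub s1 sγ]
  simp only [contract_sub_form]
  abel

theorem smoothForm_improvedDensity (hι : ContMDiff J I ∞ ι) (hD : D.IsAdmissible J ι 𝓕)
    (ξ : Generator J ι 𝓕) {φ : M → V} (hφ : φ ∈ 𝓕.configs) :
    SmoothForm J (D.improvedDensity ξ φ) := by
  have hA := 𝓕.smooth_configs
  have hX := ξ.smoothVec hφ
  have hXN := ξ.smoothVecN hφ
  have hK := SmoothField.lieField hX (hA φ hφ)
  rw [improvedDensity, improvedDensityAt_eq hD hφ hX hXN (ξ.tangent φ hφ)]
  have sQ : SmoothForm I (D.Q φ (ξ.vec φ)) := fun x ↦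
    (hD.local_Q.smooth ℝ (fun _ ↦ φ) (fun _ ↦ ξ.vec φ) 0 x hφ
      ((hA _ hφ x).family 0) ((hX x).family 0)).section
  exact (((sQ.pullback hι).add (hXN.contract (((hD.local_ell.add
    (hD.local_b.pullback hι)).add hD.local_c.extD).smoothForm hA hφ))).sub
    (hD.local_ε.isSmoothOneForm.smoothForm hA hφ hK)).add
    ((hXN.contract (hD.local_c.smoothForm hA hφ)).sub
      (hD.local_γ.isSmoothOneForm.smoothForm hA hφ hK)).extD

/-- The improved charge is invariant under the ambiguities. -/
theorem improvedCharge_shift (hι : ContMDiff J I ∞ ι) (hD : D.IsAdmissible J ι 𝓕)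
    (he : IsLocalZeroForm ρ I I id 𝓕.configs e) (hf : IsLocalZeroForm ρ I J ι 𝓕.configs f)
    (ξ : Generator J ι 𝓕) {cut : SmoothChain J N (m + 1)}
    (hcut : ∀ η, SmoothForm J η → chainIntegral (chainBoundary cut) η = 0)
    {φ : M → V} (hφ : φ ∈ 𝓕.configs) :
    (D.shift I J ι e f).improvedCharge ξ cut φ = D.improvedCharge ξ cut φ := by
  have hA := 𝓕.smooth_configs
  have s := (ξ.smoothVecN hφ).contract
    (((he.smoothForm hA hφ).pullback hι).add (hf.smoothForm hA hφ))
  rw [improvedCharge, improvedCharge, improvedDensity_shift hι hD he hf ξ hφ,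
    chainIntegral_sub cut (smoothForm_improvedDensity hι hD ξ hφ) s.extD,
    chainIntegral_extD cut s, hcut _ s, sub_zero]

end PhaseSpaceData

end Ambiguities

end CovariantPhaseSpace

end

/-! ### The main theorem, assembled. -/

theorem mainTheorem4 {m : ℕ}
    {E : Type*} [NormedAddCommGroup E] [NormedSpace ℝ E] [FiniteDimensional ℝ E]
    {V : Type*} [NormedAddCommGroup V] [NormedSpace ℝ V] [FiniteDimensional ℝ V]
    {H : Type*} [TopologicalSpace H] (I : ModelWithCorners ℝ E H)
    {M : Type*} [TopologicalSpace M] [ChartedSpace H M] [IsManifold I ∞ M]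
    {F : Type*} [NormedAddCommGroup F] [NormedSpace ℝ F] [FiniteDimensional ℝ F]
    {G : Type*} [TopologicalSpace G] (J : ModelWithCorners ℝ F G)
    {N : Type*} [TopologicalSpace N] [ChartedSpace G N] [IsManifold J ∞ N]
    (hE : Module.finrank ℝ E = m + 3) (hF : Module.finrank ℝ F = m + 2)
    -- the hypersurface `N` in spacetime `M`
    (ι : N → M) (hι : ContMDiff J I ∞ ι) (hemb : Topology.IsEmbedding ι)
    (himm : ∀ p, Function.Injective (mfderiv J I ι p))
    (ρ : FieldType E V) (𝓕 : FieldSpace ρ I M)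
    (D : PhaseSpaceData E V M F N m) (hD : D.IsAdmissible J ι 𝓕)
    (ξ : Generator J ι 𝓕)
    -- the slice `Σ` in `M`, and its boundary, a closed cut of `N`
    (slice : SmoothChain I M (m + 2)) (cut : SmoothChain J N (m + 1))
    (hslice : ∀ η, SmoothForm I η →
      chainIntegral (chainBoundary slice) η = chainIntegral cut (pullback I J ι η))
    (hcut : ∀ η, SmoothForm J η → chainIntegral (chainBoundary cut) η = 0) :
    -- `δH_ξ = -I_ξ̂ Ω + 𝓕_ξ̂` on the solution space, for the improved charge and flux
    (∀ u : ℝ → M → V, IsCurveIn ρ I (D.solutions 𝓕) u →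
      HasDerivAt (fun t ↦ D.improvedCharge ξ cut (u t))
        (-D.symplecticForm slice cut (u 0) (lieField ρ I (ξ.vec (u 0)) (u 0)) (velocity u)
          + D.improvedFlux ξ cut (u 0) (velocity u)) 0) ∧
    -- `h_ξ - Δ_ξ̂ c' = Q_ξ + i_ξ (ℓ' + b' + dc') - I_ξ̂ ε + d (i_ξ c' - I_ξ̂ γ')`
    (∀ φ ∈ 𝓕.configs,
      D.improvedDensity ξ φ = pullback I J ι (D.Q φ (ξ.vec φ))
        + contract (ξ.vecN φ) (D.ell φ + pullback I J ι (D.b φ) + extD J (D.c φ))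
        - D.ε φ (lieField ρ I (ξ.vec φ) φ)
        + extD J (contract (ξ.vecN φ) (D.c φ) - D.γ φ (lieField ρ I (ξ.vec φ) φ))) ∧
    -- invariance under the `e` and `f` ambiguities
    (∀ e f, IsLocalZeroForm ρ I I id 𝓕.configs e → IsLocalZeroForm ρ I J ι 𝓕.configs f →
      (D.shift I J ι e f).IsAdmissible J ι 𝓕 ∧
      ∀ φ ∈ 𝓕.configs,
        (D.shift I J ι e f).improvedDensity ξ φ = D.improvedDensity ξ φ
          - extD J (contract (ξ.vecN φ) (pullback I J ι (e φ) + f φ)) ∧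
        (D.shift I J ι e f).improvedCharge ξ cut φ = D.improvedCharge ξ cut φ) := by
  refine ⟨fun u hu ↦ PhaseSpaceData.hasDerivAt_improvedCharge hι hD ξ hslice hcut hu,
    fun φ hφ ↦ PhaseSpaceData.improvedDensityAt_eq hD hφ (ξ.smoothVec hφ) (ξ.smoothVecN hφ)
      (ξ.tangent φ hφ), fun e f he hf ↦ ⟨PhaseSpaceData.isAdmissible_shift hι hD he hf,
      fun φ hφ ↦ ⟨PhaseSpaceData.improvedDensity_shift hι hD he hf ξ hφ,
        PhaseSpaceData.improvedCharge_shift hι hD he hf ξ hcut hφ⟩⟩⟩
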